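/- Let $\rho\in(0,1)$ and let $c\neq 0$ be a real number. Let $(a_n)_{n\ge1}$, $(b_n)_{n\ge1}$ be sequences of positive integers with $$a_n+b_n=2n,\qquad \frac{a_n}{2n}=\rho+o\Bigl(\frac1{\sqrt n}\Bigr)\quad(n\to\infty).$$ For each $n$, choose a random Young diagram $\pi$ (the diagram of a partition $\pi_1\ge\dots\ge\pi_{a_n}\ge0$ with $\pi_1\le b_n$, having $\pi_j$ unit squares in its $j$-th column) inside the box $[0,a_n]\times[0,b_n]$ with probability proportional to $q^{|\pi|}$, where $|\pi|=\sum_j\pi_j$ is its area and $q=e^{-c/n}$. Rotate the picture so that the boundary of the diagram becomes a lattice path $(X_k)_{0\le k\le 2n}$ with steps $\pm1$ from $(0,0)$ to $(2n,b_n-a_n)$, having $a_n$ steps $-1$ and $b_n$ steps $+1$, with the diagram lying between this path and the lowest path, which goes from $(0,0)$ to the corner $(a_n,-a_n)$ and then up to $(2n,b_n-a_n)$ (so $|\pi|$ is the number of pairs formed by a step $+1$ and a later step $-1$). Extend $X$ to $[0,2n]$ by linear interpolation. For $s\in[0,1]$ put $$L_{\rho,c}(s)=1-2\rho+\frac1c\log\frac{\sinh(cs)+e^{c(2\rho-1)}\sinh(c(1-s))}{\sinh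 c},\qquad \tilde X^{(n)}_s=\sqrt n\Bigl(\frac1{2n}X_{2ns}-L_{\rho,c}(s)\Bigr),$$ $$f(s)=\frac1{\sqrt2}\,\frac{\sqrt{(e^{2c\rho}-1)(1-e^{-2c(1-\rho)})}}{\sinh(cs)+e^{c(2\rho-1)}\sinh(c(1-s))}.$$ Then the processes $(\tilde X^{(n)}_s/f(s))_{s\in[0,1]}$ converge weakly, as $n\to\infty$, in the space $D[0,1]$ of càdlàg paths with the Skorokhod topology, to the Ornstein–Uhlenbeck bridge with parameter $c$, that is, to the centered Gaussian process $(Y_s)_{s\in[0,1]}$ with covariance $$\mathbb E[Y_sY_t]=\frac{\sinh(cs)\,\sinh(c(1-t))}{c\,\sinh c},\qquad 0\le s\le t\le1.$$ -/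

import Mathlib

open MeasureTheory ProbabilityTheory Filter Topology Asymptotics
open scoped ENNReal unitInterval

noncomputable section

namespace BoxedDiagrams

/-! ### The space `D[0,1]` of càdlàg paths with the Skorokhod topology -/

/-- A real càdlàg path on `[0,1]`: right-continuous, with left limits. -/
structure CadlagPath where
  toFun : I → ℝ
  right_continuous : ∀ t, ContinuousWithinAt toFun (Set.Ici t) t
  left_limit : ∀ t, ∃ l, Tendsto toFun (𝓝[<] t) (𝓝 l)

instance : CoeFun CadlagPath (fun _ => I → ℝ) := ⟨CadlagPath.toFun⟩

/-- A continuous path, seen as a càdlàg path. -/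
def CadlagPath.ofContinuous (g : I → ℝ) (hg : Continuous g) : CadlagPath where
  toFun := g
  right_continuous _ := hg.continuousWithinAt
  left_limit t := ⟨g t, hg.continuousWithinAt⟩

/-- How far `x` is from `y` after the time change `φ`, an increasing homeomorphism of `[0,1]`:
`max (sup |φ t - t|) (sup |x t - y (φ t)|)`. -/
def timeChangeCost (φ : I ≃o I) (x y : CadlagPath) : ℝ≥0∞ :=
  max (⨆ t : I, edist (φ t) t) (⨆ t : I, edist (x t) (y (φ t)))

/-- The Skorokhod (J1) distance: the infimum of the cost over all increasing homeomorphisms of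
`[0,1]`. It defines the usual topology of `D[0,1]`. -/
instance : PseudoEMetricSpace CadlagPath where
  edist x y := ⨅ φ : I ≃o I, timeChangeCost φ x y
  edist_self x := by
    refine le_antisymm ((iInf_le _ (OrderIso.refl I)).trans ?_) zero_le
    simp [timeChangeCost]
  edist_comm := by
    have key : ∀ x y : CadlagPath,
        (⨅ φ : I ≃o I, timeChangeCost φ x y) ≤ ⨅ φ : I ≃o I, timeChangeCost φ y x := by
      intro x y
      refine le_iInf fun φ => (iInf_le _ φ.symm).trans ?_
      refine max_le_max (iSup_le fun t => ?_) (iSup_le fun t => ?_)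
      · refine le_trans ?_ (le_iSup _ (φ.symm t))
        rw [φ.apply_symm_apply, edist_comm]
      · refine le_trans ?_ (le_iSup _ (φ.symm t))
        rw [φ.apply_symm_apply, edist_comm]
    exact fun x y => le_antisymm (key x y) (key y x)
  edist_triangle x y z := by
    refine ENNReal.le_iInf_add_iInf fun φ ψ => (iInf_le _ (φ.trans ψ)).trans ?_
    refine max_le (iSup_le fun t => ?_) (iSup_le fun t => ?_)
    · calc edist ((φ.trans ψ) t) t ≤ edist (φ t) t + edist (ψ (φ t)) (φ t) := by
            rw [add_comm]; exact edist_triangle _ _ _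
        _ ≤ _ := add_le_add
            ((le_iSup (fun t : I => edist (φ t) t) t).trans (le_max_left _ _))
            ((le_iSup (fun t : I => edist (ψ t) t) (φ t)).trans (le_max_left _ _))
    · calc edist (x t) (z ((φ.trans ψ) t)) ≤ edist (x t) (y (φ t))
              + edist (y (φ t)) (z (ψ (φ t))) := edist_triangle _ _ _
        _ ≤ _ := add_le_add
            ((le_iSup (fun t : I => edist (x t) (y (φ t))) t).trans (le_max_right _ _))
            ((le_iSup (fun t : I => edist (y t) (z (ψ t))) (φ t)).trans (le_max_right _ _))

/-- `D[0,1]` carries the Borel σ-algebra of the Skorokhod topology. -/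
instance : MeasurableSpace CadlagPath := borel CadlagPath

instance : BorelSpace CadlagPath := ⟨rfl⟩

/-! ### Random Young diagrams in a box -/

/-- A partition whose Young diagram fits in the box `[0,a] × [0,b]`: a non-increasing sequence
`π 0 ≥ π 1 ≥ … ≥ π (a-1)` of integers between `0` and `b`. The Young diagram has `π j` unit squares
in column `j`; trailing zeros are empty columns. -/
def BoxPartition (a b : ℕ) : Type := {π : Fin a → Fin (b + 1) // Antitone π}

instance (a b : ℕ) : Fintype (BoxPartition a b) :=
  @Subtype.fintype _ _ (Classical.decPred _) _

instance (a b : ℕ) : Nonempty (BoxPartition a b) := ⟨⟨fun _ => 0, fun _ _ _ => le_rfl⟩⟩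

instance (a b : ℕ) : MeasurableSpace (BoxPartition a b) := ⊤

/-- The area `|π|` of the diagram: its number of unit squares. -/
def BoxPartition.area {a b : ℕ} (π : BoxPartition a b) : ℕ := ∑ j, (π.1 j : ℕ)

/-- The partition function, the sum of `q ^ |π|` over the diagrams in the box. -/
def partitionFunction (a b : ℕ) (q : ℝ) : ℝ := ∑ π : BoxPartition a b, q ^ π.area

/-- The probability measure giving each diagram `π` in the box the mass `q ^ |π| / Z`. -/
def boxMeasure (a b : ℕ) (q : ℝ) : Measure (BoxPartition a b) :=
  ∑ π : BoxPartition a b,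
    ENNReal.ofReal (q ^ π.area / partitionFunction a b q) • Measure.dirac π

/-- `boxMeasure` as a bundled probability measure, for `q > 0`. -/
def boxLaw (a b : ℕ) (q : ℝ) (hq : 0 < q) : ProbabilityMeasure (BoxPartition a b) :=
  ⟨boxMeasure a b q, ⟨by
    have hZ : 0 < partitionFunction a b q :=
      Finset.sum_pos (fun π _ => pow_pos hq _) Finset.univ_nonempty
    simp only [boxMeasure, Measure.finsetSum_apply, Measure.smul_apply, measure_univ, smul_eq_mul,
      mul_one]
    rw [← ENNReal.ofReal_sum_of_nonneg fun π _ => (div_pos (pow_pos hq _) hZ).le,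
      ← Finset.sum_div]
    exact (congrArg ENNReal.ofReal (div_self hZ.ne')).trans ENNReal.ofReal_one⟩⟩

/-- The boundary lattice path `X_k` of the diagram, `0 ≤ k ≤ a + b`, in the coordinates where the
box has corners `(0,0)`, `(a,-a)`, `(b,b)`, `(a+b,b-a)`, the diagram filling the box from its lowest
corner `(a,-a)`. The path has `a` steps `-1` and `b` steps `+1`; the step `-1` along the top of
column `j` (columns are met in the order `a-1, …, 0`) is preceded by `a-1-j` steps `-1` and by
`π j` steps `+1`. -/
def BoxPartition.boundary {a b : ℕ} (π : BoxPartition a b) (k : ℕ) : ℤ :=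
  k - 2 * (Finset.univ.filter fun j : Fin a => a - 1 - (j : ℕ) + (π.1 j : ℕ) < k).card

/-- Piecewise linear interpolation of a sequence of reals, for real times `s ≥ 0`. -/
def linearInterp (x : ℕ → ℝ) (s : ℝ) : ℝ :=
  x ⌊s⌋₊ + (s - ⌊s⌋₊) * (x (⌊s⌋₊ + 1) - x ⌊s⌋₊)

theorem continuousOn_linearInterp (x : ℕ → ℝ) : ContinuousOn (linearInterp x) (Set.Ici 0) := by
  have hcov : Set.Ici (0 : ℝ) ⊆ ⋃ n : ℕ, Set.Icc (n : ℝ) (n + 1) := fun s hs =>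
    Set.mem_iUnion.2 ⟨⌊s⌋₊, Nat.floor_le hs, (Nat.lt_floor_add_one s).le⟩
  refine ContinuousOn.mono ?_ hcov
  refine LocallyFinite.continuousOn_iUnion ?_ (fun n => isClosed_Icc) (fun n => ?_)
  · refine fun s => ⟨Set.Iio (s + 1), Iio_mem_nhds (lt_add_one s), ?_⟩
    refine (Set.finite_Iic ⌈s + 1⌉₊).subset ?_
    rintro n ⟨y, hy, hys⟩
    exact Set.mem_Iic.2 (by exact_mod_cast (hy.1.trans hys.le).trans (Nat.le_ceil (s + 1)))
  · have h : Set.EqOn (linearInterp x) (fun s => x n + (s - n) * (x (n + 1) - x n))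
        (Set.Icc (n : ℝ) (n + 1)) := by
      intro s hs
      rcases hs.2.lt_or_eq with h1 | h1
      · have hf : ⌊s⌋₊ = n := (Nat.floor_eq_iff (n.cast_nonneg.trans hs.1)).2 ⟨hs.1, h1⟩
        simp [linearInterp, hf]
      · have hf : ⌊s⌋₊ = n + 1 := by
          rw [h1]; exact_mod_cast Nat.floor_natCast (n + 1)
        simp [linearInterp, hf]
        rw [h1]; ring
    exact ContinuousOn.congr (by fun_prop) h

/-! ### Limit shape and fluctuations -/

/-- The limit shape `L_{ρ,c}`. -/
def limitShape (ρ c t : ℝ) : ℝ :=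
  1 - 2 * ρ + 1 / c * Real.log
    ((Real.sinh (c * t) + Real.exp (c * (2 * ρ - 1)) * Real.sinh (c * (1 - t))) / Real.sinh c)

/-- The normalizing function `f`. -/
def fluctScale (ρ c s : ℝ) : ℝ :=
  1 / √2 * (√((Real.exp (2 * c * ρ) - 1) * (1 - Real.exp (-2 * c * (1 - ρ)))) /
    (Real.sinh (c * s) + Real.exp (c * (2 * ρ - 1)) * Real.sinh (c * (1 - s))))

/-- The fluctuation `√n (X_{2nt} / (2n) - L_{ρ,c}(t))` of the boundary of the diagram `π`. -/
def fluctuation (ρ c : ℝ) (n : ℕ) {a b : ℕ} (π : BoxPartition a b) (t : ℝ) : ℝ :=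
  √n * (1 / (2 * n) * linearInterp (fun k => (π.boundary k : ℝ)) (2 * n * t) - limitShape ρ c t)

theorem sinh_comb_pos (ρ c : ℝ) (hc : c ≠ 0) (t : I) :
    0 < (Real.sinh (c * t) + Real.exp (c * (2 * ρ - 1)) * Real.sinh (c * (1 - t)))
      / Real.sinh c := by
  have he := Real.exp_pos (c * (2 * ρ - 1))
  obtain ⟨t, h0, h1⟩ := t
  simp only
  rcases hc.lt_or_gt with hc | hc
  · refine div_pos_of_neg_of_neg ?_ (Real.sinh_neg_iff.2 hc)
    rcases h0.lt_or_eq with h0 | h0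
    · have h2 := Real.sinh_neg_iff.2 (mul_neg_of_neg_of_pos hc h0)
      have h3 : Real.sinh (c * (1 - t)) ≤ 0 := Real.sinh_nonpos_iff.2 (by nlinarith)
      nlinarith
    · subst h0
      have h2 := Real.sinh_neg_iff.2 hc
      simp only [mul_zero, Real.sinh_zero, sub_zero, mul_one, zero_add]
      nlinarith
  · refine div_pos ?_ (Real.sinh_pos_iff.2 hc)
    rcases h0.lt_or_eq with h0 | h0
    · have h2 := Real.sinh_pos_iff.2 (mul_pos hc h0)
      have h3 : 0 ≤ Real.sinh (c * (1 - t)) := Real.sinh_nonneg_iff.2 (by nlinarith)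
      positivity
    · subst h0
      have h2 := Real.sinh_pos_iff.2 hc
      simp only [mul_zero, Real.sinh_zero, sub_zero, mul_one, zero_add]
      positivity

theorem continuous_fluctuation_div (ρ c : ℝ) (n : ℕ) {a b : ℕ} (π : BoxPartition a b) :
    Continuous fun t : I => fluctuation ρ c n π t / fluctScale ρ c t := by
  have h1 : Continuous fun t : I =>
      linearInterp (fun k => (π.boundary k : ℝ)) (2 * n * (t : ℝ)) :=
    (continuousOn_linearInterp _).comp_continuous (by fun_prop) fun t =>
      mul_nonneg (by positivity) t.2.1
  have h2 : Continuous fun t : I => limitShape ρ c t := by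
    unfold limitShape
    by_cases hc : c = 0
    · subst hc; simp; fun_prop
    · refine continuous_const.add (continuous_const.mul (Continuous.log ?_ fun t =>
        (sinh_comb_pos ρ c hc t).ne'))
      fun_prop
  have h3 : Continuous fun t : I => fluctuation ρ c n π t := by
    unfold fluctuation
    fun_prop
  unfold fluctScale
  simp only [← mul_div_assoc, div_div_eq_mul_div]
  refine (h3.mul ?_).div_const _
  fun_prop

/-- The path `t ↦ √n (X_{2nt} / (2n) - L_{ρ,c}(t)) / f(t)`, as an element of `D[0,1]`. -/
def fluctPath (ρ c : ℝ) (n : ℕ) {a b : ℕ} (π : BoxPartition a b) : CadlagPath :=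
  CadlagPath.ofContinuous (fun t => fluctuation ρ c n π t / fluctScale ρ c t)
    (continuous_fluctuation_div ρ c n π)

/-! ### The Ornstein-Uhlenbeck bridge -/

/-- `Y` is an Ornstein-Uhlenbeck bridge on `[0,1]` with parameter `c` under `P`: a centered Gaussian
process with covariance `sinh (c s) sinh (c (1 - t)) / (c sinh c)` for `s ≤ t`. -/
structure IsOUBridge {Ω : Type*} [MeasurableSpace Ω] (c : ℝ) (Y : I → Ω → ℝ) (P : Measure Ω) :
    Prop where
  gaussian : IsGaussianProcess Y P
  centered : ∀ t, ∫ ω, Y t ω ∂P = 0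
  covariance_eq : ∀ s t : I, s ≤ t → covariance (Y s) (Y t) P =
    Real.sinh (c * s) * Real.sinh (c * (1 - t)) / (c * Real.sinh c)

end BoxedDiagrams

end

/-!
The boundary of a diagram `π` is determined by the set `D ⊆ {0, …, 2n-1}` of the times of its `a n`
steps `-1`, and `|π|` is `∑ d ∈ D, d` up to a constant (`sum_downSteps`). Hence, for every `A > 0`,
the measure proportional to `q ^ |π|` is the law of independent Bernoulli sites with odds
`A * q ^ d`, conditioned on `|D| = a n` (`integral_boxMeasure_eq_siteMean`). With `q = exp (-c / n)`
the site probabilities are values of a smooth profile `downRate A c`, and `A = tilt ρ c` is the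
choice for which the conditioning is typical: the mean number of down steps is then
`2 n ρ + O(1)`, so that the hypothesis puts `a n` within `o(√n)` of the mean, and the integral of
`1 - 2 * downRate` is the limit shape (`limitShape_eq`).

Finite-dimensional distributions. The constraint `|D| = a n` is an integral of characters over the
circle, and the characteristic function of independent sites is a product. On the scale `1 / √n`
the integrand converges to a Gaussian, under a Gaussian bound (`tendsto_fourier_integral`). Dividing
by the same integral without test functions gives the characteristic functions of a Gaussian process
with covariance `stepCov`, that of independent increments conditioned to sum to zero
(`tendsto_charFun_stepSum`). After division by `f` this is the covariance of the Ornstein-Uhlenbeck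
bridge (`stepCov_div`).

Tightness. For a block `B` of at most `n` sites, integrating the characters over the sites outside
`B` shows that conditioning multiplies expectations of nonnegative functions of `D ∩ B` by at most a
constant (`siteMean_card_block_le`). So the fourth moment `O(|B|²)` of the centred number of
occupied sites survives the conditioning, and a dyadic chaining argument gives tightness of the
interpolated paths in `C[0,1]` (`isTightMeasureSet_of_fourth_moment`). By Prokhorov's theorem, and
since finite-dimensional characters separate the points of `C[0,1]`, the laws converge in `C[0,1]`
(`exists_tendsto_of_tight_of_charFun`).

Finally `C[0,1]` is a closed subspace of `D[0,1]`, on which the Skorokhod topology is the uniform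
one (`isClosedEmbedding_toCadlag`), so the convergence and the limit pass to `D[0,1]`.
-/


noncomputable section

namespace BoxedDiagrams

/-! ### Weak convergence in `C[0,1]` from characteristic functions -/

instance : MeasurableSpace C(I, ℝ) := borel _

instance : BorelSpace C(I, ℝ) := ⟨rfl⟩

/-- The linear functional `x ↦ ∑ t ∈ J, l t * x t` on `C[0,1]`. -/
def evalSum (J : Finset I) (l : I → ℝ) : C(I, ℝ) →L[ℝ] ℝ :=
  ∑ t ∈ J, l t • ContinuousMap.evalCLM ℝ t

theorem evalSum_apply (J : Finset I) (l : I → ℝ) (x : C(I, ℝ)) :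
    evalSum J l x = ∑ t ∈ J, l t * x t := by
  simp [evalSum, ContinuousMap.evalCLM_apply]

/-- The pairing of a path with a finitely supported signed measure. -/
def evalPairing : C(I, ℝ) →ₗ[ℝ] (I →₀ ℝ) →ₗ[ℝ] ℝ :=
  LinearMap.mk₂ ℝ (fun x w => w.sum fun t r => r * x t)
    (fun x y w => by simp [Finsupp.sum, mul_add, Finset.sum_add_distrib])
    (fun c x w => by simp [Finsupp.sum, Finset.mul_sum, mul_left_comm])
    (fun x v w => by
      rw [Finsupp.sum_add_index'] <;> intros <;> ring)
    (fun c x w => by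
      rw [Finsupp.sum_smul_index (by simp), Finsupp.smul_sum]
      simp [Finsupp.sum, mul_assoc])

theorem evalPairing_apply (x : C(I, ℝ)) (w : I →₀ ℝ) :
    evalPairing x w = evalSum w.support w x := by
  simp [evalPairing, evalSum_apply, Finsupp.sum]

/-- A tight sequence of laws on `C[0,1]` whose finite-dimensional characteristic functions
converge has a weak limit: Prokhorov gives a cluster point, and the characters of the
finite-dimensional marginals separate the points of `C[0,1]`. -/
theorem exists_tendsto_of_tight_of_charFun (μ : ℕ → ProbabilityMeasure C(I, ℝ))
    (ht : IsTightMeasureSet {x | ∃ n, (μ n : Measure C(I, ℝ)) = x})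
    (φ : Finset I → (I → ℝ) → ℂ)
    (h : ∀ J l, Tendsto (fun n => ∫ x, Complex.exp ((evalSum J l x : ℂ) * Complex.I)
      ∂(μ n : Measure C(I, ℝ))) atTop (𝓝 (φ J l))) :
    ∃ μ₀ : ProbabilityMeasure C(I, ℝ), Tendsto μ atTop (𝓝 μ₀) ∧ ∀ J l,
      ∫ x, Complex.exp ((evalSum J l x : ℂ) * Complex.I) ∂(μ₀ : Measure C(I, ℝ)) = φ J l := by
  have hcomp : IsCompact (closure (Set.range μ)) := by
    apply isCompact_closure_of_isTightMeasureSet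
    convert ht using 2
    simp
  obtain ⟨μ₀, -, hμ₀⟩ := hcomp.exists_mapClusterPt (f := (atTop : Filter ℕ)) (u := μ)
    (tendsto_principal.2 (Eventually.of_forall fun n => subset_closure (Set.mem_range_self n)))
  obtain ⟨U, hU, hUμ⟩ := mapClusterPt_iff_ultrafilter.1 hμ₀
  have hlim : ∀ J l,
      ∫ x, Complex.exp ((evalSum J l x : ℂ) * Complex.I) ∂(μ₀ : Measure C(I, ℝ)) = φ J l := by
    intro J l
    have h1 := (ProbabilityMeasure.tendsto_iff_forall_integral_rclike_tendsto ℂ).1 hUμ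
      (BoundedContinuousFunction.ofNormedAddCommGroup
        (fun x : C(I, ℝ) => Complex.exp ((evalSum J l x : ℂ) * Complex.I)) (by fun_prop) 1
        (fun x => by rw [Complex.norm_exp_ofReal_mul_I]))
    exact tendsto_nhds_unique h1 ((h J l).mono_left hU)
  refine ⟨μ₀, ?_, hlim⟩
  -- the discrete topology on test measures makes the pairing jointly continuous, as the lemma
  -- on separation of points by characters requires
  let _ : TopologicalSpace (I →₀ ℝ) := ⊥
  have : DiscreteTopology (I →₀ ℝ) := ⟨rfl⟩
  have hL : Continuous fun p : C(I, ℝ) × (I →₀ ℝ) => evalPairing p.1 p.2 := by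
    rw [continuous_prod_of_discrete_right]
    intro w
    simp only [evalPairing_apply]
    fun_prop
  have hL' : ∀ v : C(I, ℝ), v ≠ 0 → evalPairing v ≠ 0 := by
    intro v hv h0
    apply hv
    ext t
    have := LinearMap.congr_fun h0 (Finsupp.single t 1)
    simpa [evalPairing] using this
  refine ProbabilityMeasure.tendsto_of_tight_of_separatesPoints ℂ ht
    (BoundedContinuousFunction.separatesPoints_charPoly Real.continuous_probChar
      Real.probChar_ne_one hL hL') ?_
  intro g hg
  -- a trigonometric polynomial is a finite combination of finite-dimensional characters
  obtain ⟨w, hw⟩ := (BoundedContinuousFunction.mem_charPoly g).1 hg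
  have hint : ∀ (m : ProbabilityMeasure C(I, ℝ)), ∫ x, g x ∂(m : Measure C(I, ℝ)) =
      ∑ a ∈ w.coeff.support, w.coeff a *
        ∫ x, Complex.exp ((evalSum a.support a x : ℂ) * Complex.I) ∂(m : Measure C(I, ℝ)) := by
    intro m
    rw [hw]
    simp only [Finsupp.sum]
    rw [integral_finsetSum]
    · refine Finset.sum_congr rfl fun a _ => ?_
      rw [integral_const_mul]
      simp [evalPairing_apply, Real.probChar_apply]
    · intro a _
      refine Integrable.const_mul ?_ _
      refine Integrable.mono' (integrable_const 1) ?_ ?_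
      · have : Continuous fun x : C(I, ℝ) => evalPairing x a := by
          simp only [evalPairing_apply]; fun_prop
        exact (Continuous.comp (by fun_prop)
          (Real.continuous_probChar.comp this)).aestronglyMeasurable
      · exact Eventually.of_forall fun x => (Circle.norm_coe _).le
  simp only [hint]
  refine tendsto_finsetSum _ fun a _ => Tendsto.const_mul _ ?_
  rw [hlim]
  exact h _ _

/-- A law on `C[0,1]` with Gaussian finite-dimensional characteristic functions: every finite
linear combination of coordinates is a centred real Gaussian variable. -/
theorem map_evalSum_eq_gaussianReal (μ : ProbabilityMeasure C(I, ℝ)) (K : I → I → ℝ)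
    (h : ∀ J l, ∫ x, Complex.exp ((evalSum J l x : ℂ) * Complex.I) ∂(μ : Measure C(I, ℝ)) =
      Complex.exp (((-(∑ s ∈ J, ∑ t ∈ J, l s * l t * K s t) / 2 : ℝ)) : ℂ)) (J : Finset I)
    (l : I → ℝ) :
    0 ≤ ∑ s ∈ J, ∑ t ∈ J, l s * l t * K s t ∧
    (μ : Measure C(I, ℝ)).map (evalSum J l) =
      gaussianReal 0 (∑ s ∈ J, ∑ t ∈ J, l s * l t * K s t).toNNReal := by
  set Q := ∑ s ∈ J, ∑ t ∈ J, l s * l t * K s t with hQ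
  have hQ0 : 0 ≤ Q := by
    have h1 : ‖∫ x, Complex.exp ((evalSum J l x : ℂ) * Complex.I) ∂(μ : Measure C(I, ℝ))‖ ≤ 1 := by
      refine (norm_integral_le_of_norm_le_const (C := 1) (Eventually.of_forall fun x => ?_)).trans ?_
      · rw [Complex.norm_exp_ofReal_mul_I]
      · simp
    rw [h, Complex.norm_exp, Complex.ofReal_re, Real.exp_le_one_iff] at h1
    linarith
  refine ⟨hQ0, ?_⟩
  have : IsProbabilityMeasure ((μ : Measure C(I, ℝ)).map (evalSum J l)) :=
    Measure.isProbabilityMeasure_map (by fun_prop)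
  apply Measure.ext_of_charFun
  ext u
  rw [charFun_gaussianReal, charFun_apply_real, integral_map (by fun_prop)
    (by fun_prop : Continuous _).aestronglyMeasurable]
  have h2 := h J (fun t => u * l t)
  have h3 : ∀ x, evalSum J (fun t => u * l t) x = u * evalSum J l x := by
    intro x; simp [evalSum_apply, Finset.mul_sum, mul_assoc]
  have h4 : ∑ s ∈ J, ∑ t ∈ J, u * l s * (u * l t) * K s t = u ^ 2 * Q := by
    rw [hQ, Finset.mul_sum]
    refine Finset.sum_congr rfl fun s _ => ?_
    rw [Finset.mul_sum]
    exact Finset.sum_congr rfl fun t _ => by ring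
  simp only [h3, Complex.ofReal_mul] at h2
  rw [h2, h4]
  congr 1
  rw [Real.coe_toNNReal _ hQ0]
  push_cast
  ring

/-- The Gaussian process properties encoded in the characteristic function. -/
theorem gaussianProcess_of_charFun (μ : ProbabilityMeasure C(I, ℝ)) (K : I → I → ℝ)
    (hK : ∀ s t, K s t = K t s)
    (h : ∀ J l, ∫ x, Complex.exp ((evalSum J l x : ℂ) * Complex.I) ∂(μ : Measure C(I, ℝ)) =
      Complex.exp (((-(∑ s ∈ J, ∑ t ∈ J, l s * l t * K s t) / 2 : ℝ)) : ℂ)) :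
    IsGaussianProcess (fun (t : I) (x : C(I, ℝ)) => x t) (μ : Measure C(I, ℝ)) ∧
    (∀ t : I, ∫ x : C(I, ℝ), x t ∂(μ : Measure C(I, ℝ)) = 0) ∧
    ∀ s t : I, covariance (fun x : C(I, ℝ) => x s) (fun x : C(I, ℝ) => x t)
      (μ : Measure C(I, ℝ)) = K s t := by
  have hev : ∀ t : I, Continuous fun x : C(I, ℝ) => x t := fun t => by fun_prop
  have hlaw := fun J l => (map_evalSum_eq_gaussianReal μ K h J l).2
  have hnn := fun J l => (map_evalSum_eq_gaussianReal μ K h J l).1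
  have hmean : ∀ J l, ∫ x, evalSum J l x ∂(μ : Measure C(I, ℝ)) = 0 := by
    intro J l
    have := integral_map (μ := (μ : Measure C(I, ℝ))) (φ := evalSum J l) (f := fun y : ℝ => y)
      (by fun_prop) (by fun_prop : Continuous _).aestronglyMeasurable
    rw [← this, hlaw, integral_id_gaussianReal]
  have hvar : ∀ J l, variance (evalSum J l) (μ : Measure C(I, ℝ)) =
      ∑ s ∈ J, ∑ t ∈ J, l s * l t * K s t := by
    intro J l
    have := variance_map (μ := (μ : Measure C(I, ℝ))) (Y := evalSum J l) (X := fun y : ℝ => y)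
      (by fun_prop) (by fun_prop)
    have h2 : (fun y : ℝ => y) ∘ (evalSum J l) = evalSum J l := rfl
    rw [h2] at this
    rw [← this, hlaw, variance_fun_id_gaussianReal, Real.coe_toNNReal _ (hnn J l)]
  have hmem : ∀ t : I, MemLp (fun x : C(I, ℝ) => x t) 2 (μ : Measure C(I, ℝ)) := by
    intro t
    have h1 : MemLp id 2 ((μ : Measure C(I, ℝ)).map (evalSum {t} 1)) := by
      rw [hlaw]; exact memLp_id_gaussianReal 2
    have h2 := (memLp_map_measure_iff (by fun_prop) (by fun_prop)).1 h1
    convert h2 using 1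
    ext x
    simp [evalSum_apply]
  refine ⟨⟨fun J => ⟨?_⟩⟩, ?_, ?_⟩
  · refine isGaussian_of_map_eq_gaussianReal fun L => ?_
    suffices hs : ∃ l, ((μ : Measure C(I, ℝ)).map fun x => J.restrict fun t => x t).map L =
        (μ : Measure C(I, ℝ)).map (evalSum J l) by
      obtain ⟨l, hl⟩ := hs
      exact ⟨0, _, hl.trans (hlaw J l)⟩
    · rw [Measure.map_map (by fun_prop) (by
        refine Continuous.measurable ?_
        exact continuous_pi fun t => hev t)]
      classical
      refine ⟨fun t => if ht : t ∈ J then L (Pi.single ⟨t, ht⟩ 1) else 0, ?_⟩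
      have : L ∘ (fun (x : C(I, ℝ)) => J.restrict fun t => x t) =
          evalSum J (fun t => if ht : t ∈ J then L (Pi.single ⟨t, ht⟩ 1) else 0) := by
        ext x
        have h1 : (J.restrict fun t => x t) =
            ∑ t : J, x t • (Pi.single t (1 : ℝ) : J → ℝ) := by
          ext t; simp [Finset.sum_apply, Pi.single_apply]
        rw [Function.comp_apply, h1, map_sum, evalSum_apply, ← Finset.sum_coe_sort J]
        refine Finset.sum_congr rfl fun t _ => ?_
        simp [mul_comm]
      rw [this]
  · intro t
    rw [← hmean {t} 1]
    simp [evalSum_apply]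
  · intro s t
    have hv1 : ∀ t : I, variance (fun x : C(I, ℝ) => x t) (μ : Measure C(I, ℝ)) = K t t := by
      intro t
      have := hvar {t} 1
      have h2 : (evalSum {t} 1 : C(I, ℝ) → ℝ) = fun x : C(I, ℝ) => x t := by
        ext x; simp [evalSum_apply]
      rw [h2] at this
      simpa using this
    rcases eq_or_ne s t with rfl | hst
    · rw [covariance_self (hev s).aemeasurable, hv1]
    · have h1 := variance_add (hmem s) (hmem t)
      have h2 : ((fun x : C(I, ℝ) => x s) + fun x : C(I, ℝ) => x t) = evalSum {s, t} 1 := by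
        ext x; simp [evalSum_apply, Finset.sum_pair hst]
      rw [h2, hvar, hv1, hv1, Finset.sum_pair hst, Finset.sum_pair hst, Finset.sum_pair hst] at h1
      simp only [Pi.one_apply, one_mul] at h1
      linarith [hK s t]

/-! ### Tightness in `C[0,1]` from a fourth moment bound -/

/-- Dyadic chaining: if the increments of a continuous function over the dyadic intervals of
level `m` are at most `A * (9/10)^m`, the function has a modulus of continuity of the same
order. -/
theorem abs_sub_le_of_dyadic {X : ℝ → ℝ} (hX : Continuous X) {A : ℝ}
    (h : ∀ m i : ℕ, |X ((i + 1 : ℕ) / 2 ^ m) - X (i / 2 ^ m)| ≤ A * (9 / 10) ^ m)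
    {s t : ℝ} (hs : 0 ≤ s) (ht : 0 ≤ t) (m : ℕ) (hst : |s - t| ≤ (1 / 2) ^ m) :
    |X s - X t| ≤ 19 * A * (9 / 10) ^ m := by
  have hA : ∀ m : ℕ, 0 ≤ A * (9 / 10) ^ m := fun m => (abs_nonneg _).trans (h m 0)
  have h2 : ∀ m : ℕ, (0 : ℝ) < 2 ^ m := fun m => by positivity
  -- from level `m` on, the dyadic approximations of `s` move by at most one interval per level
  have happrox : ∀ s : ℝ, 0 ≤ s → |X (⌊2 ^ m * s⌋₊ / 2 ^ m) - X s| ≤ 9 * A * (9 / 10) ^ m := by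
    intro s hs
    have hlim : Tendsto (fun k : ℕ => X (⌊2 ^ k * s⌋₊ / 2 ^ k)) atTop (𝓝 (X s)) := by
      refine (hX.tendsto s).comp ?_
      have h3 : Tendsto (fun k : ℕ => s - (1 / 2 : ℝ) ^ k) atTop (𝓝 (s - 0)) :=
        tendsto_const_nhds.sub (tendsto_pow_atTop_nhds_zero_of_lt_one (by norm_num) (by norm_num))
      rw [sub_zero] at h3
      refine tendsto_of_tendsto_of_tendsto_of_le_of_le h3 tendsto_const_nhds (fun k => ?_)
        (fun k => ?_)
      · have h4 := Nat.lt_floor_add_one (2 ^ k * s)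
        simp only
        rw [le_div_iff₀ (h2 k), sub_mul, ← mul_pow]
        norm_num
        linarith
      · have h4 := Nat.floor_le (a := 2 ^ k * s) (by positivity)
        simp only
        rw [div_le_iff₀ (h2 k)]
        linarith
    have hstep : ∀ k : ℕ, dist (X (⌊2 ^ k * s⌋₊ / 2 ^ k))
        (X (⌊2 ^ (k + 1) * s⌋₊ / 2 ^ (k + 1))) ≤ (A * (9 / 10)) * (9 / 10) ^ k := by
      intro k
      set j := ⌊2 ^ k * s⌋₊ with hj
      have h4 := Nat.lt_floor_add_one (2 ^ k * s)
      have h5 := Nat.floor_le (a := 2 ^ k * s) (by positivity)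
      rw [← hj] at h4 h5
      have h6 : ((j : ℝ) / 2 ^ k) = ((2 * j : ℕ) : ℝ) / 2 ^ (k + 1) := by
        push_cast; rw [pow_succ]; field_simp
      have h7 : (A * (9 / 10)) * (9 / 10) ^ k = A * (9 / 10) ^ (k + 1) := by ring
      rw [h6, h7]
      have h8 : ⌊2 ^ (k + 1) * s⌋₊ = 2 * j ∨ ⌊2 ^ (k + 1) * s⌋₊ = 2 * j + 1 := by
        have h9 : 2 * j ≤ ⌊2 ^ (k + 1) * s⌋₊ := by
          apply Nat.le_floor; push_cast; rw [pow_succ]; nlinarith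
        have h10 : ⌊2 ^ (k + 1) * s⌋₊ < 2 * j + 2 := by
          rw [Nat.floor_lt (by positivity)]; push_cast; rw [pow_succ]; nlinarith
        omega
      rcases h8 with h8 | h8
      · rw [h8, dist_self]; exact hA _
      · rw [h8, dist_comm]; exact h (k + 1) (2 * j)
    have := dist_le_of_le_geometric_of_tendsto (9 / 10) _ (by norm_num) hstep hlim m
    rw [Real.dist_eq] at this
    refine this.trans (le_of_eq ?_)
    ring
  have hmid : |X (⌊2 ^ m * s⌋₊ / 2 ^ m) - X (⌊2 ^ m * t⌋₊ / 2 ^ m)| ≤ A * (9 / 10) ^ m := by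
    have hs1 := Nat.lt_floor_add_one (2 ^ m * s)
    have hs2 := Nat.floor_le (a := 2 ^ m * s) (by positivity)
    have ht1 := Nat.lt_floor_add_one (2 ^ m * t)
    have ht2 := Nat.floor_le (a := 2 ^ m * t) (by positivity)
    set i := ⌊2 ^ m * s⌋₊
    set j := ⌊2 ^ m * t⌋₊
    have h3 : |2 ^ m * s - 2 ^ m * t| ≤ 1 := by
      rw [← mul_sub, abs_mul, abs_of_pos (h2 m)]
      calc (2 : ℝ) ^ m * |s - t| ≤ 2 ^ m * (1 / 2) ^ m := by gcongr
        _ = 1 := by rw [← mul_pow]; norm_num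
    rw [abs_le] at h3
    have h4 : (i : ℝ) < j + 2 := by linarith
    have h5 : (j : ℝ) < i + 2 := by linarith
    have h4' : i < j + 2 := by exact_mod_cast h4
    have h5' : j < i + 2 := by exact_mod_cast h5
    have h6 : i = j ∨ i = j + 1 ∨ j = i + 1 := by omega
    rcases h6 with h6 | h6 | h6
    · rw [h6, sub_self, abs_zero]; exact hA m
    · rw [h6]; exact h m j
    · rw [h6, abs_sub_comm]; exact h m i
  have h9 := happrox s hs
  have h10 := happrox t ht
  rw [abs_le] at *
  constructor <;> linarith [h9.1, h9.2, h10.1, h10.2, hmid.1, hmid.2]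

/-- Paths started at `0` with the modulus of continuity `2⁻ᵐ ↦ A * (9/10)^m`. -/
def modulusSet (A : ℝ) : Set C(I, ℝ) :=
  {x | x 0 = 0 ∧ ∀ (m : ℕ) (s t : I), |(s : ℝ) - t| ≤ (1 / 2) ^ m →
    |x s - x t| ≤ A * (9 / 10) ^ m}

theorem exists_delta_of_modulus (A : ℝ) {ε : ℝ} (hε : 0 < ε) :
    ∃ m : ℕ, A * (9 / 10) ^ m < ε := by
  have h : Tendsto (fun m : ℕ => A * (9 / 10 : ℝ) ^ m) atTop (𝓝 (A * 0)) :=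
    (tendsto_pow_atTop_nhds_zero_of_lt_one (by norm_num) (by norm_num)).const_mul A
  rw [mul_zero] at h
  exact (h.eventually (gt_mem_nhds hε)).exists

theorem isCompact_modulusSet (A : ℝ) : IsCompact (modulusSet A) := by
  apply ArzelaAscoli.isCompact_of_equicontinuous
  · have himg : ContinuousMap.toFun '' modulusSet A =
        {f : I → ℝ | f 0 = 0} ∩ ⋂ (m : ℕ) (s : I) (t : I) (_ : |(s : ℝ) - t| ≤ (1 / 2) ^ m),
          {f : I → ℝ | |f s - f t| ≤ A * (9 / 10) ^ m} := by
      ext f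
      simp only [Set.mem_image, Set.mem_inter_iff, Set.mem_ofPred_eq, Set.mem_iInter]
      constructor
      · rintro ⟨x, hx, rfl⟩
        exact ⟨hx.1, hx.2⟩
      · rintro ⟨h0, hm⟩
        refine ⟨⟨f, ?_⟩, ⟨h0, hm⟩, rfl⟩
        rw [Metric.continuous_iff]
        intro b ε hε
        obtain ⟨m, hm'⟩ := exists_delta_of_modulus A hε
        refine ⟨(1 / 2) ^ m, by positivity, fun a ha => ?_⟩
        rw [Real.dist_eq]
        refine (hm m a b ?_).trans_lt hm'
        rw [Subtype.dist_eq, Real.dist_eq] at ha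
        exact ha.le
    rw [himg]
    refine IsCompact.of_isClosed_subset
      (isCompact_univ_pi (fun _ : I => isCompact_Icc (a := -A) (b := A))) ?_ ?_
    · refine IsClosed.inter (isClosed_eq (by fun_prop) (by fun_prop)) ?_
      refine isClosed_iInter fun m => isClosed_iInter fun s => isClosed_iInter fun t =>
        isClosed_iInter fun _ => isClosed_le (by fun_prop) (by fun_prop)
    · rintro f ⟨h0, hm⟩ t -
      simp only [Set.mem_ofPred_eq, Set.mem_iInter] at h0 hm
      have := hm 0 t 0 (by
        have h1 := t.2.1
        have h2 := t.2.2
        simp only [Set.Icc.coe_zero, pow_zero, sub_zero]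
        rw [abs_of_nonneg h1]; exact h2)
      rw [h0, sub_zero, pow_zero, mul_one] at this
      exact abs_le.1 this
  · intro t
    rw [Metric.equicontinuousAt_iff]
    intro ε hε
    obtain ⟨m, hm'⟩ := exists_delta_of_modulus A hε
    refine ⟨(1 / 2) ^ m, by positivity, fun a ha x => ?_⟩
    rw [Real.dist_eq]
    refine (x.2.2 m t a ?_).trans_lt hm'
    rw [Subtype.dist_eq, Real.dist_eq, abs_sub_comm] at ha
    exact ha.le

/-- A Kolmogorov type criterion: laws on `C[0,1]` of processes started at `0` with
`E |x s - x t|⁴ ≤ C (s - t)²` form a tight family. -/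
theorem isTightMeasureSet_of_fourth_moment {ι : Type*} (μ : ι → ProbabilityMeasure C(I, ℝ))
    (h0 : ∀ n, ∀ᵐ x ∂(μ n : Measure C(I, ℝ)), x 0 = 0) (C : ℝ) (hC : 0 ≤ C)
    (hm : ∀ n (s t : I), ∫⁻ x, ENNReal.ofReal ((x s - x t) ^ 4) ∂(μ n : Measure C(I, ℝ)) ≤
      ENNReal.ofReal (C * ((s : ℝ) - t) ^ 2)) :
    IsTightMeasureSet {x | ∃ n, (μ n : Measure C(I, ℝ)) = x} := by
  rw [isTightMeasureSet_iff_exists_isCompact_measure_compl_le]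
  -- the sum of the tail bounds over the dyadic levels, whose ratio is `1 / (2 * (9/10)^4) < 1`
  set S : ℝ := ∑' m : ℕ, (5000 / 6561 : ℝ) ^ m with hS
  have hsum : Summable fun m : ℕ => (5000 / 6561 : ℝ) ^ m :=
    summable_geometric_of_lt_one (by norm_num) (by norm_num)
  have key : ∀ A : ℝ, 0 < A → ∀ n, (μ n : Measure C(I, ℝ)) (modulusSet (19 * A))ᶜ ≤
      ENNReal.ofReal (C / A ^ 4 * S) := by
    intro A hA n
    let p : ℕ → ℕ → I := fun m i => Set.projIcc 0 1 zero_le_one ((i : ℝ) / 2 ^ m)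
    -- `B m i`: the increment over the `i`-th dyadic interval of level `m` is too large
    let B : ℕ → ℕ → Set C(I, ℝ) := fun m i =>
      {x | ENNReal.ofReal ((A * (9 / 10) ^ m) ^ 4) ≤
        ENNReal.ofReal ((x (p m (i + 1)) - x (p m i)) ^ 4)}
    have hsub : (modulusSet (19 * A))ᶜ ⊆
        {x | ¬ x 0 = 0} ∪ ⋃ m, ⋃ i ∈ Finset.range (2 ^ m), B m i := by
      intro x hx
      by_contra hcon
      simp only [Set.mem_union, Set.mem_ofPred_eq, Set.mem_iUnion, not_or, not_exists, not_not]
        at hcon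
      obtain ⟨hx0, hB⟩ := hcon
      refine hx ⟨hx0, fun m s t hst => ?_⟩
      have hcont : Continuous (Set.IccExtend (zero_le_one' ℝ) x) := x.continuous.Icc_extend'
      have := abs_sub_le_of_dyadic hcont (A := A) ?_ s.2.1 t.2.1 m hst
      · rwa [Set.IccExtend_val, Set.IccExtend_val] at this
      · intro m i
        by_cases hi : i < 2 ^ m
        · have h1 := hB m i (Finset.mem_range.2 hi)
          simp only [B, Set.mem_ofPred_eq, not_le] at h1
          have h2 := (ENNReal.ofReal_lt_ofReal_iff_of_nonneg (by positivity)).1 h1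
          have h3 : |x (p m (i + 1)) - x (p m i)| ^ 4 < (A * (9 / 10) ^ m) ^ 4 := by
            rwa [Even.pow_abs (by decide)]
          exact (lt_of_pow_lt_pow_left₀ 4 (by positivity) h3).le
        · have h4 : ∀ j : ℕ, 2 ^ m ≤ j →
              Set.IccExtend (zero_le_one' ℝ) x ((j : ℝ) / 2 ^ m) = x 1 := by
            intro j hj
            rw [Set.IccExtend_of_right_le]
            · rfl
            · rw [one_le_div (by positivity)]
              exact_mod_cast hj
          rw [h4 _ (by omega), h4 _ (by omega), sub_self, abs_zero]
          positivity
    refine (measure_mono hsub).trans ((measure_union_le _ _).trans ?_)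
    rw [ae_iff.1 (h0 n), zero_add]
    have hp : ∀ m i, i < 2 ^ m → ((p m (i + 1) : ℝ) - p m i) = 1 / 2 ^ m := by
      intro m i hi
      have hi' : (i : ℝ) + 1 ≤ 2 ^ m := by exact_mod_cast hi
      have h2 : (0 : ℝ) < 2 ^ m := by positivity
      simp only [p]
      rw [Set.projIcc_of_mem _ (Set.mem_Icc.2 ⟨by positivity, by
        rw [div_le_one h2]; push_cast; exact hi'⟩), Set.projIcc_of_mem _ (Set.mem_Icc.2
        ⟨by positivity, by rw [div_le_one h2]; linarith⟩)]
      push_cast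
      ring
    have hBm : ∀ m, ∀ i ∈ Finset.range (2 ^ m), (μ n : Measure C(I, ℝ)) (B m i) ≤
        ENNReal.ofReal (C * (1 / 2 ^ m) ^ 2 / (A * (9 / 10) ^ m) ^ 4) := by
      intro m i hi
      have hpos : 0 < (A * (9 / 10) ^ m) ^ 4 := by positivity
      have h1 := meas_ge_le_lintegral_div (μ := (μ n : Measure C(I, ℝ)))
        (f := fun x => ENNReal.ofReal ((x (p m (i + 1)) - x (p m i)) ^ 4))
        (ε := ENNReal.ofReal ((A * (9 / 10) ^ m) ^ 4)) (by fun_prop)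
        (by simpa using hpos) ENNReal.ofReal_ne_top
      refine h1.trans ?_
      rw [ENNReal.ofReal_div_of_pos hpos]
      gcongr
      have := hm n (p m (i + 1)) (p m i)
      rwa [hp m i (Finset.mem_range.1 hi)] at this
    calc (μ n : Measure C(I, ℝ)) (⋃ m, ⋃ i ∈ Finset.range (2 ^ m), B m i)
        ≤ ∑' m, (μ n : Measure C(I, ℝ)) (⋃ i ∈ Finset.range (2 ^ m), B m i) :=
          measure_iUnion_le _
      _ ≤ ∑' m : ℕ, ENNReal.ofReal (C / A ^ 4 * (5000 / 6561) ^ m) := by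
          refine ENNReal.tsum_le_tsum fun m => ?_
          refine (measure_biUnion_finset_le _ _).trans ((Finset.sum_le_sum (hBm m)).trans ?_)
          rw [Finset.sum_const, Finset.card_range, nsmul_eq_mul]
          rw [← ENNReal.ofReal_natCast, ← ENNReal.ofReal_mul (by positivity)]
          refine ENNReal.ofReal_le_ofReal (le_of_eq ?_)
          have h9 : ((5000 : ℝ) / 6561) ^ m = 1 / (2 ^ m * ((9 / 10) ^ m) ^ 4) := by
            rw [← pow_mul, mul_comm m 4, pow_mul, ← mul_pow, ← one_div_pow]
            norm_num
          rw [h9]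
          push_cast
          field_simp
      _ = ENNReal.ofReal (C / A ^ 4 * S) := by
          rw [← ENNReal.ofReal_tsum_of_nonneg (fun m => by positivity) (hsum.mul_left _),
            tsum_mul_left]
  intro ε hε
  have hlim : Tendsto (fun A : ℝ => ENNReal.ofReal (C / A ^ 4 * S)) atTop (𝓝 0) := by
    rw [← ENNReal.ofReal_zero]
    refine ENNReal.tendsto_ofReal ?_
    have h1 : Tendsto (fun A : ℝ => C / A ^ 4) atTop (𝓝 0) :=
      tendsto_const_nhds.div_atTop (tendsto_pow_atTop (by norm_num))
    simpa using h1.mul_const S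
  obtain ⟨A, hA, hAε⟩ := ((eventually_gt_atTop (0 : ℝ)).and
    (hlim.eventually (gt_mem_nhds hε))).exists
  refine ⟨modulusSet (19 * A), isCompact_modulusSet _, ?_⟩
  rintro _ ⟨n, rfl⟩
  exact (key A hA n).trans hAε.le

/-! ### Continuous paths inside the Skorokhod space -/

/-- The inclusion of `C[0,1]` in `D[0,1]`. -/
def toCadlag (x : C(I, ℝ)) : CadlagPath := CadlagPath.ofContinuous x x.continuous

theorem toCadlag_apply (x : C(I, ℝ)) (t : I) : toCadlag x t = x t := rfl

theorem edist_cadlag (x y : CadlagPath) : edist x y = ⨅ φ : I ≃o I, timeChangeCost φ x y := rfl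

theorem edist_toCadlag_le (x y : C(I, ℝ)) : edist (toCadlag x) (toCadlag y) ≤ edist x y := by
  rw [edist_cadlag]
  refine (iInf_le _ (OrderIso.refl I)).trans (max_le (by simp) (iSup_le fun t => ?_))
  change edist (x t) (y t) ≤ _
  rw [edist_dist, edist_dist]
  exact ENNReal.ofReal_le_ofReal (ContinuousMap.dist_apply_le_dist t)

theorem exists_timeChange_of_edist_lt {x y : CadlagPath} {ε : ℝ}
    (h : edist x y < ENNReal.ofReal ε) :
    ∃ φ : I ≃o I, ∀ t, dist (φ t) t < ε ∧ dist (x t) (y (φ t)) < ε := by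
  rw [edist_cadlag, iInf_lt_iff] at h
  obtain ⟨φ, hφ⟩ := h
  refine ⟨φ, fun t => ?_⟩
  rw [← edist_lt_ofReal, ← edist_lt_ofReal]
  exact ⟨((le_iSup (fun t : I => edist (φ t) t) t).trans (le_max_left _ _)).trans_lt hφ,
    ((le_iSup (fun t : I => edist (x t) (y (φ t))) t).trans (le_max_right _ _)).trans_lt hφ⟩

/-- The Skorokhod topology induces the uniform topology on continuous paths, and a Skorokhod
limit of continuous paths is continuous. -/
theorem isClosedEmbedding_toCadlag : IsClosedEmbedding toCadlag := by
  have hcont : Continuous toCadlag :=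
    (LipschitzWith.of_edist_le edist_toCadlag_le).continuous
  have hind : IsInducing toCadlag := by
    rw [isInducing_iff_nhds]
    intro x
    refine le_antisymm (hcont.tendsto x).le_comap ?_
    rw [Metric.nhds_basis_ball.ge_iff]
    intro ε hε
    -- a time change close to the identity moves the uniformly continuous `x` by little
    obtain ⟨δ, hδ, hxδ⟩ := Metric.uniformContinuous_iff.1
      (CompactSpace.uniformContinuous_of_continuous x.continuous) (ε / 3) (by positivity)
    refine mem_comap.2 ⟨Metric.eball (toCadlag x) (ENNReal.ofReal (min δ (ε / 3))),
      Metric.eball_mem_nhds _ (by simp [hδ, hε]), ?_⟩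
    intro y hy
    rw [Set.mem_preimage, Metric.mem_eball, edist_comm] at hy
    obtain ⟨φ, hφ⟩ := exists_timeChange_of_edist_lt hy
    have h1 : dist y x ≤ 2 * (ε / 3) := by
      rw [ContinuousMap.dist_le (by positivity)]
      intro s
      obtain ⟨h2, h3⟩ := hφ (φ.symm s)
      rw [φ.apply_symm_apply] at h2 h3
      have h4 := hxδ (h2.trans_le (min_le_left _ _))
      have h5 := h3.trans_le (min_le_right _ _)
      rw [toCadlag_apply, toCadlag_apply] at h5
      calc dist (y s) (x s) ≤ dist (y s) (x (φ.symm s)) + dist (x (φ.symm s)) (x s) :=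
            dist_triangle _ _ _
        _ ≤ ε / 3 + ε / 3 := by
            rw [dist_comm (y s), dist_comm _ (x s)]; exact add_le_add h5.le h4.le
        _ = _ := by ring
    rw [Metric.mem_ball]
    linarith
  refine ⟨⟨hind, fun x y h => ?_⟩, ?_⟩
  · ext t
    exact congrArg (fun z : CadlagPath => z t) h
  · refine isClosed_of_closure_subset fun y hy => ?_
    -- `y` is uniformly approximated by the continuous paths `x ∘ φ`
    have hyc : Continuous y.toFun := by
      refine continuous_of_uniform_approx_of_continuous fun u hu => ?_
      obtain ⟨ε, hε, hεu⟩ := Metric.mem_uniformity_dist.1 hu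
      obtain ⟨_, ⟨x, rfl⟩, hx⟩ := EMetric.mem_closure_iff.1 hy (ENNReal.ofReal ε)
        (by simpa using hε)
      obtain ⟨φ, hφ⟩ := exists_timeChange_of_edist_lt hx
      exact ⟨fun t => x (φ t), x.continuous.comp φ.continuous, fun t => hεu (hφ t).2⟩
    exact ⟨⟨y.toFun, hyc⟩, rfl⟩

theorem measurableEmbedding_toCadlag : MeasurableEmbedding toCadlag :=
  isClosedEmbedding_toCadlag.measurableEmbedding

/-- A Gaussian law on `C[0,1]` with the covariance of the bridge, seen on `D[0,1]`. -/
theorem isOUBridge_map_toCadlag (c : ℝ) (μ : ProbabilityMeasure C(I, ℝ))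
    (hg : IsGaussianProcess (fun (t : I) (x : C(I, ℝ)) => x t) (μ : Measure C(I, ℝ)))
    (h0 : ∀ t : I, ∫ x : C(I, ℝ), x t ∂(μ : Measure C(I, ℝ)) = 0)
    (hcov : ∀ s t : I, s ≤ t → covariance (fun x : C(I, ℝ) => x s) (fun x : C(I, ℝ) => x t)
      (μ : Measure C(I, ℝ)) =
        Real.sinh (c * s) * Real.sinh (c * (1 - t)) / (c * Real.sinh c)) :
    IsOUBridge c (fun t (y : CadlagPath) => y t) ((μ : Measure C(I, ℝ)).map toCadlag) := by
  have hme := measurableEmbedding_toCadlag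
  have hev : ∀ t : I, Continuous fun x : C(I, ℝ) => x t := fun t => by fun_prop
  have hae : ∀ t : I, AEMeasurable (fun y : CadlagPath => y t)
      ((μ : Measure C(I, ℝ)).map toCadlag) := fun t =>
    hme.aemeasurable_map_iff.2 (hev t).aemeasurable
  refine ⟨⟨fun J => ⟨?_⟩⟩, fun t => ?_, fun s t hst => ?_⟩
  · have h1 : AEMeasurable (fun y : CadlagPath => J.restrict fun t => y t)
        ((μ : Measure C(I, ℝ)).map toCadlag) :=
      aemeasurable_pi_lambda _ fun t => hae t
    rw [AEMeasurable.map_map_of_aemeasurable h1 hme.measurable.aemeasurable]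
    exact (hg.hasGaussianLaw J).isGaussian_map
  · rw [hme.integral_map]
    exact h0 t
  · rw [covariance_map (hae s).aestronglyMeasurable (hae t).aestronglyMeasurable
      hme.measurable.aemeasurable]
    exact hcov s t hst

/-! ### Diagrams in a box as sets of down steps -/

/-- The time at which the boundary path takes the step `-1` along the top of column `j`. -/
def stepTime {a b : ℕ} (π : BoxPartition a b) (j : Fin a) : ℕ := a - 1 - (j : ℕ) + (π.1 j : ℕ)

/-- The set of times at which the boundary path takes a step `-1`. -/
def downSteps {a b : ℕ} (π : BoxPartition a b) : Finset ℕ := Finset.univ.image (stepTime π)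

theorem stepTime_strictAnti {a b : ℕ} (π : BoxPartition a b) : StrictAnti (stepTime π) := by
  intro i j hij
  have h1 : π.1 j ≤ π.1 i := π.2 hij.le
  have h2 : (π.1 j : ℕ) ≤ π.1 i := h1
  have h3 : (i : ℕ) < j := hij
  have := j.2
  unfold stepTime
  omega

/-- The boundary path only depends on the set of down steps: it loses `2` at each of them, relative
to the path with slope `1`. -/
theorem boundary_eq {a b : ℕ} (π : BoxPartition a b) (k : ℕ) :
    π.boundary k = k - 2 * ((downSteps π).filter (· < k)).card := by
  have h : ((downSteps π).filter (· < k)).card =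
      (Finset.univ.filter fun j : Fin a => a - 1 - (j : ℕ) + (π.1 j : ℕ) < k).card := by
    rw [downSteps, Finset.filter_image,
      Finset.card_image_of_injective _ (stepTime_strictAnti π).injective]
    rfl
  rw [h, BoxPartition.boundary]

theorem downSteps_mem {a b : ℕ} (π : BoxPartition a b) :
    downSteps π ∈ Finset.powersetCard a (Finset.range (a + b)) := by
  rw [Finset.mem_powersetCard]
  constructor
  · intro d hd
    obtain ⟨j, -, rfl⟩ := Finset.mem_image.1 hd
    have := j.2
    have := (π.1 j).2
    rw [Finset.mem_range, stepTime]
    omega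
  · rw [downSteps, Finset.card_image_of_injective _ (stepTime_strictAnti π).injective]
    simp

/-- A unit square of the diagram delays one down step by one unit of time. -/
theorem sum_downSteps {a b : ℕ} (π : BoxPartition a b) :
    ∑ d ∈ downSteps π, d = π.area + ∑ j : Fin a, (a - 1 - (j : ℕ)) := by
  rw [downSteps, Finset.sum_image (stepTime_strictAnti π).injective.injOn, BoxPartition.area,
    add_comm, ← Finset.sum_add_distrib]
  rfl

theorem add_sub_le_of_strictMono {a : ℕ} {f : Fin a → ℕ} (hf : StrictMono f) {i j : Fin a}
    (hij : i ≤ j) : f i + ((j : ℕ) - i) ≤ f j := by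
  obtain ⟨k, hk⟩ : ∃ k, (j : ℕ) = i + k := Nat.exists_eq_add_of_le hij
  induction k generalizing j with
  | zero =>
    have : i = j := Fin.ext (by omega)
    subst this
    simp
  | succ k ih =>
    have hj := j.2
    let j' : Fin a := ⟨i + k, by omega⟩
    have h1 := ih (j := j') (Fin.le_def.2 (Nat.le_add_right _ _)) rfl
    have h2 : f j' < f j := hf (Fin.lt_def.2 (by simp only [j']; omega))
    simp only [j'] at h1 h2
    omega

theorem downSteps_injective {a b : ℕ} :
    Function.Injective (downSteps : BoxPartition a b → Finset ℕ) := by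
  intro π π' h
  have hrange : Set.range (stepTime π ∘ Fin.rev) = Set.range (stepTime π' ∘ Fin.rev) := by
    rw [Fin.rev_surjective.range_comp, Fin.rev_surjective.range_comp]
    have := congrArg (fun s : Finset ℕ => (s : Set ℕ)) h
    simpa [downSteps] using this
  have hmono : ∀ p : BoxPartition a b, StrictMono (stepTime p ∘ Fin.rev) := fun p i j hij =>
    stepTime_strictAnti p (Fin.rev_lt_rev.2 hij)
  have heq := (hmono π).range_inj (hmono π') |>.1 hrange
  apply Subtype.ext
  funext j
  have h1 := congrFun heq j.rev
  simp only [Function.comp_apply, Fin.rev_rev, stepTime] at h1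
  exact Fin.ext (by omega)

/-- Every set of `a` times below `a + b` is the set of down steps of a diagram: the column `j` has
height `d - (a - 1 - j)`, where `d` is the `(a - 1 - j)`-th element of the set, counted from `0`. -/
theorem exists_downSteps_eq {a b : ℕ} {D : Finset ℕ}
    (hD : D ∈ Finset.powersetCard a (Finset.range (a + b))) :
    ∃ π : BoxPartition a b, downSteps π = D := by
  obtain ⟨hsub, hcard⟩ := Finset.mem_powersetCard.1 hD
  let e := D.orderEmbOfFin hcard
  have he : StrictMono e := e.strictMono
  have hlt : ∀ i, e i < a + b := fun i =>
    Finset.mem_range.1 (hsub (D.orderEmbOfFin_mem hcard i))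
  have hlow : ∀ i : Fin a, (i : ℕ) ≤ e i := by
    intro i
    have hi := i.2
    have := add_sub_le_of_strictMono he (i := ⟨0, by omega⟩) (j := i) (Fin.le_def.2 (Nat.zero_le _))
    simp only at this
    omega
  have hhigh : ∀ i : Fin a, e i ≤ b + i := by
    intro i
    have hi := i.2
    have := add_sub_le_of_strictMono he (i := i) (j := ⟨a - 1, by omega⟩)
      (Fin.le_def.2 (by simp only; omega))
    have h2 := hlt ⟨a - 1, by omega⟩
    simp only at this
    omega
  refine ⟨⟨fun j => ⟨e j.rev - (j.rev : ℕ), by have := hhigh j.rev; omega⟩, ?_⟩, ?_⟩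
  · intro i j hij
    have h1 := add_sub_le_of_strictMono he (Fin.rev_le_rev.2 hij)
    have h2 := hlow j.rev
    have h3 : (j.rev : ℕ) ≤ i.rev := Fin.rev_le_rev.2 hij
    refine Fin.le_def.2 ?_
    simp only
    omega
  · have h1 : ∀ j : Fin a, a - 1 - (j : ℕ) + (e j.rev - (j.rev : ℕ)) = e j.rev := by
      intro j
      have h2 := hlow j.rev
      have h3 := Fin.val_rev j
      omega
    refine (Finset.image_congr (g := e ∘ Fin.rev) fun j _ => h1 j).trans ?_
    rw [← Finset.image_image, Finset.image_univ_of_surjective Fin.rev_surjective]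
    exact D.image_orderEmbOfFin_univ hcard

theorem sum_boxPartition {M : Type*} [AddCommMonoid M] {a b : ℕ} (F : Finset ℕ → M) :
    ∑ π : BoxPartition a b, F (downSteps π) =
      ∑ D ∈ Finset.powersetCard a (Finset.range (a + b)), F D := by
  refine Finset.sum_bij (fun π _ => downSteps π) (fun π _ => downSteps_mem π)
    (fun π _ π' _ h => downSteps_injective h) (fun D hD => ?_) (fun _ _ => rfl)
  obtain ⟨π, hπ⟩ := exists_downSteps_eq hD
  exact ⟨π, Finset.mem_univ _, hπ⟩

/-- Integrals against the box measure are ratios of sums over sets of down steps: the area of a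
diagram is, up to an additive constant, the sum of the times of its down steps. -/
theorem integral_boxMeasure {E : Type*} [NormedAddCommGroup E] [NormedSpace ℝ E]
    [CompleteSpace E] (a b : ℕ) {q : ℝ}
    (hq : 0 < q) (F : Finset ℕ → E) :
    ∫ π, F (downSteps π) ∂(boxMeasure a b q) =
      (∑ D ∈ Finset.powersetCard a (Finset.range (a + b)), ∏ d ∈ D, q ^ d)⁻¹ •
        ∑ D ∈ Finset.powersetCard a (Finset.range (a + b)), (∏ d ∈ D, q ^ d) • F D := by
  have hZ : 0 < partitionFunction a b q :=
    Finset.sum_pos (fun π _ => pow_pos hq _) Finset.univ_nonempty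
  set κ := q ^ (∑ j : Fin a, (a - 1 - (j : ℕ))) with hκ
  have hκ0 : 0 < κ := pow_pos hq _
  have hw : ∀ π : BoxPartition a b, ∏ d ∈ downSteps π, q ^ d = q ^ π.area * κ := by
    intro π
    rw [Finset.prod_pow_eq_pow_sum, sum_downSteps, pow_add]
  have h1 : ∑ D ∈ Finset.powersetCard a (Finset.range (a + b)), ∏ d ∈ D, q ^ d =
      partitionFunction a b q * κ := by
    rw [← sum_boxPartition, partitionFunction, Finset.sum_mul]
    exact Finset.sum_congr rfl fun π _ => hw π
  rw [h1, ← sum_boxPartition, boxMeasure, integral_finsetSum_measure]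
  · rw [Finset.smul_sum]
    refine Finset.sum_congr rfl fun π _ => ?_
    rw [integral_smul_measure, integral_dirac, hw, smul_smul,
      ENNReal.toReal_ofReal (div_pos (pow_pos hq _) hZ).le]
    congr 1
    field_simp
  · intro π _
    refine Integrable.smul_measure ?_ ENNReal.ofReal_ne_top
    exact integrable_dirac (by simp)

/-! ### Independent Bernoulli sites -/

/-- The weight of `D ⊆ S` when each site `d ∈ S` belongs to `D` independently with
probability `r d`. -/
def siteWeight (r : ℕ → ℝ) (S D : Finset ℕ) : ℝ := (∏ d ∈ D, r d) * ∏ d ∈ S \ D, (1 - r d)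

/-- The expectation of `f D` for the random set `D ⊆ S` which contains each `d ∈ S` independently
with probability `r d`. -/
def siteMean {E : Type*} [AddCommMonoid E] [Module ℝ E] (r : ℕ → ℝ) (S : Finset ℕ)
    (f : Finset ℕ → E) : E :=
  ∑ D ∈ S.powerset, siteWeight r S D • f D

section Module

variable {E : Type*} [AddCommMonoid E] [Module ℝ E]

theorem siteMean_congr {r : ℕ → ℝ} {S : Finset ℕ} {f g : Finset ℕ → E}
    (h : ∀ D ⊆ S, f D = g D) : siteMean r S f = siteMean r S g :=
  Finset.sum_congr rfl fun D hD => by rw [h D (Finset.mem_powerset.1 hD)]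

theorem siteMean_empty (r : ℕ → ℝ) (f : Finset ℕ → E) : siteMean r ∅ f = f ∅ := by
  simp [siteMean, siteWeight]

theorem siteMean_insert (r : ℕ → ℝ) {S : Finset ℕ} {d : ℕ} (hd : d ∉ S) (f : Finset ℕ → E) :
    siteMean r (insert d S) f =
      (1 - r d) • siteMean r S f + r d • siteMean r S (fun D => f (insert d D)) := by
  rw [siteMean, Finset.sum_powerset_insert hd, siteMean, siteMean, Finset.smul_sum,
    Finset.smul_sum]
  congr 1
  · refine Finset.sum_congr rfl fun D hD => ?_
    have hdD : d ∉ D := fun h => hd (Finset.mem_powerset.1 hD h)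
    rw [smul_smul]
    congr 1
    rw [siteWeight, siteWeight, Finset.insert_sdiff_of_notMem _ hdD,
      Finset.prod_insert (by simp [hd])]
    ring
  · refine Finset.sum_congr rfl fun D hD => ?_
    have hdD : d ∉ D := fun h => hd (Finset.mem_powerset.1 hD h)
    rw [smul_smul]
    congr 1
    rw [siteWeight, siteWeight, Finset.prod_insert hdD, Finset.insert_sdiff_insert,
      Finset.sdiff_insert_of_notMem hd]
    ring

/-- Independence of disjoint blocks of sites. -/
theorem siteMean_union (r : ℕ → ℝ) {B C : Finset ℕ} (h : Disjoint B C) (f : Finset ℕ → E) :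
    siteMean r (B ∪ C) f = siteMean r B fun D => siteMean r C fun D' => f (D ∪ D') := by
  induction B using Finset.induction_on generalizing f with
  | empty => simp [siteMean_empty]
  | insert d B hd ih =>
    rw [Finset.disjoint_insert_left] at h
    rw [Finset.insert_union, siteMean_insert r (by simp [hd, h.1]), siteMean_insert r hd,
      ih h.2, ih h.2]
    simp only [Finset.insert_union]

theorem siteMean_add (r : ℕ → ℝ) (S : Finset ℕ) (f g : Finset ℕ → E) :
    siteMean r S (fun D => f D + g D) = siteMean r S f + siteMean r S g := by
  simp [siteMean, Finset.sum_add_distrib]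

end Module

theorem siteMean_const_mul {A : Type*} [Ring A] [Algebra ℝ A] (r : ℕ → ℝ) (S : Finset ℕ) (c : A)
    (f : Finset ℕ → A) : siteMean r S (fun D => c * f D) = c * siteMean r S f := by
  simp [siteMean, Finset.mul_sum]

theorem siteMean_const (r : ℕ → ℝ) (S : Finset ℕ) (c : ℝ) : siteMean r S (fun _ => c) = c := by
  induction S using Finset.induction_on with
  | empty => simp [siteMean_empty]
  | insert d S hd ih => rw [siteMean_insert r hd, ih]; simp only [smul_eq_mul]; ring

theorem siteWeight_nonneg {r : ℕ → ℝ} (hr : ∀ d, r d ∈ Set.Icc (0 : ℝ) 1) (S D : Finset ℕ) :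
    0 ≤ siteWeight r S D :=
  mul_nonneg (Finset.prod_nonneg fun d _ => (hr d).1)
    (Finset.prod_nonneg fun d _ => sub_nonneg.2 (hr d).2)

theorem norm_siteMean_le {E : Type*} [NormedAddCommGroup E] [NormedSpace ℝ E] {r : ℕ → ℝ}
    (hr : ∀ d, r d ∈ Set.Icc (0 : ℝ) 1) (S : Finset ℕ) (f : Finset ℕ → E) :
    ‖siteMean r S f‖ ≤ siteMean r S fun D => ‖f D‖ := by
  refine (norm_sum_le _ _).trans (Finset.sum_le_sum fun D _ => ?_)
  rw [norm_smul, Real.norm_of_nonneg (siteWeight_nonneg hr S D), smul_eq_mul]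

/-- The characteristic function of a linear statistic of the random set is a product over the
sites. -/
theorem siteMean_exp_sum (r : ℕ → ℝ) (S : Finset ℕ) (y : ℕ → ℝ) :
    siteMean r S (fun D => Complex.exp ((∑ d ∈ D, y d : ℝ) * Complex.I)) =
      ∏ d ∈ S, (1 - r d + r d * Complex.exp (y d * Complex.I)) := by
  induction S using Finset.induction_on with
  | empty => simp [siteMean_empty]
  | insert d S hd ih =>
    rw [siteMean_insert r hd, Finset.prod_insert hd, ← ih]
    have h : siteMean r S (fun D => Complex.exp ((∑ e ∈ insert d D, y e : ℝ) * Complex.I)) =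
        Complex.exp (y d * Complex.I) *
          siteMean r S (fun D => Complex.exp ((∑ d ∈ D, y d : ℝ) * Complex.I)) := by
      rw [← siteMean_const_mul]
      refine siteMean_congr fun D hD => ?_
      rw [Finset.sum_insert (fun h => hd (hD h)), ← Complex.exp_add]
      congr 1
      push_cast
      ring
    rw [h, Complex.real_smul, Complex.real_smul]
    push_cast
    ring

theorem siteMean_sub_eq_zero (r : ℕ → ℝ) (S : Finset ℕ) :
    siteMean r S (fun D => (D.card : ℝ) - ∑ d ∈ S, r d) = 0 := by
  induction S using Finset.induction_on with
  | empty => simp [siteMean_empty]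
  | insert d S hd ih =>
    rw [siteMean_insert r hd]
    have h1 : siteMean r S (fun D => (D.card : ℝ) - ∑ e ∈ insert d S, r e) = -r d := by
      have := siteMean_add r S (fun _ => -r d) (fun D => (D.card : ℝ) - ∑ d ∈ S, r d)
      rw [siteMean_const, ih, add_zero] at this
      rw [Finset.sum_insert hd, ← this]
      exact siteMean_congr fun D _ => by ring
    have h2 : siteMean r S (fun D => ((insert d D).card : ℝ) - ∑ e ∈ insert d S, r e) =
        1 - r d := by
      have := siteMean_add r S (fun _ => 1 - r d) (fun D => (D.card : ℝ) - ∑ d ∈ S, r d)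
      rw [siteMean_const, ih, add_zero] at this
      rw [Finset.sum_insert hd, ← this]
      refine siteMean_congr fun D hD => ?_
      rw [Finset.card_insert_of_notMem (fun h => hd (hD h))]
      push_cast
      ring
    rw [h1, h2]
    simp only [smul_eq_mul]
    ring

/-- One step of the moment recursion: adding an independent site. -/
theorem siteMean_insert_sub_pow (r : ℕ → ℝ) {S : Finset ℕ} {d : ℕ} (hd : d ∉ S) (k : ℕ) :
    siteMean r (insert d S) (fun D => ((D.card : ℝ) - ∑ e ∈ insert d S, r e) ^ k) =
      siteMean r S (fun D => (1 - r d) * ((D.card : ℝ) - ∑ e ∈ S, r e - r d) ^ k +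
        r d * ((D.card : ℝ) - ∑ e ∈ S, r e + (1 - r d)) ^ k) := by
  rw [siteMean_insert r hd, siteMean_add, siteMean_const_mul, siteMean_const_mul]
  simp only [smul_eq_mul, Finset.sum_insert hd]
  congr 2
  · exact siteMean_congr fun D _ => by ring
  · refine siteMean_congr fun D hD => ?_
    rw [Finset.card_insert_of_notMem (fun h => hd (hD h))]
    push_cast
    ring

theorem siteMean_sub_sq_le {r : ℕ → ℝ} (hr : ∀ d, r d ∈ Set.Icc (0 : ℝ) 1) (S : Finset ℕ) :
    siteMean r S (fun D => ((D.card : ℝ) - ∑ d ∈ S, r d) ^ 2) ≤ S.card := by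
  induction S using Finset.induction_on with
  | empty => simp [siteMean_empty]
  | insert d S hd ih =>
    rw [siteMean_insert_sub_pow r hd, Finset.card_insert_of_notMem hd]
    have h : siteMean r S (fun D => (1 - r d) * ((D.card : ℝ) - ∑ e ∈ S, r e - r d) ^ 2 +
        r d * ((D.card : ℝ) - ∑ e ∈ S, r e + (1 - r d)) ^ 2) =
        siteMean r S (fun D => ((D.card : ℝ) - ∑ d ∈ S, r d) ^ 2) + r d * (1 - r d) := by
      rw [← siteMean_const r S (r d * (1 - r d)), ← siteMean_add]
      exact siteMean_congr fun D _ => by ring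
    rw [h]
    push_cast
    have h1 := (hr d).1
    have h2 := (hr d).2
    nlinarith

/-- The fourth central moment of the number of occupied sites is at most `3 |S|²`. -/
theorem siteMean_sub_pow_four_le {r : ℕ → ℝ} (hr : ∀ d, r d ∈ Set.Icc (0 : ℝ) 1)
    (S : Finset ℕ) :
    siteMean r S (fun D => ((D.card : ℝ) - ∑ d ∈ S, r d) ^ 4) ≤ 3 * (S.card : ℝ) ^ 2 := by
  induction S using Finset.induction_on with
  | empty => simp [siteMean_empty]
  | insert d S hd ih =>
    rw [siteMean_insert_sub_pow r hd, Finset.card_insert_of_notMem hd]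
    have h1 := (hr d).1
    have h2 := (hr d).2
    set p := r d
    have h : siteMean r S (fun D => (1 - p) * ((D.card : ℝ) - ∑ e ∈ S, r e - p) ^ 4 +
        p * ((D.card : ℝ) - ∑ e ∈ S, r e + (1 - p)) ^ 4) =
        siteMean r S (fun D => ((D.card : ℝ) - ∑ d ∈ S, r d) ^ 4) +
        6 * (p * (1 - p)) * siteMean r S (fun D => ((D.card : ℝ) - ∑ d ∈ S, r d) ^ 2) +
        4 * (p * (1 - p) * (1 - 2 * p)) * siteMean r S (fun D => ((D.card : ℝ) - ∑ d ∈ S, r d)) +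
        (p * (1 - p) ^ 4 + (1 - p) * p ^ 4) := by
      rw [← siteMean_const_mul, ← siteMean_const_mul,
        ← siteMean_const r S (p * (1 - p) ^ 4 + (1 - p) * p ^ 4), ← siteMean_add, ← siteMean_add,
        ← siteMean_add]
      exact siteMean_congr fun D _ => by ring
    rw [h, siteMean_sub_eq_zero]
    have h3 := siteMean_sub_sq_le hr S
    have h4 : 0 ≤ siteMean r S (fun D => ((D.card : ℝ) - ∑ d ∈ S, r d) ^ 2) :=
      Finset.sum_nonneg fun D _ => mul_nonneg (siteWeight_nonneg hr S D) (sq_nonneg _)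
    have h5 : p * (1 - p) ≤ 1 := by nlinarith
    have h6 : p * (1 - p) ^ 4 ≤ 1 := mul_le_one₀ h2 (by positivity)
      (pow_le_one₀ (by linarith) (by linarith))
    have h7 : (1 - p) * p ^ 4 ≤ 1 := mul_le_one₀ (by linarith) (by positivity)
      (pow_le_one₀ h1 h2)
    have h8 : 6 * (p * (1 - p)) * siteMean r S (fun D => ((D.card : ℝ) - ∑ d ∈ S, r d) ^ 2) ≤
        6 * 1 * S.card := by gcongr
    push_cast
    nlinarith

/-! ### Conditioning on the number of occupied sites -/

theorem integral_exp_int (m : ℤ) :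
    ∫ θ in (-Real.pi)..Real.pi, Complex.exp ((m * θ : ℝ) * Complex.I) =
      ((if m = 0 then 2 * Real.pi else 0 : ℝ) : ℂ) := by
  split_ifs with h
  · simp [h]
    ring
  · have hm : (m : ℂ) * Complex.I ≠ 0 := by simp [h]
    have h1 : ∀ θ : ℝ, Complex.exp ((m * θ : ℝ) * Complex.I) =
        Complex.exp ((m : ℂ) * Complex.I * θ) := by
      intro θ; congr 1; push_cast; ring
    simp only [h1]
    rw [integral_exp_mul_complex hm]
    have h2 : Complex.exp ((m : ℂ) * Complex.I * (Real.pi : ℝ)) =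
        Complex.exp ((m : ℂ) * Complex.I * (-Real.pi : ℝ)) := by
      rw [Complex.exp_eq_exp_iff_exists_int]
      exact ⟨m, by push_cast; ring⟩
    rw [h2, sub_self, zero_div, Complex.ofReal_zero]

/-- Fourier inversion: the constraint `|D| = a` is the mean of a character over the circle. -/
theorem siteMean_card_eq (r : ℕ → ℝ) (S : Finset ℕ) (a : ℕ) (F : Finset ℕ → ℂ) :
    (2 * Real.pi : ℂ) * siteMean r S (fun D => if D.card = a then F D else 0) =
      ∫ θ in (-Real.pi)..Real.pi, Complex.exp ((-(a * θ) : ℝ) * Complex.I) *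
        siteMean r S (fun D => Complex.exp ((D.card * θ : ℝ) * Complex.I) * F D) := by
  have h1 : ∀ θ : ℝ, Complex.exp ((-(a * θ) : ℝ) * Complex.I) *
        siteMean r S (fun D => Complex.exp ((D.card * θ : ℝ) * Complex.I) * F D) =
      ∑ D ∈ S.powerset, siteWeight r S D • F D *
        Complex.exp ((((D.card : ℤ) - a : ℤ) * θ : ℝ) * Complex.I) := by
    intro θ
    rw [siteMean, Finset.mul_sum]
    refine Finset.sum_congr rfl fun D _ => ?_
    have h2 : Complex.exp ((((D.card : ℤ) - a : ℤ) * θ : ℝ) * Complex.I) =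
        Complex.exp ((-(a * θ) : ℝ) * Complex.I) * Complex.exp ((D.card * θ : ℝ) * Complex.I) := by
      rw [← Complex.exp_add]; congr 1; push_cast; ring
    rw [h2, Complex.real_smul, Complex.real_smul]
    ring
  simp only [h1]
  rw [intervalIntegral.integral_finsetSum fun D _ =>
    Continuous.intervalIntegrable (by fun_prop) _ _, siteMean, Finset.mul_sum]
  refine Finset.sum_congr rfl fun D _ => ?_
  rw [intervalIntegral.integral_const_mul, integral_exp_int]
  by_cases h : D.card = a
  · simp [h]
    ring
  · have : ¬ ((D.card : ℤ) - a = 0) := by omega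
    simp [h, this]

/-- With odds `w d`, the weight of `D` is proportional to the product of the odds over `D`. -/
theorem siteWeight_eq_div {r w : ℕ → ℝ} (hw : ∀ d, 0 < w d) (hr : ∀ d, r d = w d / (1 + w d))
    {S D : Finset ℕ} (hD : D ⊆ S) :
    siteWeight r S D = (∏ d ∈ D, w d) / ∏ d ∈ S, (1 + w d) := by
  have h1 : ∀ d, 1 - r d = 1 / (1 + w d) := by
    intro d
    have := hw d
    rw [hr]; field_simp; ring
  have h2 : ∀ T : Finset ℕ, ∏ d ∈ T, (1 + w d) ≠ 0 := fun T =>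
    (Finset.prod_pos fun d _ => by have := hw d; linarith).ne'
  rw [siteWeight, ← Finset.prod_sdiff hD]
  simp only [h1]
  simp only [hr, Finset.prod_div_distrib, Finset.prod_const_one]
  have h3 := h2 D
  have h4 := h2 (S \ D)
  field_simp

theorem siteMean_card_eq_powersetCard {G : Type*} [AddCommGroup G] [Module ℝ G] {q A : ℝ}
    (hq : 0 < q) (hA : 0 < A) {r : ℕ → ℝ} (hr : ∀ d, r d = A * q ^ d / (1 + A * q ^ d))
    (S : Finset ℕ) (a : ℕ) (F : Finset ℕ → G) :
    siteMean r S (fun D => if D.card = a then F D else 0) =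
      (A ^ a / ∏ d ∈ S, (1 + A * q ^ d)) •
        ∑ D ∈ Finset.powersetCard a S, (∏ d ∈ D, q ^ d) • F D := by
  have hw : ∀ d, 0 < A * q ^ d := fun d => by positivity
  rw [siteMean, Finset.smul_sum, Finset.powersetCard_eq_filter, Finset.sum_filter]
  refine Finset.sum_congr rfl fun D hD => ?_
  split_ifs with h
  · rw [siteWeight_eq_div hw hr (Finset.mem_powerset.1 hD), Finset.prod_mul_distrib,
      Finset.prod_const, h, smul_smul]
    congr 1
    ring
  · simp

/-- The box measure is the law of independent Bernoulli down steps, with geometric odds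
`A * q ^ d`, conditioned on their number. -/
theorem integral_boxMeasure_eq_siteMean {E : Type*} [NormedAddCommGroup E] [NormedSpace ℝ E]
    [CompleteSpace E] (a b : ℕ) {q A : ℝ} (hq : 0 < q) (hA : 0 < A) {r : ℕ → ℝ}
    (hr : ∀ d, r d = A * q ^ d / (1 + A * q ^ d)) (F : Finset ℕ → E) :
    ∫ π, F (downSteps π) ∂(boxMeasure a b q) =
      (siteMean r (Finset.range (a + b)) fun D => if D.card = a then (1 : ℝ) else 0)⁻¹ •
        siteMean r (Finset.range (a + b)) fun D => if D.card = a then F D else 0 := by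
  set S := Finset.range (a + b)
  have hw : ∀ d, 0 < A * q ^ d := fun d => by positivity
  set Z := ∏ d ∈ S, (1 + A * q ^ d)
  have hZ : 0 < Z := Finset.prod_pos fun d _ => by have := hw d; linarith
  have hκ : 0 < A ^ a / Z := by positivity
  rw [integral_boxMeasure a b hq, siteMean_card_eq_powersetCard hq hA hr,
    siteMean_card_eq_powersetCard hq hA hr, smul_smul]
  congr 1
  simp only [smul_eq_mul, mul_one]
  rw [mul_inv, mul_right_comm, inv_mul_cancel₀ hκ.ne', one_mul]

/-! ### The characteristic function of one site -/

/-- The characteristic function of a centred Bernoulli variable of parameter `r`. -/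
def siteChar (r y : ℝ) : ℂ :=
  (1 - r + r * Complex.exp (y * Complex.I)) * Complex.exp ((-(r * y) : ℝ) * Complex.I)

theorem continuous_siteChar (r : ℝ) : Continuous (siteChar r) := by
  unfold siteChar; fun_prop

theorem norm_exp_sub_taylor_le (u : ℝ) :
    ‖Complex.exp (u * Complex.I) - (1 + u * Complex.I - u ^ 2 / 2)‖ ≤ 4 * |u| ^ 3 := by
  have hu : ‖(u * Complex.I : ℂ)‖ = |u| := by simp
  rcases le_or_gt |u| 1 with h | h
  · have h1 := Complex.norm_exp_sub_sum_le_norm_mul_exp (u * Complex.I) 3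
    rw [hu] at h1
    have h2 : ∑ m ∈ Finset.range 3, (u * Complex.I : ℂ) ^ m / (m.factorial : ℂ) =
        1 + u * Complex.I - u ^ 2 / 2 := by
      simp [Finset.sum_range_succ, mul_pow, Nat.factorial]
      ring
    rw [h2] at h1
    have h3 : Real.exp |u| ≤ 4 := by
      have := Real.exp_one_lt_d9
      have := Real.exp_le_exp.2 h
      linarith
    calc _ ≤ |u| ^ 3 * Real.exp |u| := h1
      _ ≤ |u| ^ 3 * 4 := by gcongr
      _ = _ := by ring
  · have h1 : ‖(1 + u * Complex.I - u ^ 2 / 2 : ℂ)‖ ≤ 1 + |u| + |u| ^ 2 / 2 := by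
      refine (norm_sub_le _ _).trans (add_le_add ((norm_add_le _ _).trans ?_) ?_)
      · rw [hu]; simp
      · simp
    have h2 : ‖Complex.exp (u * Complex.I)‖ = 1 := Complex.norm_exp_ofReal_mul_I u
    refine (norm_sub_le _ _).trans ?_
    rw [h2]
    have h3 : 1 ≤ |u| ^ 2 := one_le_pow₀ h.le
    have h4 : |u| ^ 2 ≤ |u| ^ 3 := pow_le_pow_right₀ h.le (by norm_num)
    have h5 : |u| ≤ |u| ^ 2 := by nlinarith
    linarith

/-- Second order expansion of the characteristic function of a site. -/
theorem norm_siteChar_sub_le {r : ℝ} (hr : r ∈ Set.Icc (0 : ℝ) 1) (y : ℝ) :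
    ‖siteChar r y - (Real.exp (-(r * (1 - r) * y ^ 2 / 2)) : ℝ)‖ ≤ 6 * |y| ^ 3 := by
  obtain ⟨h0, h1⟩ := hr
  have hsc : siteChar r y = (1 - r : ℝ) * Complex.exp ((-(r * y) : ℝ) * Complex.I) +
      (r : ℝ) * Complex.exp (((1 - r) * y : ℝ) * Complex.I) := by
    have : Complex.exp (((1 - r) * y : ℝ) * Complex.I) =
        Complex.exp (y * Complex.I) * Complex.exp ((-(r * y) : ℝ) * Complex.I) := by
      rw [← Complex.exp_add]; congr 1; push_cast; ring
    rw [this, siteChar]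
    push_cast
    ring
  set v := r * (1 - r) * y ^ 2 / 2 with hv
  have hrr : 0 ≤ r * (1 - r) := mul_nonneg h0 (by linarith)
  have hv0 : 0 ≤ v := by positivity
  have hdecomp : siteChar r y - (Real.exp (-v) : ℝ) =
      (1 - r : ℝ) * (Complex.exp ((-(r * y) : ℝ) * Complex.I) -
        (1 + (-(r * y) : ℝ) * Complex.I - ((-(r * y) : ℝ) : ℂ) ^ 2 / 2)) +
      (r : ℝ) * (Complex.exp (((1 - r) * y : ℝ) * Complex.I) -
        (1 + ((1 - r) * y : ℝ) * Complex.I - (((1 - r) * y : ℝ) : ℂ) ^ 2 / 2)) -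
      ((Real.exp (-v) - (1 - v) : ℝ) : ℂ) := by
    rw [hsc, hv]
    push_cast
    ring
  have hA : ‖((1 - r : ℝ) : ℂ) * (Complex.exp ((-(r * y) : ℝ) * Complex.I) -
        (1 + (-(r * y) : ℝ) * Complex.I - ((-(r * y) : ℝ) : ℂ) ^ 2 / 2))‖ ≤
      (1 - r) * (4 * |y| ^ 3) := by
    rw [norm_mul, Complex.norm_real, Real.norm_of_nonneg (by linarith)]
    refine mul_le_mul_of_nonneg_left ((norm_exp_sub_taylor_le _).trans ?_) (by linarith)
    have : |(-(r * y))| ≤ |y| := by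
      rw [abs_neg, abs_mul, abs_of_nonneg h0]
      exact mul_le_of_le_one_left (abs_nonneg _) h1
    gcongr
  have hB : ‖((r : ℝ) : ℂ) * (Complex.exp (((1 - r) * y : ℝ) * Complex.I) -
        (1 + ((1 - r) * y : ℝ) * Complex.I - (((1 - r) * y : ℝ) : ℂ) ^ 2 / 2))‖ ≤
      r * (4 * |y| ^ 3) := by
    rw [norm_mul, Complex.norm_real, Real.norm_of_nonneg h0]
    refine mul_le_mul_of_nonneg_left ((norm_exp_sub_taylor_le _).trans ?_) h0
    have : |((1 - r) * y)| ≤ |y| := by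
      rw [abs_mul, abs_of_nonneg (by linarith : 0 ≤ 1 - r)]
      exact mul_le_of_le_one_left (abs_nonneg _) (by linarith)
    gcongr
  have hC : ‖((Real.exp (-v) - (1 - v) : ℝ) : ℂ)‖ ≤ 2 * |y| ^ 3 := by
    rw [Complex.norm_real, Real.norm_eq_abs]
    have hq : r * (1 - r) ≤ 1 := by nlinarith
    have hvy : v ≤ |y| ^ 2 / 2 := by
      rw [sq_abs, hv]
      have := mul_le_of_le_one_left (sq_nonneg y) hq
      linarith
    rcases le_or_gt |y| 1 with h | h
    · have hv1 : v ≤ 1 := by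
        have : |y| ^ 2 ≤ 1 := pow_le_one₀ (abs_nonneg _) h
        linarith
      have := Real.abs_exp_sub_one_sub_id_le (x := -v) (by rwa [abs_neg, abs_of_nonneg hv0])
      have h2 : Real.exp (-v) - 1 - -v = Real.exp (-v) - (1 - v) := by ring
      rw [h2, neg_sq] at this
      refine this.trans ?_
      calc v ^ 2 ≤ (|y| ^ 2 / 2) ^ 2 := by gcongr
        _ = |y| ^ 3 * (|y| / 4) := by ring
        _ ≤ |y| ^ 3 * 2 := by gcongr; linarith
        _ = _ := by ring
    · have h3 := Real.exp_pos (-v)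
      have h4 : Real.exp (-v) ≤ 1 := Real.exp_le_one_iff.2 (by linarith)
      have h5 : 1 ≤ |y| ^ 3 := one_le_pow₀ h.le
      have h6 : |y| ^ 2 ≤ |y| ^ 3 := pow_le_pow_right₀ h.le (by norm_num)
      rw [abs_le]
      constructor <;> linarith
  rw [hdecomp]
  refine (norm_sub_le _ _).trans ((add_le_add ((norm_add_le _ _).trans (add_le_add hA hB))
    hC).trans (le_of_eq ?_))
  ring

theorem norm_siteChar_le {r : ℝ} (hr : r ∈ Set.Icc (0 : ℝ) 1) (y : ℝ) :
    ‖siteChar r y‖ ≤ Real.exp (-(r * (1 - r) * (1 - Real.cos y))) := by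
  obtain ⟨h0, h1⟩ := hr
  rw [siteChar, norm_mul, Complex.norm_exp_ofReal_mul_I, mul_one]
  have hsq : ‖(1 - r + r * Complex.exp (y * Complex.I) : ℂ)‖ ^ 2 =
      1 - 2 * (r * (1 - r) * (1 - Real.cos y)) := by
    rw [← Complex.normSq_eq_norm_sq, Complex.exp_mul_I, Complex.normSq_apply]
    simp [Complex.cos_ofReal_re, Complex.sin_ofReal_re, Complex.cos_ofReal_im,
      Complex.sin_ofReal_im]
    linear_combination r ^ 2 * Real.sin_sq_add_cos_sq y
  refine le_of_sq_le_sq ?_ (Real.exp_pos _).le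
  rw [hsq, ← Real.exp_nat_mul]
  have := Real.add_one_le_exp (((2 : ℕ) : ℝ) * -(r * (1 - r) * (1 - Real.cos y)))
  push_cast at this ⊢
  linarith

theorem sq_div_le_one_sub_cos {y : ℝ} (hy : |y| ≤ 4) : y ^ 2 / 16 ≤ 1 - Real.cos y := by
  rcases le_or_gt |y| Real.pi with h | h
  · have h1 := Real.cos_le_one_sub_mul_cos_sq h
    have h2 : Real.pi ^ 2 ≤ 16 := by nlinarith [Real.pi_le_four, Real.pi_pos]
    have h3 : 2 / 16 ≤ 2 / Real.pi ^ 2 := by gcongr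
    nlinarith [sq_nonneg y]
  · rw [← Real.cos_abs]
    have h1 : Real.cos |y| ≤ 0 := Real.cos_nonpos_of_pi_div_two_le_of_le
      (by linarith [Real.pi_pos]) (by linarith [Real.pi_gt_three])
    have h2 : y ^ 2 ≤ 16 := by rw [← sq_abs]; nlinarith [abs_nonneg y]
    linarith

/-- Gaussian decay on `|y| ≤ 4`. The fundamental domain is `|y| ≤ π`; the margin up to `4` leaves
room for a bounded perturbation of the frequency. -/
theorem norm_siteChar_le_exp_sq {r g y : ℝ} (hr : r ∈ Set.Icc (0 : ℝ) 1) (hg0 : 0 ≤ g)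
    (hg : g ≤ r * (1 - r)) (hy : |y| ≤ 4) : ‖siteChar r y‖ ≤ Real.exp (-(g / 16 * y ^ 2)) := by
  refine (norm_siteChar_le hr y).trans (Real.exp_le_exp.2 (neg_le_neg ?_))
  have h1 := sq_div_le_one_sub_cos hy
  calc g / 16 * y ^ 2 = g * (y ^ 2 / 16) := by ring
    _ ≤ r * (1 - r) * (1 - Real.cos y) := by gcongr; exact hg0.trans hg

theorem norm_siteChar_le_one {r : ℝ} (hr : r ∈ Set.Icc (0 : ℝ) 1) (y : ℝ) :
    ‖siteChar r y‖ ≤ 1 := by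
  refine (norm_siteChar_le hr y).trans (Real.exp_le_one_iff.2 ?_)
  have := Real.cos_le_one y
  have : 0 ≤ r * (1 - r) * (1 - Real.cos y) :=
    mul_nonneg (mul_nonneg hr.1 (by linarith [hr.2])) (by linarith)
  linarith

theorem norm_prod_sub_prod_le {ι : Type*} (S : Finset ι) (f g : ι → ℂ) (hf : ∀ i, ‖f i‖ ≤ 1)
    (hg : ∀ i, ‖g i‖ ≤ 1) : ‖∏ i ∈ S, f i - ∏ i ∈ S, g i‖ ≤ ∑ i ∈ S, ‖f i - g i‖ := by
  classical
  induction S using Finset.induction_on with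
  | empty => simp
  | insert i S hi ih =>
    rw [Finset.prod_insert hi, Finset.prod_insert hi, Finset.sum_insert hi]
    have h1 : f i * ∏ j ∈ S, f j - g i * ∏ j ∈ S, g j =
        (f i - g i) * ∏ j ∈ S, f j + g i * (∏ j ∈ S, f j - ∏ j ∈ S, g j) := by ring
    rw [h1]
    refine (norm_add_le _ _).trans (add_le_add ?_ ?_)
    · rw [norm_mul]
      refine mul_le_of_le_one_right (norm_nonneg _) ?_
      rw [norm_prod]
      exact Finset.prod_le_one (fun _ _ => norm_nonneg _) fun j _ => hf j
    · rw [norm_mul]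
      exact (mul_le_of_le_one_left (norm_nonneg _) (hg i)).trans ih

/-! ### Asymptotics of the Fourier integral -/

/-- Central limit theorem for independent sites, in Fourier form: only the normalized variance
`q` of the linear statistic with coefficients `t n d + x` enters the limit. -/
theorem tendsto_prod_siteChar {r t : ℕ → ℕ → ℝ} {Λ x q : ℝ}
    (hr : ∀ n d, r n d ∈ Set.Icc (0 : ℝ) 1) (ht : ∀ n d, |t n d| ≤ Λ)
    (hq : Tendsto (fun n : ℕ => (∑ d ∈ Finset.range (2 * n),
      r n d * (1 - r n d) * (t n d + x) ^ 2) / (n : ℝ)) atTop (𝓝 q)) :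
    Tendsto (fun n : ℕ => ∏ d ∈ Finset.range (2 * n), siteChar (r n d) ((t n d + x) / √n))
      atTop (𝓝 (Real.exp (-q / 2) : ℝ)) := by
  have h1 : Tendsto (fun n : ℕ => ((Real.exp (-((∑ d ∈ Finset.range (2 * n),
      r n d * (1 - r n d) * (t n d + x) ^ 2) / n) / 2) : ℝ) : ℂ)) atTop
      (𝓝 (Real.exp (-q / 2) : ℝ)) := by
    refine (Complex.continuous_ofReal.tendsto _).comp ((Real.continuous_exp.tendsto _).comp ?_)
    exact hq.neg.div_const 2
  have h2 : Tendsto (fun n : ℕ => 12 * (Λ + |x|) ^ 3 / √n) atTop (𝓝 0) :=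
    tendsto_const_nhds.div_atTop (Real.tendsto_sqrt_atTop.comp tendsto_natCast_atTop_atTop)
  have h3 : Tendsto (fun n : ℕ => ∏ d ∈ Finset.range (2 * n),
      siteChar (r n d) ((t n d + x) / √n) - ((Real.exp (-((∑ d ∈ Finset.range (2 * n),
      r n d * (1 - r n d) * (t n d + x) ^ 2) / n) / 2) : ℝ) : ℂ)) atTop (𝓝 0) := by
    refine squeeze_zero_norm' ?_ h2
    filter_upwards [eventually_gt_atTop 0] with n hn
    have hn0 : (0 : ℝ) < n := by exact_mod_cast hn
    have hs : (√n : ℝ) ^ 2 = n := Real.sq_sqrt hn0.le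
    have hs0 : 0 < √(n : ℝ) := Real.sqrt_pos.2 hn0
    have h4 : ((Real.exp (-((∑ d ∈ Finset.range (2 * n),
        r n d * (1 - r n d) * (t n d + x) ^ 2) / n) / 2) : ℝ) : ℂ) =
        ∏ d ∈ Finset.range (2 * n),
          ((Real.exp (-(r n d * (1 - r n d) * ((t n d + x) / √n) ^ 2 / 2)) : ℝ) : ℂ) := by
      rw [← Complex.ofReal_prod, ← Real.exp_sum, Finset.sum_div, ← Finset.sum_neg_distrib,
        Finset.sum_div]
      congr 2
      refine Finset.sum_congr rfl fun d _ => ?_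
      rw [div_pow, hs]
      ring
    rw [h4]
    have hterm : ∀ d, ‖siteChar (r n d) ((t n d + x) / √n) -
        ((Real.exp (-(r n d * (1 - r n d) * ((t n d + x) / √n) ^ 2 / 2)) : ℝ) : ℂ)‖ ≤
        6 * ((Λ + |x|) / √n) ^ 3 := by
      intro d
      refine (norm_siteChar_sub_le (hr n d) _).trans ?_
      rw [abs_div, abs_of_pos hs0]
      have : |t n d + x| ≤ Λ + |x| := (abs_add_le _ _).trans (by gcongr; exact ht n d)
      gcongr
    refine (norm_prod_sub_prod_le _ _ _ (fun d => norm_siteChar_le_one (hr n d) _)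
      (fun d => ?_)).trans ((Finset.sum_le_sum fun d _ => hterm d).trans (le_of_eq ?_))
    · rw [Complex.norm_real, Real.norm_of_nonneg (Real.exp_pos _).le, Real.exp_le_one_iff]
      have := mul_nonneg (hr n d).1 (sub_nonneg.2 (hr n d).2)
      have : 0 ≤ r n d * (1 - r n d) * ((t n d + x) / √n) ^ 2 / 2 := by positivity
      linarith
    · rw [Finset.sum_const, Finset.card_range, nsmul_eq_mul]
      push_cast
      rw [div_pow]
      have : (√n : ℝ) ^ 3 = n * √n := by rw [pow_succ, hs]
      rw [this]
      field_simp
      ring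
  simpa using h3.add h1

/-- The local limit theorem in integrated form: the rescaled Fourier integral converges to a
Gaussian integral, by dominated convergence. -/
theorem tendsto_fourier_integral {r t : ℕ → ℕ → ℝ} {δ : ℕ → ℝ} {Λ g : ℝ} {q : ℝ → ℝ}
    (hr : ∀ n d, r n d ∈ Set.Icc (0 : ℝ) 1) (hg : 0 < g)
    (hrg : ∀ n d, d < 2 * n → g ≤ r n d * (1 - r n d))
    (ht : ∀ n d, |t n d| ≤ Λ) (hδ : Tendsto δ atTop (𝓝 0))
    (hq : ∀ x, Tendsto (fun n : ℕ => (∑ d ∈ Finset.range (2 * n),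
      r n d * (1 - r n d) * (t n d + x) ^ 2) / (n : ℝ)) atTop (𝓝 (q x))) :
    Tendsto (fun n : ℕ => ∫ x in (-(Real.pi * √n))..(Real.pi * √n),
      (∏ d ∈ Finset.range (2 * n), siteChar (r n d) ((t n d + x) / √n)) *
        Complex.exp ((x * δ n : ℝ) * Complex.I)) atTop
      (𝓝 (∫ x : ℝ, ((Real.exp (-q x / 2) : ℝ) : ℂ))) := by
  have hΛ : 0 ≤ Λ := (abs_nonneg _).trans (ht 0 0)
  have hsq : Tendsto (fun n : ℕ => √(n : ℝ)) atTop atTop :=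
    Real.tendsto_sqrt_atTop.comp tendsto_natCast_atTop_atTop
  have hle : ∀ n : ℕ, -(Real.pi * √n) ≤ Real.pi * √n := fun n => by
    have : 0 ≤ Real.pi * √n := by positivity
    linarith
  simp only [intervalIntegral.integral_of_le (hle _), ← integral_indicator measurableSet_Ioc]
  refine tendsto_integral_filter_of_dominated_convergence
    (fun x => Real.exp (g / 16 * (2 * Λ ^ 2)) * Real.exp (-(g / 16) * x ^ 2)) ?_ ?_ ?_ ?_
  · refine Eventually.of_forall fun n => ?_
    refine (Continuous.aestronglyMeasurable ?_).indicator measurableSet_Ioc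
    have : ∀ d, Continuous fun x => siteChar (r n d) ((t n d + x) / √n) := fun d =>
      (continuous_siteChar _).comp (by fun_prop)
    fun_prop
  · filter_upwards [eventually_gt_atTop 0, hsq.eventually_ge_atTop (Λ / (4 - Real.pi))]
      with n hn hnΛ
    refine Eventually.of_forall fun x => ?_
    have hn0 : (0 : ℝ) < n := by exact_mod_cast hn
    have hs : (√n : ℝ) ^ 2 = n := Real.sq_sqrt hn0.le
    have hs0 : 0 < √(n : ℝ) := Real.sqrt_pos.2 hn0
    by_cases hx : x ∈ Set.Ioc (-(Real.pi * √n)) (Real.pi * √n)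
    · rw [Set.indicator_of_mem hx, norm_mul, Complex.norm_exp_ofReal_mul_I, mul_one, norm_prod,
        ← Real.exp_add]
      have hxa : |x| ≤ Real.pi * √n := abs_le.2 ⟨hx.1.le, hx.2⟩
      have hpi : 0 < 4 - Real.pi := by linarith [Real.pi_lt_d2]
      have hy : ∀ d, |(t n d + x) / √n| ≤ 4 := by
        intro d
        rw [abs_div, abs_of_pos hs0, div_le_iff₀ hs0]
        rw [div_le_iff₀ hpi] at hnΛ
        have := (abs_add_le (t n d) x).trans (add_le_add (ht n d) hxa)
        linarith
      calc ∏ d ∈ Finset.range (2 * n), ‖siteChar (r n d) ((t n d + x) / √n)‖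
          ≤ ∏ d ∈ Finset.range (2 * n), Real.exp (-(g / 16 * ((x ^ 2 / 2 - Λ ^ 2) / n))) := by
            refine Finset.prod_le_prod (fun _ _ => norm_nonneg _) fun d hd => ?_
            refine (norm_siteChar_le_exp_sq (hr n d) hg.le
              (hrg n d (Finset.mem_range.1 hd)) (hy d)).trans ?_
            rw [Real.exp_le_exp, div_pow, hs, neg_le_neg_iff]
            have h5 : t n d ^ 2 ≤ Λ ^ 2 := sq_le_sq' (abs_le.1 (ht n d)).1 (abs_le.1 (ht n d)).2
            have h6 : x ^ 2 / 2 - Λ ^ 2 ≤ (t n d + x) ^ 2 := by nlinarith [sq_nonneg (x + 2 * t n d)]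
            gcongr
        _ = Real.exp (g / 16 * (2 * Λ ^ 2) + -(g / 16) * x ^ 2) := by
            rw [Finset.prod_const, Finset.card_range, ← Real.exp_nat_mul]
            congr 1
            push_cast
            field_simp
            ring
    · rw [Set.indicator_of_notMem hx, norm_zero]
      positivity
  · exact (integrable_exp_neg_mul_sq (by positivity)).const_mul _
  · refine Eventually.of_forall fun x => ?_
    have h1 : Tendsto (fun n => Complex.exp ((x * δ n : ℝ) * Complex.I)) atTop (𝓝 1) := by
      have h2 : Tendsto (fun n => ((x * δ n : ℝ) * Complex.I : ℂ)) atTop (𝓝 0) := by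
        have h3 := ((Complex.continuous_ofReal.tendsto _).comp (hδ.const_mul x)).mul_const Complex.I
        simpa using h3
      simpa [Function.comp_def] using (Complex.continuous_exp.tendsto _).comp h2
    have h4 := (tendsto_prod_siteChar (x := x) hr ht (hq x)).mul h1
    rw [mul_one] at h4
    refine h4.congr' ?_
    filter_upwards [(hsq.const_mul_atTop Real.pi_pos).eventually_gt_atTop |x|] with n hn
    rw [Set.indicator_of_mem]
    have := abs_lt.1 hn
    exact ⟨this.1, this.2.le⟩

/-! ### The local density of down steps -/

/-- The asymptotic probability of a down step at macroscopic time `s`, when the odds of a down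
step at that time are `A * exp (-2 c s)`. -/
def downRate (A c s : ℝ) : ℝ := A * Real.exp (-2 * c * s) / (1 + A * Real.exp (-2 * c * s))

/-- The primitive of `downRate` vanishing at `0`: the macroscopic number of down steps. -/
def downMean (A c t : ℝ) : ℝ :=
  -(1 / (2 * c)) * Real.log ((1 + A * Real.exp (-2 * c * t)) / (1 + A))

/-- The primitive of the variance `downRate * (1 - downRate)` vanishing at `0`. -/
def downVar (A c t : ℝ) : ℝ := (downRate A c 0 - downRate A c t) / (2 * c)

section Rate

variable {A c : ℝ}

theorem downRate_pos (hA : 0 < A) (s : ℝ) : 0 < downRate A c s := by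
  unfold downRate; positivity

theorem downRate_lt_one (hA : 0 < A) (s : ℝ) : downRate A c s < 1 := by
  have : 0 < A * Real.exp (-2 * c * s) := by positivity
  rw [downRate, div_lt_one (by linarith)]
  linarith

theorem downRate_mem (hA : 0 < A) (s : ℝ) : downRate A c s ∈ Set.Icc (0 : ℝ) 1 :=
  ⟨(downRate_pos hA s).le, (downRate_lt_one hA s).le⟩

theorem hasDerivAt_exp_mul (c s : ℝ) :
    HasDerivAt (fun s => A * Real.exp (-2 * c * s)) (-2 * c * (A * Real.exp (-2 * c * s))) s := by
  have h := (((hasDerivAt_id s).const_mul (-2 * c)).exp).const_mul A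
  refine h.congr_deriv ?_
  simp only [id]
  ring

theorem hasDerivAt_downRate (hA : 0 < A) (s : ℝ) :
    HasDerivAt (downRate A c) (-2 * c * (downRate A c s * (1 - downRate A c s))) s := by
  have h0 : (0 : ℝ) < 1 + A * Real.exp (-2 * c * s) := by positivity
  have h := (hasDerivAt_exp_mul (A := A) c s).div ((hasDerivAt_exp_mul (A := A) c s).const_add 1)
    h0.ne'
  refine HasDerivAt.congr_deriv (f := downRate A c) h ?_
  unfold downRate
  field_simp
  ring

theorem hasDerivAt_downMean (hA : 0 < A) (hc : c ≠ 0) (s : ℝ) :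
    HasDerivAt (downMean A c) (downRate A c s) s := by
  have h0 : (0 : ℝ) < 1 + A * Real.exp (-2 * c * s) := by positivity
  have h1 : (0 : ℝ) < 1 + A := by positivity
  have h := ((((hasDerivAt_exp_mul (A := A) c s).const_add 1).div_const (1 + A)).log
    (by positivity)).const_mul (-(1 / (2 * c)))
  refine HasDerivAt.congr_deriv (f := downMean A c) h ?_
  unfold downRate
  field_simp

theorem hasDerivAt_downVar (hA : 0 < A) (hc : c ≠ 0) (s : ℝ) :
    HasDerivAt (downVar A c) (downRate A c s * (1 - downRate A c s)) s := by
  have h := ((hasDerivAt_downRate (c := c) hA s).const_sub (downRate A c 0)).div_const (2 * c)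
  refine HasDerivAt.congr_deriv (f := downVar A c) h ?_
  field_simp

theorem downMean_zero (hA : 0 < A) : downMean A c 0 = 0 := by
  have h1 : (0 : ℝ) < 1 + A := by positivity
  simp [downMean, div_self h1.ne']

theorem downVar_zero : downVar A c 0 = 0 := by simp [downVar]

theorem abs_sub_le_of_hasDerivAt {F F' : ℝ → ℝ} {K : ℝ} (h : ∀ s, HasDerivAt F (F' s) s)
    (hK : ∀ s, |F' s| ≤ K) (s t : ℝ) : |F s - F t| ≤ K * |s - t| := by
  have := Convex.norm_image_sub_le_of_norm_hasDerivWithin_le (f := F) (f' := F') (s := Set.univ)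
    (C := K) (x := t) (y := s) (fun x _ => (h x).hasDerivWithinAt)
    (fun x _ => hK x) convex_univ (Set.mem_univ _) (Set.mem_univ _)
  simpa [Real.norm_eq_abs] using this

theorem rate_mul_le (hA : 0 < A) (s : ℝ) :
    0 < downRate A c s * (1 - downRate A c s) ∧ downRate A c s * (1 - downRate A c s) ≤ 1 := by
  have h0 := downRate_pos (c := c) hA s
  have h1 := downRate_lt_one (c := c) hA s
  exact ⟨mul_pos h0 (by linarith), by nlinarith⟩

theorem downRate_lipschitz (hA : 0 < A) (s t : ℝ) :
    |downRate A c s - downRate A c t| ≤ 2 * |c| * |s - t| := by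
  refine abs_sub_le_of_hasDerivAt (hasDerivAt_downRate hA) (fun s => ?_) s t
  obtain ⟨h0, h1⟩ := rate_mul_le (c := c) hA s
  rw [abs_mul, abs_of_pos h0, abs_mul, abs_neg, abs_two]
  exact mul_le_of_le_one_right (by positivity) h1

theorem downMean_lipschitz (hA : 0 < A) (hc : c ≠ 0) (s t : ℝ) :
    |downMean A c s - downMean A c t| ≤ |s - t| := by
  have := abs_sub_le_of_hasDerivAt (hasDerivAt_downMean hA hc) (K := 1) (fun s => by
    rw [abs_of_pos (downRate_pos hA s)]; exact (downRate_lt_one hA s).le) s t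
  linarith

theorem downVar_lipschitz (hA : 0 < A) (hc : c ≠ 0) (s t : ℝ) :
    |downVar A c s - downVar A c t| ≤ |s - t| := by
  have := abs_sub_le_of_hasDerivAt (hasDerivAt_downVar hA hc) (K := 1) (fun s => by
    rw [abs_of_pos (rate_mul_le hA s).1]; exact (rate_mul_le hA s).2) s t
  linarith

theorem rate_mul_lipschitz (hA : 0 < A) (s t : ℝ) :
    |downRate A c s * (1 - downRate A c s) - downRate A c t * (1 - downRate A c t)| ≤
      2 * |c| * |s - t| := by
  have h1 : downRate A c s * (1 - downRate A c s) - downRate A c t * (1 - downRate A c t) =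
      (downRate A c s - downRate A c t) * (1 - downRate A c s - downRate A c t) := by ring
  rw [h1, abs_mul]
  have h2 : |1 - downRate A c s - downRate A c t| ≤ 1 := by
    have := downRate_pos (c := c) hA s
    have := downRate_lt_one (c := c) hA s
    have := downRate_pos (c := c) hA t
    have := downRate_lt_one (c := c) hA t
    rw [abs_le]; constructor <;> linarith
  exact (mul_le_of_le_one_right (abs_nonneg _) h2).trans (downRate_lipschitz hA s t)

theorem exists_rate_mul_ge (hA : 0 < A) (c : ℝ) :
    ∃ g, 0 < g ∧ ∀ s ∈ Set.Icc (0 : ℝ) 1, g ≤ downRate A c s * (1 - downRate A c s) := by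
  have hcont : Continuous fun s => downRate A c s * (1 - downRate A c s) := by
    have : Continuous (downRate A c) :=
      continuous_iff_continuousAt.2 fun s => (hasDerivAt_downRate hA s).continuousAt
    fun_prop
  obtain ⟨s, -, hs⟩ := isCompact_Icc.exists_isMinOn (Set.nonempty_Icc.2 zero_le_one)
    hcont.continuousOn
  exact ⟨_, (rate_mul_le hA s).1, fun t ht => hs ht⟩

theorem downVar_one_pos (hA : 0 < A) (hc : c ≠ 0) : 0 < downVar A c 1 := by
  have h : StrictMono (downVar A c) := strictMono_of_hasDerivAt_pos (hasDerivAt_downVar hA hc)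
    fun s => (rate_mul_le hA s).1
  have := h zero_lt_one
  rwa [downVar_zero] at this

end Rate

/-! ### Riemann sums -/

/-- Left Riemann sums of a Lipschitz derivative. -/
theorem abs_riemann_sum_le {F g : ℝ → ℝ} {K h : ℝ} (hF : ∀ s, HasDerivAt F (g s) s)
    (hK : ∀ s t, |g s - g t| ≤ K * |s - t|) (hh : 0 < h) (hF0 : F 0 = 0) (k : ℕ) :
    |h * ∑ d ∈ Finset.range k, g (d * h) - F (k * h)| ≤ k * (K * h ^ 2) := by
  induction k with
  | zero => simp [hF0]
  | succ k ih =>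
    have hstep : |h * g (k * h) - (F ((k + 1 : ℕ) * h) - F (k * h))| ≤ K * h ^ 2 := by
      have hlt : (k : ℝ) * h < (k + 1 : ℕ) * h := by push_cast; nlinarith
      obtain ⟨ξ, hξ, hs⟩ := exists_hasDerivAt_eq_slope F g hlt
        (fun x _ => (hF x).continuousAt.continuousWithinAt) (fun x _ => hF x)
      have hd : ((k + 1 : ℕ) : ℝ) * h - k * h = h := by push_cast; ring
      rw [hd, eq_div_iff hh.ne'] at hs
      rw [← hs]
      have h1 : h * g (k * h) - g ξ * h = h * (g (k * h) - g ξ) := by ring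
      rw [h1, abs_mul, abs_of_pos hh]
      have h2 : |k * h - ξ| ≤ h := by
        rw [abs_le]; constructor <;> linarith [hξ.1, hξ.2]
      have hK0 : 0 ≤ K := by
        have := (abs_nonneg _).trans (hK 1 0)
        simpa using this
      calc h * |g (k * h) - g ξ| ≤ h * (K * h) := by
            refine mul_le_mul_of_nonneg_left ((hK _ _).trans ?_) hh.le
            gcongr
        _ = _ := by ring
    rw [Finset.sum_range_succ]
    have h3 : h * (∑ d ∈ Finset.range k, g (d * h) + g (k * h)) - F ((k + 1 : ℕ) * h) =
        (h * ∑ d ∈ Finset.range k, g (d * h) - F (k * h)) +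
          (h * g (k * h) - (F ((k + 1 : ℕ) * h) - F (k * h))) := by ring
    rw [h3]
    refine (abs_add_le _ _).trans ((add_le_add ih hstep).trans (le_of_eq ?_))
    push_cast
    ring

/-! ### The explicit constants -/

/-- The odds of a down step at time `0` for which the limit shape ends at the corner of the box. -/
def tilt (ρ c : ℝ) : ℝ :=
  (Real.exp (2 * c * ρ) - 1) / (1 - Real.exp (-2 * c * (1 - ρ)))

section Tilt

variable {ρ c : ℝ}

theorem one_sub_exp_ne (hρ : ρ ∈ Set.Ioo (0 : ℝ) 1) (hc : c ≠ 0) :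
    1 - Real.exp (-2 * c * (1 - ρ)) ≠ 0 := by
  rw [sub_ne_zero, ne_comm, Ne, Real.exp_eq_one_iff]
  have := hρ.2
  exact mul_ne_zero (mul_ne_zero (by norm_num) hc) (by linarith)

theorem tilt_pos (hρ : ρ ∈ Set.Ioo (0 : ℝ) 1) (hc : c ≠ 0) : 0 < tilt ρ c := by
  obtain ⟨h0, h1⟩ := hρ
  rcases hc.lt_or_gt with hc | hc
  · refine div_pos_of_neg_of_neg ?_ ?_
    · rw [sub_neg, Real.exp_lt_one_iff]; nlinarith
    · rw [sub_neg, Real.one_lt_exp_iff]; nlinarith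
  · refine div_pos ?_ ?_
    · rw [sub_pos, Real.one_lt_exp_iff]; positivity
    · rw [sub_pos, Real.exp_lt_one_iff]; nlinarith

/-- The denominator in the limit shape, in exponential form. -/
theorem sinh_comb_eq (hρ : ρ ∈ Set.Ioo (0 : ℝ) 1) (hc : c ≠ 0) (t : ℝ) :
    Real.sinh (c * t) + Real.exp (c * (2 * ρ - 1)) * Real.sinh (c * (1 - t)) =
      (1 - Real.exp (-2 * c * (1 - ρ))) / 2 *
        (Real.exp (c * t) * (1 + tilt ρ c * Real.exp (-2 * c * t))) := by
  have h := one_sub_exp_ne hρ hc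
  have h1 : (1 - Real.exp (-2 * c * (1 - ρ))) / 2 *
        (Real.exp (c * t) * (1 + tilt ρ c * Real.exp (-2 * c * t))) =
      1 / 2 * ((1 - Real.exp (-2 * c * (1 - ρ))) * Real.exp (c * t) +
        (Real.exp (2 * c * ρ) - 1) * (Real.exp (c * t) * Real.exp (-2 * c * t))) := by
    rw [tilt]
    generalize 1 - Real.exp (-2 * c * (1 - ρ)) = u at *
    field_simp
  have h2 : Real.exp (c * (2 * ρ - 1)) * Real.exp (c * (1 - t)) =
      Real.exp (2 * c * ρ) * (Real.exp (c * t) * Real.exp (-2 * c * t)) := by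
    rw [← Real.exp_add, ← Real.exp_add, ← Real.exp_add]; congr 1; ring
  have h3 : Real.exp (c * (2 * ρ - 1)) * Real.exp (-(c * (1 - t))) =
      Real.exp (-2 * c * (1 - ρ)) * Real.exp (c * t) := by
    rw [← Real.exp_add, ← Real.exp_add]; congr 1; ring
  have h4 : Real.exp (-(c * t)) = Real.exp (c * t) * Real.exp (-2 * c * t) := by
    rw [← Real.exp_add]; congr 1; ring
  rw [h1, Real.sinh_eq, Real.sinh_eq]
  linear_combination (1 / 2) * h2 - (1 / 2) * h3 - (1 / 2) * h4

theorem one_add_tilt_mul (hρ : ρ ∈ Set.Ioo (0 : ℝ) 1) (hc : c ≠ 0) :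
    Real.sinh c * Real.exp (c * (2 * ρ - 1)) =
      (1 - Real.exp (-2 * c * (1 - ρ))) / 2 * (1 + tilt ρ c) := by
  have h := sinh_comb_eq hρ hc 0
  simp only [mul_zero, Real.sinh_zero, sub_zero, mul_one, Real.exp_zero, zero_add, one_mul] at h
  rw [← h]
  ring

/-- The slope of the limit shape is `1 - 2 * downRate`: the mean step of the boundary path. -/
theorem limitShape_eq (hρ : ρ ∈ Set.Ioo (0 : ℝ) 1) (hc : c ≠ 0) (t : ℝ) :
    limitShape ρ c t = t - 2 * downMean (tilt ρ c) c t := by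
  have hA := tilt_pos hρ hc
  have h := one_sub_exp_ne hρ hc
  have hs : Real.sinh c ≠ 0 := Real.sinh_ne_zero.2 hc
  have h1 : (0 : ℝ) < 1 + tilt ρ c := by positivity
  have h2 : 0 < 1 + tilt ρ c * Real.exp (-2 * c * t) := by positivity
  have h3 : (Real.sinh (c * t) + Real.exp (c * (2 * ρ - 1)) * Real.sinh (c * (1 - t))) /
      Real.sinh c = Real.exp (c * (2 * ρ - 1)) * (Real.exp (c * t) *
        ((1 + tilt ρ c * Real.exp (-2 * c * t)) / (1 + tilt ρ c))) := by
    have h4 := one_add_tilt_mul hρ hc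
    rw [sinh_comb_eq hρ hc, div_eq_iff hs]
    generalize 1 - Real.exp (-2 * c * (1 - ρ)) = u at *
    generalize 1 + tilt ρ c * Real.exp (-2 * c * t) = y at *
    generalize 1 + tilt ρ c = z at *
    field_simp
    linear_combination (-2 : ℝ) * h4
  rw [limitShape, h3, Real.log_mul (Real.exp_pos _).ne' (by positivity),
    Real.log_mul (Real.exp_pos _).ne' (by positivity), Real.log_exp, Real.log_exp, downMean]
  field_simp
  ring

theorem downMean_one (hρ : ρ ∈ Set.Ioo (0 : ℝ) 1) (hc : c ≠ 0) :
    downMean (tilt ρ c) c 1 = ρ := by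
  have h := limitShape_eq hρ hc 1
  rw [limitShape] at h
  simp only [mul_one, sub_self, mul_zero, Real.sinh_zero, add_zero] at h
  rw [div_self (Real.sinh_ne_zero.2 hc), Real.log_one] at h
  linarith

/-- The limiting covariance of the centred number of down steps: independent increments
conditioned to sum to zero. -/
def stepCov (A c s t : ℝ) : ℝ :=
  2 * downVar A c (min s t) - 2 * downVar A c s * downVar A c t / downVar A c 1

theorem fluctScale_mul (hρ : ρ ∈ Set.Ioo (0 : ℝ) 1) (hc : c ≠ 0) (s t : ℝ) :
    fluctScale ρ c s * fluctScale ρ c t = 2 * tilt ρ c /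
      ((Real.exp (c * s) * (1 + tilt ρ c * Real.exp (-2 * c * s))) *
        (Real.exp (c * t) * (1 + tilt ρ c * Real.exp (-2 * c * t)))) := by
  have hA := tilt_pos hρ hc
  have h := one_sub_exp_ne hρ hc
  have h1 : (Real.exp (2 * c * ρ) - 1) * (1 - Real.exp (-2 * c * (1 - ρ))) =
      tilt ρ c * (1 - Real.exp (-2 * c * (1 - ρ))) ^ 2 := by
    rw [tilt]; field_simp
  rw [fluctScale, fluctScale, sinh_comb_eq hρ hc, sinh_comb_eq hρ hc, h1]
  set u := 1 - Real.exp (-2 * c * (1 - ρ))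
  have h2 : √(tilt ρ c * u ^ 2) * √(tilt ρ c * u ^ 2) = tilt ρ c * u ^ 2 :=
    Real.mul_self_sqrt (by positivity)
  have h3 : √(2 : ℝ) * √2 = 2 := Real.mul_self_sqrt (by norm_num)
  set q := √(tilt ρ c * u ^ 2)
  set w := √(2 : ℝ)
  have hw : w ≠ 0 := by intro h0; rw [h0] at h3; norm_num at h3
  have e1 := Real.exp_pos (c * s)
  have e2 := Real.exp_pos (c * t)
  have p1 : 0 < 1 + tilt ρ c * Real.exp (-2 * c * s) := by positivity
  have p2 : 0 < 1 + tilt ρ c * Real.exp (-2 * c * t) := by positivity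
  generalize 1 + tilt ρ c * Real.exp (-2 * c * s) = y1 at *
  generalize 1 + tilt ρ c * Real.exp (-2 * c * t) = y2 at *
  have h4 : 1 / w * (q / (u / 2 * (Real.exp (c * s) * y1))) *
      (1 / w * (q / (u / 2 * (Real.exp (c * t) * y2)))) =
      (q * q) * 4 / ((w * w) * u ^ 2 * ((Real.exp (c * s) * y1) * (Real.exp (c * t) * y2))) := by
    field_simp
    ring
  rw [h4, h2, h3]
  field_simp
  ring

/-- Up to the factor `2 c` this is an increment of `downVar`. -/
theorem downRate_sub (hA : 0 < A) (c s t : ℝ) :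
    downRate A c s - downRate A c t = A * (Real.exp (-2 * c * s) - Real.exp (-2 * c * t)) /
      ((1 + A * Real.exp (-2 * c * s)) * (1 + A * Real.exp (-2 * c * t))) := by
  have p1 : 0 < 1 + A * Real.exp (-2 * c * s) := by positivity
  have p2 : 0 < 1 + A * Real.exp (-2 * c * t) := by positivity
  unfold downRate
  field_simp
  ring

/-- After division by the scale `f`, the covariance becomes that of the Ornstein-Uhlenbeck
bridge. -/
theorem stepCov_div (hρ : ρ ∈ Set.Ioo (0 : ℝ) 1) (hc : c ≠ 0) {s t : ℝ} (hst : s ≤ t) :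
    stepCov (tilt ρ c) c s t / (fluctScale ρ c s * fluctScale ρ c t) =
      Real.sinh (c * s) * Real.sinh (c * (1 - t)) / (c * Real.sinh c) := by
  have hA := tilt_pos hρ hc
  rw [fluctScale_mul hρ hc, stepCov, min_eq_left hst]
  generalize tilt ρ c = A at *
  have hv1 := (downVar_one_pos (c := c) hA hc).ne'
  have h1 : 2 * downVar A c s - 2 * downVar A c s * downVar A c t / downVar A c 1 =
      2 * downVar A c s * (downVar A c 1 - downVar A c t) / downVar A c 1 := by
    field_simp
  have h2 : downVar A c 1 - downVar A c t = (downRate A c t - downRate A c 1) / (2 * c) := by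
    unfold downVar; ring
  rw [h1, h2]
  unfold downVar
  rw [downRate_sub hA, downRate_sub hA, downRate_sub hA]
  rw [mul_one (-2 * c), show Real.exp (-2 * c) = (Real.exp c)⁻¹ ^ 2 by
    rw [← Real.exp_neg, ← Real.exp_nat_mul]; congr 1; push_cast; ring]
  have hexp : ∀ x : ℝ, Real.exp (-2 * c * x) = (Real.exp (c * x))⁻¹ ^ 2 := by
    intro x
    rw [← Real.exp_neg, ← Real.exp_nat_mul]
    congr 1; push_cast; ring
  have hsub : Real.exp (c * (1 - t)) = Real.exp c * (Real.exp (c * t))⁻¹ := by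
    rw [← Real.exp_neg, ← Real.exp_add]; congr 1; ring
  rw [Real.sinh_eq, Real.sinh_eq, Real.sinh_eq, Real.exp_neg, Real.exp_neg, Real.exp_neg, hsub]
  simp only [hexp, mul_zero, mul_one, Real.exp_zero]
  have hE : Real.exp c ^ 2 ≠ 1 := by
    rw [← Real.exp_nat_mul, Ne, Real.exp_eq_one_iff]
    simpa using hc
  have e1 := Real.exp_pos (c * s)
  have e2 := Real.exp_pos (c * t)
  have e3 := Real.exp_pos c
  generalize Real.exp (c * s) = Y at *
  generalize Real.exp (c * t) = X at *
  generalize Real.exp c = E at *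
  have q1 : Y ^ 2 + A ≠ 0 := by positivity
  have q2 : X ^ 2 + A ≠ 0 := by positivity
  have q3 : E ^ 2 + A ≠ 0 := by positivity
  have q4 : E ^ 2 - 1 ≠ 0 := sub_ne_zero.2 hE
  have q5 : 1 + A ≠ 0 := by positivity
  field_simp

end Tilt

/-! ### Characteristic functions of the conditioned sites -/

/-- Fourier formula for the conditioned characteristic function, on the scale `1 / √n` on which
the integrand has a Gaussian limit. -/
theorem siteMean_card_fourier (r t : ℕ → ℝ) {n : ℕ} (hn : 0 < n) (a : ℕ) :
    ((2 * Real.pi * √n : ℝ) : ℂ) * siteMean r (Finset.range (2 * n)) (fun D =>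
      if D.card = a then Complex.exp ((∑ d ∈ D, t d / √n -
        ∑ d ∈ Finset.range (2 * n), t d / √n * r d : ℝ) * Complex.I) else 0) =
    ∫ x in (-(Real.pi * √n))..(Real.pi * √n),
      (∏ d ∈ Finset.range (2 * n), siteChar (r d) ((t d + x) / √n)) *
        Complex.exp ((x * ((∑ d ∈ Finset.range (2 * n), r d - a) / √n) : ℝ) * Complex.I) := by
  have hn0 : (0 : ℝ) < n := by exact_mod_cast hn
  have hs0 : 0 < √(n : ℝ) := Real.sqrt_pos.2 hn0
  set S := Finset.range (2 * n)
  let G : ℝ → ℂ := fun θ => (∏ d ∈ S, siteChar (r d) (t d / √n + θ)) *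
    Complex.exp ((θ * (∑ d ∈ S, r d - a) : ℝ) * Complex.I)
  have h1 : (∫ x in (-(Real.pi * √n))..(Real.pi * √n),
      (∏ d ∈ S, siteChar (r d) ((t d + x) / √n)) *
        Complex.exp ((x * ((∑ d ∈ S, r d - a) / √n) : ℝ) * Complex.I)) =
      √(n : ℝ) • ∫ θ in (-Real.pi)..Real.pi, G θ := by
    have h2 := intervalIntegral.integral_comp_div (a := -(Real.pi * √n)) (b := Real.pi * √n) G
      hs0.ne'
    rw [neg_div, mul_div_cancel_right₀ _ hs0.ne'] at h2
    rw [← h2]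
    refine intervalIntegral.integral_congr fun x _ => ?_
    simp only [G, add_div]
    congr 4
    ring
  rw [h1]
  have h3 : ((2 * Real.pi * √n : ℝ) : ℂ) = (√n : ℝ) * (2 * Real.pi) := by push_cast; ring
  rw [h3, mul_assoc, siteMean_card_eq, Complex.real_smul]
  congr 1
  refine intervalIntegral.integral_congr fun θ _ => ?_
  have h4 : siteMean r S (fun D => Complex.exp ((D.card * θ : ℝ) * Complex.I) *
      Complex.exp ((∑ d ∈ D, t d / √n - ∑ d ∈ S, t d / √n * r d : ℝ) * Complex.I)) =
      Complex.exp ((-∑ d ∈ S, t d / √n * r d : ℝ) * Complex.I) *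
        ∏ d ∈ S, (1 - r d + r d * Complex.exp ((t d / √n + θ : ℝ) * Complex.I)) := by
    rw [← siteMean_exp_sum, ← siteMean_const_mul]
    refine siteMean_congr fun D _ => ?_
    rw [← Complex.exp_add, ← Complex.exp_add, Finset.sum_add_distrib, Finset.sum_const,
      nsmul_eq_mul]
    congr 1
    push_cast
    ring
  simp only [G, siteChar]
  rw [h4, Finset.prod_mul_distrib, ← Complex.exp_sum, ← mul_assoc, ← Complex.exp_add,
    mul_comm (∏ d ∈ S, _), mul_right_comm, ← Complex.exp_add]
  congr 2
  rw [← Finset.sum_mul, ← add_mul, ← add_mul]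
  congr 1
  have h5 : ∑ d ∈ S, (-(r d * (t d / √n + θ))) = -(∑ d ∈ S, t d / √n * r d) - θ * ∑ d ∈ S, r d := by
    rw [Finset.mul_sum, ← Finset.sum_neg_distrib, ← Finset.sum_sub_distrib]
    exact Finset.sum_congr rfl fun d _ => by ring
  rw [← Complex.ofReal_sum, h5]
  push_cast
  ring

theorem integral_gaussian_quadratic {V₂ : ℝ} (hV : 0 < V₂) (V₀ V₁ : ℝ) :
    ∫ x : ℝ, ((Real.exp (-(V₀ + 2 * x * V₁ + x ^ 2 * V₂) / 2) : ℝ) : ℂ) =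
      (Real.pi / (V₂ / 2) : ℂ) ^ (1 / 2 : ℂ) *
        ((Real.exp (-(V₀ - V₁ ^ 2 / V₂) / 2) : ℝ) : ℂ) := by
  have h := integral_cexp_quadratic (b := ((-(V₂ / 2) : ℝ) : ℂ))
    (by rw [Complex.ofReal_re]; linarith) (-V₁ : ℂ) (-(V₀ / 2) : ℂ)
  have h1 : ∀ x : ℝ, ((Real.exp (-(V₀ + 2 * x * V₁ + x ^ 2 * V₂) / 2) : ℝ) : ℂ) =
      Complex.exp (((-(V₂ / 2) : ℝ) : ℂ) * x ^ 2 + (-V₁ : ℂ) * x + (-(V₀ / 2) : ℂ)) := by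
    intro x
    rw [Complex.ofReal_exp]
    congr 1
    push_cast
    ring
  simp only [h1, h]
  have hV' : (V₂ : ℂ) ≠ 0 := by exact_mod_cast hV.ne'
  rw [Complex.ofReal_exp]
  congr 2
  · push_cast; ring
  · push_cast; field_simp; ring

theorem gaussian_prefactor_ne {V₂ : ℝ} (hV : 0 < V₂) :
    (Real.pi / (V₂ / 2) : ℂ) ^ (1 / 2 : ℂ) ≠ 0 := by
  have : (Real.pi / (V₂ / 2) : ℂ) = ((Real.pi / (V₂ / 2) : ℝ) : ℂ) := by push_cast; rfl
  rw [this, Complex.cpow_ne_zero_iff_of_exponent_ne_zero (by norm_num)]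
  exact_mod_cast (by have := Real.pi_pos; positivity : Real.pi / (V₂ / 2) ≠ 0)

/-- The probability of a down step at time `d`, before conditioning, in the box of semiperimeter
`2 n`. For `n = 0` the division by zero makes it `downRate A c 0`. -/
def siteRate (A c : ℝ) (n d : ℕ) : ℝ := downRate A c (d * (1 / (2 * n)))

theorem siteRate_eq (A c : ℝ) (n d : ℕ) :
    siteRate A c n d = A * Real.exp (-c / n) ^ d / (1 + A * Real.exp (-c / n) ^ d) := by
  have h : Real.exp (-c / n) ^ d = Real.exp (-2 * c * (d * (1 / (2 * n)))) := by
    rw [← Real.exp_nat_mul]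
    congr 1
    rcases Nat.eq_zero_or_pos n with rfl | hn
    · simp
    · have : (n : ℝ) ≠ 0 := by exact_mod_cast hn.ne'
      field_simp
  rw [siteRate, downRate, h]

/-- The times before `2 n t` are the natural numbers below `⌈2 n t⌉₊`. -/
theorem filter_lt_eq_range (n : ℕ) {t : ℝ} (ht1 : t ≤ 1) :
    (Finset.range (2 * n)).filter (fun d : ℕ => (d : ℝ) < 2 * n * t) =
      Finset.range ⌈2 * n * t⌉₊ := by
  ext d
  rw [Finset.mem_filter, Finset.mem_range, Finset.mem_range, Nat.lt_ceil, and_iff_right_iff_imp]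
  intro h
  have h0 : (0 : ℝ) ≤ n := n.cast_nonneg
  have h1 : (d : ℝ) < 2 * n := h.trans_le (by nlinarith)
  exact_mod_cast h1

section Limit

variable {A c : ℝ}

/-- Riemann sums of the variance profile. -/
theorem tendsto_sum_variance (hA : 0 < A) (hc : c ≠ 0) {t : ℝ} (ht : t ∈ Set.Icc (0 : ℝ) 1) :
    Tendsto (fun n : ℕ => (∑ d ∈ Finset.range (2 * n), siteRate A c n d * (1 - siteRate A c n d) *
      (if (d : ℝ) < 2 * n * t then 1 else 0)) / (n : ℝ)) atTop (𝓝 (2 * downVar A c t)) := by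
  rw [tendsto_iff_norm_sub_tendsto_zero]
  have h1 : Tendsto (fun n : ℕ => (2 * |c| + 1) / (n : ℝ)) atTop (𝓝 0) :=
    tendsto_const_nhds.div_atTop tendsto_natCast_atTop_atTop
  refine squeeze_zero' (Eventually.of_forall fun n => norm_nonneg _) ?_ h1
  filter_upwards [eventually_gt_atTop 0] with n hn
  have hn0 : (0 : ℝ) < n := by exact_mod_cast hn
  simp only [mul_ite, mul_one, mul_zero]
  rw [← Finset.sum_filter, filter_lt_eq_range n ht.2]
  set k := ⌈2 * n * t⌉₊
  have hx : 0 ≤ 2 * n * t := by have := ht.1; positivity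
  have hk1 : 2 * n * t ≤ k := Nat.le_ceil _
  have hk2 : (k : ℝ) < 2 * n * t + 1 := Nat.ceil_lt_add_one hx
  have hk3 : (k : ℝ) ≤ 2 * n := by
    have : k ≤ 2 * n := Nat.ceil_le.2 (by push_cast; nlinarith [ht.2])
    exact_mod_cast this
  have hh : (0 : ℝ) < 1 / (2 * n) := by positivity
  have hR := abs_riemann_sum_le (hasDerivAt_downVar (c := c) hA hc) (rate_mul_lipschitz hA) hh
    downVar_zero k
  have hL := downVar_lipschitz (c := c) hA hc (k * (1 / (2 * n))) t
  have hkt : |k * (1 / (2 * n)) - t| ≤ 1 / (2 * n) := by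
    have e1 : k * (1 / (2 * n)) - t = (k - 2 * n * t) * (1 / (2 * n)) := by field_simp
    rw [e1, abs_mul, abs_of_pos hh, abs_of_nonneg (by linarith)]
    exact mul_le_of_le_one_left hh.le (by linarith)
  rw [Real.norm_eq_abs]
  have e2 : (∑ d ∈ Finset.range k, siteRate A c n d * (1 - siteRate A c n d)) / (n : ℝ) -
      2 * downVar A c t = 2 * ((1 / (2 * n) * ∑ d ∈ Finset.range k,
        downRate A c (d * (1 / (2 * n))) * (1 - downRate A c (d * (1 / (2 * n)))) -
        downVar A c (k * (1 / (2 * n)))) + (downVar A c (k * (1 / (2 * n))) - downVar A c t)) := by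
    simp only [siteRate]
    field_simp
    ring
  rw [e2, abs_mul, abs_two]
  have e3 : k * (2 * |c| * (1 / (2 * n)) ^ 2) ≤ |c| / n := by
    have : k * (2 * |c| * (1 / (2 * n)) ^ 2) ≤ (2 * n) * (2 * |c| * (1 / (2 * n)) ^ 2) := by
      gcongr
    refine this.trans (le_of_eq ?_)
    field_simp
  have e4 : (2 * |c| + 1) / (n : ℝ) = 2 * (|c| / n + 1 / (2 * n)) := by field_simp
  rw [e4]
  refine mul_le_mul_of_nonneg_left ((abs_add_le _ _).trans (add_le_add (hR.trans e3)
    (hL.trans hkt))) (by norm_num)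

/-- The rescaled centred number of down steps before the macroscopic time `t`. -/
def stepSum (A c : ℝ) (n : ℕ) (t : ℝ) (D : Finset ℕ) : ℝ :=
  ((D.filter fun d : ℕ => (d : ℝ) < 2 * n * t).card - ∑ d ∈ (Finset.range (2 * n)).filter
    (fun d : ℕ => (d : ℝ) < 2 * n * t), siteRate A c n d) / √n

theorem sum_mul_stepSum (J : Finset I) (l : I → ℝ) (n : ℕ) (D : Finset ℕ) :
    ∑ t ∈ J, l t * stepSum A c n t D =
      ∑ d ∈ D, (∑ t ∈ J, l t * if (d : ℝ) < 2 * n * t then 1 else 0) / √n -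
        ∑ d ∈ Finset.range (2 * n), (∑ t ∈ J, l t * if (d : ℝ) < 2 * n * t then 1 else 0) / √n *
          siteRate A c n d := by
  have h1 : ∑ d ∈ D, (∑ t ∈ J, l t * if (d : ℝ) < 2 * n * t then (1 : ℝ) else 0) / √n =
      ∑ t ∈ J, l t * ((D.filter fun d : ℕ => (d : ℝ) < 2 * n * t).card / √n) := by
    rw [← Finset.sum_div, Finset.sum_comm, Finset.sum_div]
    refine Finset.sum_congr rfl fun t _ => ?_
    rw [← Finset.mul_sum, Finset.sum_boole]
    ring
  have h2 : ∑ d ∈ Finset.range (2 * n), (∑ t ∈ J, l t * if (d : ℝ) < 2 * n * t then (1 : ℝ) else 0)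
        / √n * siteRate A c n d =
      ∑ t ∈ J, l t * ((∑ d ∈ (Finset.range (2 * n)).filter
        (fun d : ℕ => (d : ℝ) < 2 * n * t), siteRate A c n d) / √n) := by
    simp only [Finset.sum_div, Finset.sum_mul, Finset.mul_sum, Finset.sum_filter]
    rw [Finset.sum_comm]
    refine Finset.sum_congr rfl fun t _ => Finset.sum_congr rfl fun d _ => ?_
    split_ifs <;> ring
  rw [h1, h2, ← Finset.sum_sub_distrib]
  refine Finset.sum_congr rfl fun t _ => ?_
  rw [stepSum]
  ring

/-- Joint central and local limit theorem: the characteristic function of the linear statistic on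
the event `|D| = a n`, times `2 π √n`, converges. Integrating out the frequency `x` of the
constraint turns the covariance `2 v (min s t)` of independent increments into `stepCov`. -/
theorem tendsto_fourier_steps (hA : 0 < A) (hc : c ≠ 0) {a : ℕ → ℕ}
    (ha : Tendsto (fun n : ℕ => (∑ d ∈ Finset.range (2 * n), siteRate A c n d - a n) / √(n : ℝ))
      atTop (𝓝 0)) (J : Finset I) (l : I → ℝ) :
    Tendsto (fun n : ℕ => ((2 * Real.pi * √n : ℝ) : ℂ) *
      siteMean (siteRate A c n) (Finset.range (2 * n)) (fun D => if D.card = a n then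
        Complex.exp ((∑ t ∈ J, l t * stepSum A c n t D : ℝ) * Complex.I) else 0)) atTop
      (𝓝 ((Real.pi / (2 * downVar A c 1 / 2) : ℂ) ^ (1 / 2 : ℂ) *
        ((Real.exp (-(∑ s ∈ J, ∑ t ∈ J, l s * l t * stepCov A c s t) / 2) : ℝ) : ℂ))) := by
  obtain ⟨g, hg, hgr⟩ := exists_rate_mul_ge hA c
  let T : ℕ → ℕ → ℝ := fun n d => ∑ t ∈ J, l t * if (d : ℝ) < 2 * n * t then 1 else 0
  set V₀ := ∑ s ∈ J, ∑ t ∈ J, l s * l t * (2 * downVar A c (min s t : ℝ)) with hV₀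
  set V₁ := ∑ t ∈ J, l t * (2 * downVar A c t) with hV₁
  set V₂ := 2 * downVar A c 1 with hV₂
  have hV₂pos : 0 < V₂ := by have := downVar_one_pos hA hc; positivity
  have hcov : ∑ s ∈ J, ∑ t ∈ J, l s * l t * stepCov A c s t = V₀ - V₁ ^ 2 / V₂ := by
    have h1 : V₁ ^ 2 / V₂ = ∑ s ∈ J, ∑ t ∈ J, l s * l t *
        (2 * downVar A c s * downVar A c t / downVar A c 1) := by
      rw [sq, hV₁, Finset.sum_mul_sum, Finset.sum_div]
      refine Finset.sum_congr rfl fun s _ => ?_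
      rw [Finset.sum_div]
      refine Finset.sum_congr rfl fun t _ => ?_
      have := (downVar_one_pos (c := c) hA hc).ne'
      rw [hV₂]
      field_simp
    rw [h1, hV₀, ← Finset.sum_sub_distrib]
    refine Finset.sum_congr rfl fun s _ => ?_
    rw [← Finset.sum_sub_distrib]
    refine Finset.sum_congr rfl fun t _ => ?_
    rw [stepCov]
    ring
  have hr : ∀ n d, siteRate A c n d ∈ Set.Icc (0 : ℝ) 1 := fun n d => downRate_mem hA _
  have hrg : ∀ n d, d < 2 * n → g ≤ siteRate A c n d * (1 - siteRate A c n d) := by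
    intro n d hd
    refine hgr _ ⟨by positivity, ?_⟩
    have h1 : (d : ℝ) < 2 * n := by exact_mod_cast hd
    have h2 : (0 : ℝ) < 2 * n := (Nat.cast_nonneg d).trans_lt h1
    rw [mul_one_div, div_le_one h2]
    exact h1.le
  have hT : ∀ n d, |T n d| ≤ ∑ t ∈ J, |l t| := by
    intro n d
    refine (Finset.abs_sum_le_sum_abs _ _).trans (Finset.sum_le_sum fun t _ => ?_)
    rw [abs_mul]
    refine mul_le_of_le_one_right (abs_nonneg _) ?_
    split_ifs <;> simp
  have hq : ∀ x, Tendsto (fun n : ℕ => (∑ d ∈ Finset.range (2 * n),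
      siteRate A c n d * (1 - siteRate A c n d) * (T n d + x) ^ 2) / (n : ℝ)) atTop
      (𝓝 (V₀ + 2 * x * V₁ + x ^ 2 * V₂)) := by
    intro x
    let W : ℕ → ℝ → ℝ := fun n t => (∑ d ∈ Finset.range (2 * n),
      siteRate A c n d * (1 - siteRate A c n d) * (if (d : ℝ) < 2 * n * t then 1 else 0)) / (n : ℝ)
    have hW : ∀ t ∈ Set.Icc (0 : ℝ) 1, Tendsto (fun n => W n t) atTop (𝓝 (2 * downVar A c t)) :=
      fun t ht => tendsto_sum_variance hA hc ht
    have hlim : Tendsto (fun n => ∑ s ∈ J, ∑ t ∈ J, l s * l t * W n (min s t : ℝ) +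
        2 * x * ∑ t ∈ J, l t * W n t + x ^ 2 * W n 1) atTop
        (𝓝 (V₀ + 2 * x * V₁ + x ^ 2 * V₂)) := by
      refine ((tendsto_finsetSum _ fun s _ => tendsto_finsetSum _ fun t _ =>
        (hW _ ⟨le_min s.2.1 t.2.1, (min_le_left _ _).trans s.2.2⟩).const_mul _).add
        ((tendsto_finsetSum _ fun t _ => (hW _ t.2).const_mul _).const_mul _)).add
        ((hW 1 ⟨zero_le_one, le_rfl⟩).const_mul _)
    refine hlim.congr fun n => ?_
    have hmin : ∀ (d : ℕ) (s t : ℝ), (if (d : ℝ) < 2 * n * min s t then (1 : ℝ) else 0) =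
        (if (d : ℝ) < 2 * n * s then 1 else 0) * (if (d : ℝ) < 2 * n * t then 1 else 0) := by
      intro d s t
      have : (d : ℝ) < 2 * n * min s t ↔ (d : ℝ) < 2 * n * s ∧ (d : ℝ) < 2 * n * t := by
        rw [mul_min_of_nonneg _ _ (by positivity : (0 : ℝ) ≤ 2 * n), lt_min_iff]
      by_cases h1 : (d : ℝ) < 2 * n * s <;> by_cases h2 : (d : ℝ) < 2 * n * t <;>
        simp [this, h1, h2]
    have hexp : ∀ d ∈ Finset.range (2 * n), (T n d + x) ^ 2 =
        ∑ s ∈ J, ∑ t ∈ J, l s * l t * (if (d : ℝ) < 2 * n * min (s : ℝ) t then (1 : ℝ) else 0) +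
        2 * x * ∑ t ∈ J, l t * (if (d : ℝ) < 2 * n * t then (1 : ℝ) else 0) +
        x ^ 2 * (if (d : ℝ) < 2 * n * 1 then (1 : ℝ) else 0) := by
      intro d hd
      have hd' : (d : ℝ) < 2 * n * 1 := by
        rw [mul_one]; exact_mod_cast Finset.mem_range.1 hd
      rw [if_pos hd', add_sq, sq (T n d)]
      simp only [T, Finset.sum_mul_sum, hmin]
      have : ∀ s t : I, l s * (if (d : ℝ) < 2 * n * s then (1 : ℝ) else 0) *
          (l t * if (d : ℝ) < 2 * n * t then (1 : ℝ) else 0) =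
          l s * l t * ((if (d : ℝ) < 2 * n * s then 1 else 0) *
            if (d : ℝ) < 2 * n * t then 1 else 0) := fun s t => by ring
      simp only [this]
      ring
    let v : ℕ → ℝ := fun d => siteRate A c n d * (1 - siteRate A c n d)
    let e : ℕ → ℝ → ℝ := fun d t => if (d : ℝ) < 2 * n * t then 1 else 0
    have hsplit : ∑ d ∈ Finset.range (2 * n), v d * (T n d + x) ^ 2 =
        ∑ s ∈ J, ∑ t ∈ J, l s * l t * ∑ d ∈ Finset.range (2 * n), v d * e d (min (s : ℝ) t) +
        2 * x * ∑ t ∈ J, l t * ∑ d ∈ Finset.range (2 * n), v d * e d t +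
        x ^ 2 * ∑ d ∈ Finset.range (2 * n), v d * e d 1 := by
      rw [Finset.sum_congr rfl fun d hd => congrArg (v d * ·) (hexp d hd)]
      simp only [mul_add, Finset.sum_add_distrib, Finset.mul_sum]
      congr 1
      · congr 1
        · rw [Finset.sum_comm]
          refine Finset.sum_congr rfl fun s _ => ?_
          rw [Finset.sum_comm]
          exact Finset.sum_congr rfl fun t _ => Finset.sum_congr rfl fun d _ =>
            mul_left_comm _ _ _
        · rw [Finset.sum_comm]
          refine Finset.sum_congr rfl fun t _ => Finset.sum_congr rfl fun d _ => ?_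
          simp only [e]
          ring
      · exact Finset.sum_congr rfl fun d _ => mul_left_comm _ _ _
    change _ = (∑ d ∈ Finset.range (2 * n), v d * (T n d + x) ^ 2) / n
    rw [hsplit]
    simp only [W, v, e, add_div, Finset.sum_div, mul_div_assoc]
  have hmain := tendsto_fourier_integral (q := fun x => V₀ + 2 * x * V₁ + x ^ 2 * V₂) hr hg hrg hT
    ha hq
  rw [integral_gaussian_quadratic hV₂pos] at hmain
  rw [hcov]
  have hcast : ((2 * downVar A c 1 : ℝ) : ℂ) = 2 * (downVar A c 1 : ℂ) := by push_cast; rfl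
  rw [hV₂, hcast] at hmain
  refine hmain.congr' ?_
  filter_upwards [eventually_gt_atTop 0] with n hn
  rw [← siteMean_card_fourier _ _ hn]
  simp only [sum_mul_stepSum, T]

end Limit

/-! ### Finite-dimensional limits -/

theorem siteMean_ofReal (r : ℕ → ℝ) (S : Finset ℕ) (f : Finset ℕ → ℝ) :
    siteMean r S (fun D => (f D : ℂ)) = ((siteMean r S f : ℝ) : ℂ) := by
  simp [siteMean]

section Limit

variable {A c : ℝ} {a b : ℕ → ℕ}

/-- Local limit theorem: `2 π √n` times the probability of the conditioning event converges. -/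
theorem tendsto_card_prob (hA : 0 < A) (hc : c ≠ 0)
    (ha : Tendsto (fun n : ℕ => (∑ d ∈ Finset.range (2 * n), siteRate A c n d - a n) / √(n : ℝ))
      atTop (𝓝 0)) :
    Tendsto (fun n : ℕ => ((2 * Real.pi * √n : ℝ) : ℂ) *
      ((siteMean (siteRate A c n) (Finset.range (2 * n)) (fun D => if D.card = a n then (1 : ℝ)
        else 0) : ℝ) : ℂ)) atTop
      (𝓝 ((Real.pi / (2 * downVar A c 1 / 2) : ℂ) ^ (1 / 2 : ℂ))) := by
  have h := tendsto_fourier_steps hA hc ha ∅ 0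
  simp only [Finset.sum_empty, neg_zero, zero_div, Real.exp_zero, Complex.ofReal_one, mul_one,
    Complex.ofReal_zero, zero_mul, Complex.exp_zero] at h
  refine h.congr fun n => ?_
  rw [← siteMean_ofReal]
  congr 2
  ext D
  split_ifs <;> simp

theorem prefactor_ne (hA : 0 < A) (hc : c ≠ 0) :
    (Real.pi / (2 * downVar A c 1 / 2) : ℂ) ^ (1 / 2 : ℂ) ≠ 0 := by
  have h := gaussian_prefactor_ne (V₂ := 2 * downVar A c 1)
    (by have := downVar_one_pos hA hc; positivity)
  push_cast at h
  exact h

/-- The conditioned characteristic functions converge to those of a Gaussian process. -/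
theorem tendsto_charFun_stepSum (hA : 0 < A) (hc : c ≠ 0)
    (hab : ∀ n, 1 ≤ n → a n + b n = 2 * n)
    (ha : Tendsto (fun n : ℕ => (∑ d ∈ Finset.range (2 * n), siteRate A c n d - a n) / √(n : ℝ))
      atTop (𝓝 0)) (J : Finset I) (l : I → ℝ) :
    Tendsto (fun n : ℕ => ∫ π, Complex.exp ((∑ t ∈ J, l t * stepSum A c n t (downSteps π) : ℝ) *
        Complex.I) ∂(boxMeasure (a n) (b n) (Real.exp (-c / n)))) atTop
      (𝓝 (Complex.exp (((-(∑ s ∈ J, ∑ t ∈ J, l s * l t * stepCov A c s t) / 2 : ℝ)) : ℂ))) := by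
  have h1 := tendsto_fourier_steps hA hc ha J l
  have h2 := tendsto_card_prob hA hc ha
  have hne := prefactor_ne (c := c) hA hc
  have h3 := h1.div h2 hne
  rw [mul_div_cancel_left₀ _ hne, Complex.ofReal_exp] at h3
  refine h3.congr' ?_
  filter_upwards [eventually_ge_atTop 1] with n hn
  have hn0 : (0 : ℝ) < n := by exact_mod_cast hn
  have hs : ((2 * Real.pi * √n : ℝ) : ℂ) ≠ 0 := by
    have := Real.pi_pos
    exact_mod_cast (by positivity : 2 * Real.pi * √(n : ℝ) ≠ 0)
  rw [Pi.div_apply, mul_div_mul_left _ _ hs,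
    integral_boxMeasure_eq_siteMean (a n) (b n) (Real.exp_pos _) hA (siteRate_eq A c n)
      (fun D => Complex.exp ((∑ t ∈ J, l t * stepSum A c n t D : ℝ) * Complex.I)), hab n hn,
    Complex.real_smul, Complex.ofReal_inv, div_eq_inv_mul]

/-! ### Fourth moments under the conditioned law -/

/-- A block of sites under the constraint `|D| = m`: the remaining sites spread the constraint
over a window of size `√n`. -/
theorem siteMean_card_block_le {r : ℕ → ℝ} {n m : ℕ} {g : ℝ} (hn : 0 < n)
    (hr : ∀ d, r d ∈ Set.Icc (0 : ℝ) 1) (hg : 0 < g)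
    (hrg : ∀ d, d < 2 * n → g ≤ r d * (1 - r d)) {B : Finset ℕ} (hB : B ⊆ Finset.range (2 * n))
    (hBn : B.card ≤ n) {h : Finset ℕ → ℝ} (hh : ∀ D, 0 ≤ h D) :
    2 * Real.pi * siteMean r (Finset.range (2 * n))
      (fun D => if D.card = m then h (D ∩ B) else 0) ≤
      siteMean r B h * √(Real.pi / (g / 16 * n)) := by
  set S := Finset.range (2 * n)
  set C := S \ B
  have hn0 : (0 : ℝ) < n := by exact_mod_cast hn
  have hβ : 0 < g / 16 * n := by positivity
  have hSBC : S = B ∪ C := (Finset.union_sdiff_of_subset hB).symm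
  have hdisj : Disjoint B C := Finset.disjoint_sdiff
  have hCcard : n ≤ C.card := by
    have := Finset.card_sdiff_add_card_eq_card hB
    rw [Finset.card_range] at this
    change n ≤ (S \ B).card
    omega
  have hmean : 0 ≤ siteMean r B h :=
    Finset.sum_nonneg fun D _ => mul_nonneg (siteWeight_nonneg hr B D) (hh D)
  have hpoint : ∀ θ : ℝ, |θ| ≤ Real.pi →
      ‖Complex.exp ((-(m * θ) : ℝ) * Complex.I) * siteMean r S (fun D =>
        Complex.exp ((D.card * θ : ℝ) * Complex.I) * (h (D ∩ B) : ℂ))‖ ≤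
      siteMean r B h * Real.exp (-(g / 16 * n) * θ ^ 2) := by
    intro θ hθ
    rw [norm_mul, Complex.norm_exp_ofReal_mul_I, one_mul]
    have h1 : siteMean r S (fun D => Complex.exp ((D.card * θ : ℝ) * Complex.I) *
        (h (D ∩ B) : ℂ)) = siteMean r B (fun E => (∏ d ∈ C, (1 - r d + r d *
          Complex.exp (θ * Complex.I))) * (Complex.exp ((E.card * θ : ℝ) * Complex.I) * h E)) := by
      rw [hSBC, siteMean_union r hdisj]
      refine siteMean_congr fun E hE => ?_
      rw [← siteMean_exp_sum r C (fun _ => θ), mul_comm, ← siteMean_const_mul]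
      refine siteMean_congr fun F hF => ?_
      have hEF : Disjoint E F := Disjoint.mono hE hF hdisj
      have hint : (E ∪ F) ∩ B = E := by
        rw [Finset.union_inter_distrib_right, Finset.inter_eq_left.2 hE,
          Finset.disjoint_iff_inter_eq_empty.1 (Disjoint.mono hF le_rfl hdisj.symm),
          Finset.union_empty]
      rw [hint, Finset.card_union_of_disjoint hEF, Finset.sum_const, nsmul_eq_mul]
      have h2 : Complex.exp ((((E.card + F.card : ℕ) : ℝ) * θ : ℝ) * Complex.I) =
          Complex.exp ((E.card * θ : ℝ) * Complex.I) *
            Complex.exp ((F.card * θ : ℝ) * Complex.I) := by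
        rw [← Complex.exp_add]; congr 1; push_cast; ring
      rw [h2]
      ring
    rw [h1, siteMean_const_mul, norm_mul, mul_comm (siteMean r B h)]
    -- the sites outside `B`, at least `n` of them, give the Gaussian decay in `θ`
    refine mul_le_mul ?_ ?_ (norm_nonneg _) (Real.exp_pos _).le
    · rw [norm_prod]
      have h3 : ∀ d ∈ C, ‖(1 - r d + r d * Complex.exp (θ * Complex.I) : ℂ)‖ ≤
          Real.exp (-(g / 16 * θ ^ 2)) := by
        intro d hd
        have hd' : d < 2 * n := Finset.mem_range.1 (Finset.mem_sdiff.1 hd).1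
        have h4 := norm_siteChar_le_exp_sq (hr d) hg.le (hrg d hd')
          (hθ.trans Real.pi_le_four)
        rwa [siteChar, norm_mul, Complex.norm_exp_ofReal_mul_I, mul_one] at h4
      refine (Finset.prod_le_prod (fun _ _ => norm_nonneg _) h3).trans ?_
      rw [Finset.prod_const, ← Real.exp_nat_mul, Real.exp_le_exp]
      have h5 : (n : ℝ) ≤ C.card := by exact_mod_cast hCcard
      have h6 : 0 ≤ g / 16 * θ ^ 2 := by positivity
      nlinarith
    · refine (norm_siteMean_le hr B _).trans (le_of_eq (siteMean_congr fun E _ => ?_))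
      rw [norm_mul, Complex.norm_exp_ofReal_mul_I, one_mul, Complex.norm_real,
        Real.norm_of_nonneg (hh E)]
  have hle : -Real.pi ≤ Real.pi := by linarith [Real.pi_pos]
  have hgauss : Integrable fun θ : ℝ => siteMean r B h * Real.exp (-(g / 16 * n) * θ ^ 2) :=
    (integrable_exp_neg_mul_sq hβ).const_mul _
  have hmain : ‖(2 * Real.pi : ℂ) * siteMean r S (fun D =>
      if D.card = m then (h (D ∩ B) : ℂ) else 0)‖ ≤
      siteMean r B h * √(Real.pi / (g / 16 * n)) := by
    rw [siteMean_card_eq]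
    refine (intervalIntegral.norm_integral_le_of_norm_le hle
      (g := fun θ => siteMean r B h * Real.exp (-(g / 16 * n) * θ ^ 2))
      (Eventually.of_forall fun θ hθ => hpoint θ (abs_le.2 ⟨hθ.1.le, hθ.2⟩))
      hgauss.intervalIntegrable).trans ?_
    rw [intervalIntegral.integral_of_le hle]
    refine (setIntegral_le_integral hgauss (Eventually.of_forall fun θ =>
      mul_nonneg hmean (Real.exp_pos _).le)).trans (le_of_eq ?_)
    rw [integral_const_mul, integral_gaussian]
  have hcast : siteMean r S (fun D => if D.card = m then (h (D ∩ B) : ℂ) else 0) =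
      ((siteMean r S (fun D => if D.card = m then h (D ∩ B) else 0) : ℝ) : ℂ) := by
    rw [← siteMean_ofReal]
    refine siteMean_congr fun D _ => ?_
    split_ifs <;> simp
  have h2 : (2 * Real.pi : ℂ) = ((2 * Real.pi : ℝ) : ℂ) := by push_cast; rfl
  rw [hcast, h2, ← Complex.ofReal_mul, Complex.norm_real] at hmain
  exact (le_abs_self _).trans hmain

/-- The number of down steps before time `k`, minus its mean before conditioning. -/
def centredCount (A c : ℝ) (n : ℕ) (D : Finset ℕ) (k : ℕ) : ℝ :=
  (D.filter (· < k)).card - ∑ d ∈ Finset.range k, siteRate A c n d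

theorem centredCount_sub (n : ℕ) (D : Finset ℕ) {k l : ℕ} (hkl : k ≤ l) :
    centredCount A c n D l - centredCount A c n D k =
      (D ∩ Finset.Ico k l).card - ∑ d ∈ Finset.Ico k l, siteRate A c n d := by
  have h1 : (D.filter (· < l)).card = (D.filter (· < k)).card + (D ∩ Finset.Ico k l).card := by
    rw [← Finset.card_union_of_disjoint]
    · congr 1
      ext d
      simp only [Finset.mem_filter, Finset.mem_union, Finset.mem_inter, Finset.mem_Ico]
      constructor
      · rintro ⟨h1, h2⟩
        by_cases h3 : d < k
        · exact Or.inl ⟨h1, h3⟩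
        · exact Or.inr ⟨h1, by omega, h2⟩
      · rintro (⟨h1, h2⟩ | ⟨h1, h2, h3⟩)
        · exact ⟨h1, by omega⟩
        · exact ⟨h1, h3⟩
    · rw [Finset.disjoint_left]
      intro d hd hd'
      simp only [Finset.mem_filter, Finset.mem_inter, Finset.mem_Ico] at hd hd'
      omega
  have h2 := Finset.sum_range_add_sum_Ico (fun d => siteRate A c n d) hkl
  rw [centredCount, centredCount, h1, ← h2]
  push_cast
  ring

/-- Conditioning costs only a constant factor on blocks of at most `n` sites: the event `|D| = a n`
has a probability of order `1 / √n`, and given the sites in the block one of at most that order. -/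
theorem exists_block_fourth_moment_le (hA : 0 < A) (hc : c ≠ 0)
    (hab : ∀ n, 1 ≤ n → a n + b n = 2 * n)
    (ha : Tendsto (fun n : ℕ => (∑ d ∈ Finset.range (2 * n), siteRate A c n d - a n) / √(n : ℝ))
      atTop (𝓝 0)) :
    ∃ C, 0 ≤ C ∧ ∀ᶠ n : ℕ in atTop, ∀ B ⊆ Finset.range (2 * n), B.card ≤ n →
      ∫ π, (((downSteps π ∩ B).card : ℝ) - ∑ d ∈ B, siteRate A c n d) ^ 4
        ∂(boxMeasure (a n) (b n) (Real.exp (-c / n))) ≤ C * (B.card : ℝ) ^ 2 := by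
  obtain ⟨g, hg, hgr⟩ := exists_rate_mul_ge hA c
  have hprob := (tendsto_card_prob hA hc ha).norm
  have hpos := norm_pos_iff.2 (prefactor_ne (c := c) hA hc)
  set κ := ‖(Real.pi / (2 * downVar A c 1 / 2) : ℂ) ^ (1 / 2 : ℂ)‖ with hκ
  refine ⟨3 * √(Real.pi / (g / 16)) / (κ / 2), by positivity, ?_⟩
  filter_upwards [eventually_ge_atTop 1,
    hprob.eventually (lt_mem_nhds (half_lt_self hpos))] with n hn hpn B hB hBn
  have hn0 : (0 : ℝ) < n := by exact_mod_cast hn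
  have hpi := Real.pi_pos
  have hs0 : 0 < √(n : ℝ) := Real.sqrt_pos.2 hn0
  have hr : ∀ d, siteRate A c n d ∈ Set.Icc (0 : ℝ) 1 := fun d => downRate_mem hA _
  have hrg : ∀ d, d < 2 * n → g ≤ siteRate A c n d * (1 - siteRate A c n d) := by
    intro d hd
    refine hgr _ ⟨by positivity, ?_⟩
    have h1 : (d : ℝ) < 2 * n := by exact_mod_cast hd
    rw [mul_one_div, div_le_one (by positivity)]
    exact h1.le
  set p := siteMean (siteRate A c n) (Finset.range (2 * n))
    (fun D => if D.card = a n then (1 : ℝ) else 0) with hp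
  have hp0 : 0 ≤ p := Finset.sum_nonneg fun D _ => mul_nonneg (siteWeight_nonneg hr _ D)
    (by simp only; split_ifs <;> norm_num)
  rw [← Complex.ofReal_mul, Complex.norm_real, Real.norm_of_nonneg (by positivity)] at hpn
  have hp1 : 0 < p := by
    by_contra hcon
    have : p = 0 := le_antisymm (not_lt.1 hcon) hp0
    rw [this, mul_zero] at hpn
    linarith
  rw [integral_boxMeasure_eq_siteMean (a n) (b n) (Real.exp_pos _) hA (siteRate_eq A c n)
    (fun D => (((D ∩ B).card : ℝ) - ∑ d ∈ B, siteRate A c n d) ^ 4), hab n hn, ← hp, smul_eq_mul,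
    inv_mul_le_iff₀ hp1]
  have h1 := siteMean_card_block_le (m := a n) hn hr hg hrg hB hBn
    (h := fun E => ((E.card : ℝ) - ∑ d ∈ B, siteRate A c n d) ^ 4) (fun D => by positivity)
  have h2 := siteMean_sub_pow_four_le hr B
  set M := siteMean (siteRate A c n) (Finset.range (2 * n)) fun D =>
    if D.card = a n then (((D ∩ B).card : ℝ) - ∑ d ∈ B, siteRate A c n d) ^ 4 else 0
  have h3 : √(Real.pi / (g / 16 * n)) = √(Real.pi / (g / 16)) / √n := by
    rw [← Real.sqrt_div' _ hn0.le, div_div]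
  rw [h3] at h1
  set q := √(Real.pi / (g / 16))
  have hq : 0 ≤ q := Real.sqrt_nonneg _
  have h4 : 2 * Real.pi * M ≤ 3 * (B.card : ℝ) ^ 2 * (q / √n) :=
    h1.trans (mul_le_mul_of_nonneg_right h2 (by positivity))
  have h5 : 2 * Real.pi * √n * M ≤ 3 * (B.card : ℝ) ^ 2 * q := by
    have := mul_le_mul_of_nonneg_right h4 hs0.le
    have e : 3 * (B.card : ℝ) ^ 2 * (q / √n) * √n = 3 * (B.card : ℝ) ^ 2 * q := by field_simp
    linarith
  have h6 : 3 * (B.card : ℝ) ^ 2 * q ≤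
      2 * Real.pi * √n * (p * (3 * q / (κ / 2) * (B.card : ℝ) ^ 2)) := by
    have e : 2 * Real.pi * √n * (p * (3 * q / (κ / 2) * (B.card : ℝ) ^ 2)) =
        (3 * (B.card : ℝ) ^ 2 * q) * ((2 * Real.pi * √n * p) / (κ / 2)) := by
      field_simp
    rw [e]
    refine le_mul_of_one_le_right (by positivity) ?_
    rw [one_le_div (by positivity)]
    exact hpn.le
  exact le_of_mul_le_mul_left (h5.trans h6) (by positivity)

instance (a b : ℕ) : MeasurableSingletonClass (BoxPartition a b) := ⟨fun _ => trivial⟩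

instance (a b : ℕ) (q : ℝ) : IsFiniteMeasure (boxMeasure a b q) := by
  constructor
  simp only [boxMeasure, Measure.finsetSum_apply, Measure.smul_apply, measure_univ, smul_eq_mul,
    mul_one]
  exact ENNReal.sum_lt_top.2 fun π _ => ENNReal.ofReal_lt_top

theorem integrable_box {a b : ℕ} {q : ℝ} {E : Type*} [NormedAddCommGroup E]
    (F : BoxPartition a b → E) : Integrable F (boxMeasure a b q) :=
  Integrable.of_finite

theorem add_pow_four_le (x y : ℝ) : (x + y) ^ 4 ≤ 8 * x ^ 4 + 8 * y ^ 4 := by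
  nlinarith [sq_nonneg (x - y), sq_nonneg (x + y), sq_nonneg (x ^ 2 - y ^ 2),
    mul_nonneg (sq_nonneg (x - y)) (sq_nonneg (x + y)), mul_nonneg (sq_nonneg (x - y))
    (add_nonneg (sq_nonneg x) (sq_nonneg y))]

/-- Blocks of more than `n` sites are cut into two blocks. -/
theorem exists_count_fourth_moment_le (hA : 0 < A) (hc : c ≠ 0)
    (hab : ∀ n, 1 ≤ n → a n + b n = 2 * n)
    (ha : Tendsto (fun n : ℕ => (∑ d ∈ Finset.range (2 * n), siteRate A c n d - a n) / √(n : ℝ))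
      atTop (𝓝 0)) :
    ∃ C, 0 ≤ C ∧ ∀ᶠ n : ℕ in atTop, ∀ k l, k ≤ l → l ≤ 2 * n →
      ∫ π, (centredCount A c n (downSteps π) l - centredCount A c n (downSteps π) k) ^ 4
        ∂(boxMeasure (a n) (b n) (Real.exp (-c / n))) ≤ C * ((l : ℝ) - k) ^ 2 := by
  obtain ⟨C, hC, hev⟩ := exists_block_fourth_moment_le hA hc hab ha
  refine ⟨16 * C, by positivity, ?_⟩
  filter_upwards [hev] with n hn
  have key : ∀ k l, k ≤ l → l ≤ 2 * n → l - k ≤ n →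
      ∫ π, (centredCount A c n (downSteps π) l - centredCount A c n (downSteps π) k) ^ 4
        ∂(boxMeasure (a n) (b n) (Real.exp (-c / n))) ≤ C * ((l : ℝ) - k) ^ 2 := by
    intro k l hkl hl hkn
    have h := hn (Finset.Ico k l) (fun d hd => by
      rw [Finset.mem_Ico] at hd; rw [Finset.mem_range]; omega) (by simpa using hkn)
    simp only [centredCount_sub _ _ hkl]
    rwa [Nat.card_Ico, Nat.cast_sub hkl] at h
  intro k l hkl hl
  by_cases hkn : l - k ≤ n
  · refine (key k l hkl hl hkn).trans ?_
    have := mul_nonneg hC (sq_nonneg ((l : ℝ) - k))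
    linarith
  · have h1 := key k (k + n) (by omega) (by omega) (by omega)
    have h2 := key (k + n) l (by omega) hl (by omega)
    calc ∫ π, (centredCount A c n (downSteps π) l - centredCount A c n (downSteps π) k) ^ 4
        ∂(boxMeasure (a n) (b n) (Real.exp (-c / n)))
        ≤ ∫ π, (8 * (centredCount A c n (downSteps π) (k + n) -
              centredCount A c n (downSteps π) k) ^ 4 +
            8 * (centredCount A c n (downSteps π) l -
              centredCount A c n (downSteps π) (k + n)) ^ 4)
            ∂(boxMeasure (a n) (b n) (Real.exp (-c / n))) := by
          refine integral_mono (integrable_box _) (integrable_box _) fun π => ?_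
          have e : centredCount A c n (downSteps π) l - centredCount A c n (downSteps π) k =
            (centredCount A c n (downSteps π) (k + n) - centredCount A c n (downSteps π) k) +
            (centredCount A c n (downSteps π) l - centredCount A c n (downSteps π) (k + n)) := by
            ring
          simp only
          rw [e]
          exact add_pow_four_le _ _
      _ ≤ 8 * (C * (((k + n : ℕ) : ℝ) - k) ^ 2) + 8 * (C * ((l : ℝ) - (k + n : ℕ)) ^ 2) := by
          rw [integral_add (integrable_box _) (integrable_box _), integral_const_mul,
            integral_const_mul]
          linarith
      _ ≤ 16 * C * ((l : ℝ) - k) ^ 2 := by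
          have h3 : (k : ℝ) + n ≤ l := by exact_mod_cast (by omega : k + n ≤ l)
          have h4 : (0 : ℝ) ≤ n := n.cast_nonneg
          push_cast
          have h5 : ((k : ℝ) + n - k) ^ 2 ≤ ((l : ℝ) - k) ^ 2 := by
            apply pow_le_pow_left₀ <;> linarith
          have h6 : ((l : ℝ) - (k + n)) ^ 2 ≤ ((l : ℝ) - k) ^ 2 := by
            apply pow_le_pow_left₀ <;> linarith
          have h7 := mul_le_mul_of_nonneg_left h5 hC
          have h8 := mul_le_mul_of_nonneg_left h6 hC
          linarith

end Limit

/-! ### Interpolated paths -/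

section Interp

variable {x : ℕ → ℝ}

theorem abs_sub_le_of_step (hx : ∀ k, |x (k + 1) - x k| ≤ 1) {k l : ℕ} (hkl : k ≤ l) :
    |x l - x k| ≤ (l : ℝ) - k := by
  induction l, hkl using Nat.le_induction with
  | base => simp
  | succ l _ ih =>
    have h := abs_add_le (x (l + 1) - x l) (x l - x k)
    rw [sub_add_sub_cancel] at h
    push_cast
    linarith [hx l]

theorem linearInterp_natCast (x : ℕ → ℝ) (k : ℕ) : linearInterp x k = x k := by
  simp [linearInterp]

theorem abs_linearInterp_sub_le (hx : ∀ k, |x (k + 1) - x k| ≤ 1) {s t : ℝ} (hs : 0 ≤ s)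
    (ht : 0 ≤ t) : |linearInterp x s - linearInterp x t| ≤ |s - t| := by
  wlog hst : t ≤ s generalizing s t
  · rw [abs_sub_comm, abs_sub_comm s]
    exact this ht hs (le_of_not_ge hst)
  rw [abs_of_nonneg (sub_nonneg.2 hst)]
  have hs1 := Nat.floor_le hs
  have ht1 := Nat.floor_le ht
  have ht2 := Nat.lt_floor_add_one t
  have hmul : ∀ (r : ℝ) (k : ℕ), 0 ≤ r → |r * (x (k + 1) - x k)| ≤ r := fun r k hr => by
    rw [abs_mul, abs_of_nonneg hr]
    exact mul_le_of_le_one_right hr (hx k)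
  rcases (Nat.floor_le_floor hst).eq_or_lt with h | h
  · have e : linearInterp x s - linearInterp x t = (s - t) * (x (⌊s⌋₊ + 1) - x ⌊s⌋₊) := by
      rw [linearInterp, linearInterp, h]; ring
    rw [e]
    exact hmul _ _ (sub_nonneg.2 hst)
  · have e : linearInterp x s - linearInterp x t = (s - ⌊s⌋₊) * (x (⌊s⌋₊ + 1) - x ⌊s⌋₊) +
        (x ⌊s⌋₊ - x (⌊t⌋₊ + 1)) + (1 - (t - ⌊t⌋₊)) * (x (⌊t⌋₊ + 1) - x ⌊t⌋₊) := by
      rw [linearInterp, linearInterp]; ring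
    rw [e]
    refine (abs_add_three _ _ _).trans ?_
    have h1 := hmul (s - ⌊s⌋₊) ⌊s⌋₊ (by linarith)
    have h2 := abs_sub_le_of_step hx (Nat.succ_le_of_lt h)
    have h3 := hmul (1 - (t - ⌊t⌋₊)) ⌊t⌋₊ (by linarith)
    push_cast [Nat.succ_eq_add_one] at h2
    linarith

theorem abs_linearInterp_sub_ceil_le (hx : ∀ k, |x (k + 1) - x k| ≤ 1) {s : ℝ} (hs : 0 ≤ s) :
    |linearInterp x s - x ⌈s⌉₊| ≤ 1 := by
  rw [← linearInterp_natCast x ⌈s⌉₊]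
  refine (abs_linearInterp_sub_le hx hs (Nat.cast_nonneg _)).trans ?_
  rw [abs_le]
  constructor <;> linarith [Nat.le_ceil s, Nat.ceil_lt_add_one hs]

theorem abs_linearInterp_sub_floor_le (hx : ∀ k, |x (k + 1) - x k| ≤ 1) {s : ℝ} (hs : 0 ≤ s) :
    |linearInterp x s - x ⌊s⌋₊| ≤ 1 := by
  rw [← linearInterp_natCast x ⌊s⌋₊]
  refine (abs_linearInterp_sub_le hx hs (Nat.cast_nonneg _)).trans ?_
  rw [abs_le]
  constructor <;> linarith [Nat.floor_le hs, Nat.lt_floor_add_one s]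

end Interp

section Paths

variable {A c : ℝ}

theorem siteRate_mem (hA : 0 < A) (n d : ℕ) : siteRate A c n d ∈ Set.Icc (0 : ℝ) 1 :=
  downRate_mem hA _

theorem abs_centredCount_step_le (hA : 0 < A) (n : ℕ) (D : Finset ℕ) (k : ℕ) :
    |centredCount A c n D (k + 1) - centredCount A c n D k| ≤ 1 := by
  obtain ⟨h0, h1⟩ := siteRate_mem (c := c) hA n k
  rw [centredCount_sub n D k.le_succ, Nat.Ico_succ_singleton, Finset.sum_singleton]
  have h2 : (D ∩ {k}).card ≤ 1 := (Finset.card_le_card Finset.inter_subset_right).trans (by simp)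
  have h3 : ((D ∩ {k}).card : ℝ) ≤ 1 := by exact_mod_cast h2
  have h4 : (0 : ℝ) ≤ (D ∩ {k}).card := Nat.cast_nonneg _
  rw [abs_le]
  constructor <;> linarith

/-- The interpolated centred number of down steps, rescaled to `[0,1]` and divided by `√n`. -/
def countPath (A c : ℝ) (n : ℕ) (D : Finset ℕ) : C(I, ℝ) where
  toFun t := linearInterp (centredCount A c n D) (2 * n * t) / √n
  continuous_toFun := ((continuousOn_linearInterp _).comp_continuous (by fun_prop) fun t : I =>
    mul_nonneg (by positivity) t.2.1).div_const _

theorem countPath_apply (n : ℕ) (D : Finset ℕ) (t : I) :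
    countPath A c n D t = linearInterp (centredCount A c n D) (2 * n * t) / √n := rfl

theorem countPath_zero (n : ℕ) (D : Finset ℕ) : countPath A c n D 0 = 0 := by
  simp [countPath_apply, linearInterp, centredCount]

/-- Interpolation changes the number of down steps before `2 n t` by at most one. -/
theorem abs_countPath_sub_stepSum_le (hA : 0 < A) (n : ℕ) (D : Finset ℕ) (t : I) :
    |countPath A c n D t - stepSum A c n t D| ≤ 1 / √n := by
  have h0 : (0 : ℝ) ≤ 2 * n * t := mul_nonneg (by positivity) t.2.1
  have h1 : stepSum A c n t D = centredCount A c n D ⌈2 * n * (t : ℝ)⌉₊ / √n := by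
    rw [stepSum, centredCount, filter_lt_eq_range n t.2.2]
    simp only [Nat.lt_ceil]
  rw [h1, countPath_apply, ← sub_div, abs_div, abs_of_nonneg (Real.sqrt_nonneg _)]
  exact div_le_div_of_nonneg_right
    (abs_linearInterp_sub_ceil_le (abs_centredCount_step_le hA n D) h0) (Real.sqrt_nonneg _)

theorem linearInterp_boundary (A c : ℝ) (n : ℕ) {a b : ℕ} (π : BoxPartition a b) (s : ℝ) :
    linearInterp (fun k => (π.boundary k : ℝ)) s =
      s - 2 * linearInterp (centredCount A c n (downSteps π)) s -
        2 * linearInterp (fun k => ∑ d ∈ Finset.range k, siteRate A c n d) s := by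
  have h : ∀ k, (π.boundary k : ℝ) = k - 2 * (centredCount A c n (downSteps π) k +
      ∑ d ∈ Finset.range k, siteRate A c n d) := fun k => by
    rw [boundary_eq, centredCount]; push_cast; ring
  simp only [linearInterp, h]
  push_cast
  ring

theorem abs_sum_siteRate_sub_le (hA : 0 < A) (hc : c ≠ 0) {n k : ℕ} (hn : 0 < n)
    (hk : k ≤ 2 * n) :
    |∑ d ∈ Finset.range k, siteRate A c n d - 2 * n * downMean A c (k * (1 / (2 * n)))| ≤
      2 * |c| := by
  have hn0 : (0 : ℝ) < n := by exact_mod_cast hn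
  have h := abs_riemann_sum_le (hasDerivAt_downMean hA hc) (downRate_lipschitz hA)
    (h := 1 / (2 * n)) (by positivity) (downMean_zero hA) k
  have hk' : (k : ℝ) ≤ 2 * n := by exact_mod_cast hk
  have e : ∑ d ∈ Finset.range k, siteRate A c n d - 2 * n * downMean A c (k * (1 / (2 * n))) =
      2 * n * (1 / (2 * n) * ∑ d ∈ Finset.range k, downRate A c (d * (1 / (2 * n))) -
        downMean A c (k * (1 / (2 * n)))) := by
    simp only [siteRate]
    field_simp
  rw [e, abs_mul, abs_of_pos (by positivity : (0 : ℝ) < 2 * n)]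
  refine (mul_le_mul_of_nonneg_left h (by positivity)).trans ?_
  have e2 : 2 * (n : ℝ) * (k * (2 * |c| * (1 / (2 * n)) ^ 2)) = 2 * |c| * (k / (2 * n)) := by
    field_simp
  rw [e2]
  exact mul_le_of_le_one_right (by positivity) ((div_le_one (by positivity)).2 hk')

theorem abs_linearInterp_siteRate_sub_le (hA : 0 < A) (hc : c ≠ 0) {n : ℕ} (hn : 0 < n) (t : I) :
    |linearInterp (fun k => ∑ d ∈ Finset.range k, siteRate A c n d) (2 * n * t) -
      2 * n * downMean A c t| ≤ 2 * |c| + 2 := by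
  have hn0 : (0 : ℝ) < n := by exact_mod_cast hn
  have h0 : (0 : ℝ) ≤ 2 * n * t := mul_nonneg (by positivity) t.2.1
  have hstep : ∀ k, |∑ d ∈ Finset.range (k + 1), siteRate A c n d -
      ∑ d ∈ Finset.range k, siteRate A c n d| ≤ 1 := fun k => by
    obtain ⟨h0, h1⟩ := siteRate_mem (c := c) hA n k
    rw [Finset.sum_range_succ, add_sub_cancel_left, abs_of_nonneg h0]
    exact h1
  set k := ⌊2 * n * (t : ℝ)⌋₊ with hkdef
  have h1 := abs_linearInterp_sub_floor_le
    (x := fun k => ∑ d ∈ Finset.range k, siteRate A c n d) hstep h0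
  have hk : k ≤ 2 * n := by
    have : 2 * n * (t : ℝ) ≤ (2 * n : ℕ) := by
      push_cast
      exact mul_le_of_le_one_right (by positivity) t.2.2
    exact (Nat.floor_le_floor this).trans (by rw [Nat.floor_natCast])
  have h2 := abs_sum_siteRate_sub_le (c := c) hA hc hn hk
  have h3 : |2 * n * downMean A c (k * (1 / (2 * n))) - 2 * n * downMean A c t| ≤ 1 := by
    rw [← mul_sub, abs_mul, abs_of_pos (by positivity : (0 : ℝ) < 2 * n)]
    refine (mul_le_mul_of_nonneg_left (downMean_lipschitz hA hc _ _) (by positivity)).trans ?_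
    rw [← abs_of_pos (by positivity : (0 : ℝ) < 2 * n), ← abs_mul,
      abs_of_pos (by positivity : (0 : ℝ) < 2 * n)]
    have e : 2 * (n : ℝ) * (k * (1 / (2 * n)) - t) = k - 2 * n * t := by field_simp
    rw [e, abs_le]
    constructor <;> linarith [Nat.floor_le h0, Nat.lt_floor_add_one (2 * n * (t : ℝ))]
  rw [← hkdef] at h1
  rw [abs_le] at *
  constructor <;> linarith [h1.1, h1.2, h2.1, h2.2, h3.1, h3.2]

/-- The fluctuation of the boundary is minus the centred number of down steps, up to the error of
the Riemann sum approximating the limit shape. -/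
theorem abs_fluctuation_add_countPath_le {ρ : ℝ} (hρ : ρ ∈ Set.Ioo (0 : ℝ) 1) (hc : c ≠ 0) {n : ℕ}
    (hn : 0 < n) {a b : ℕ} (π : BoxPartition a b) (t : I) :
    |fluctuation ρ c n π t + countPath (tilt ρ c) c n (downSteps π) t| ≤ (2 * |c| + 2) / √n := by
  have hn0 : (0 : ℝ) < n := by exact_mod_cast hn
  have hs : 0 < √(n : ℝ) := Real.sqrt_pos.2 hn0
  have hss : √(n : ℝ) * √n = n := Real.mul_self_sqrt hn0.le
  have e : fluctuation ρ c n π t + countPath (tilt ρ c) c n (downSteps π) t =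
      -(linearInterp (fun k => ∑ d ∈ Finset.range k, siteRate (tilt ρ c) c n d) (2 * n * t) -
        2 * n * downMean (tilt ρ c) c t) / √n := by
    rw [fluctuation, countPath_apply, linearInterp_boundary (tilt ρ c) c n, limitShape_eq hρ hc,
      eq_div_iff hs.ne', add_mul, div_mul_cancel₀ _ hs.ne', mul_comm (√(n : ℝ)) (_ - _), mul_assoc,
      hss]
    field_simp
    ring
  rw [e, abs_div, abs_neg, abs_of_pos hs]
  exact div_le_div_of_nonneg_right
    (abs_linearInterp_siteRate_sub_le (tilt_pos hρ hc) hc hn t) hs.le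

/-- The hypothesis on `a n` says that `a n` is within `o(√n)` of the mean number of down steps
before conditioning. -/
theorem tendsto_sum_siteRate_sub {ρ : ℝ} (hρ : ρ ∈ Set.Ioo (0 : ℝ) 1) (hc : c ≠ 0) {a : ℕ → ℕ}
    (ha : (fun n : ℕ => (a n : ℝ) / (2 * n) - ρ) =o[atTop] fun n : ℕ => 1 / √(n : ℝ)) :
    Tendsto (fun n : ℕ => (∑ d ∈ Finset.range (2 * n), siteRate (tilt ρ c) c n d - a n) / √(n : ℝ))
      atTop (𝓝 0) := by
  have hA := tilt_pos hρ hc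
  have h1 : Tendsto (fun n : ℕ => 2 * |c| / √(n : ℝ) +
      2 * |((a n : ℝ) / (2 * n) - ρ) / (1 / √(n : ℝ))|) atTop (𝓝 0) := by
    have h2 : Tendsto (fun n : ℕ => 2 * |c| / √(n : ℝ)) atTop (𝓝 0) :=
      tendsto_const_nhds.div_atTop (Real.tendsto_sqrt_atTop.comp tendsto_natCast_atTop_atTop)
    have h3 := (ha.tendsto_div_nhds_zero.abs).const_mul 2
    simpa using h2.add h3
  refine squeeze_zero_norm' ?_ h1
  filter_upwards [eventually_ge_atTop 1] with n hn
  have hn0 : (0 : ℝ) < n := by exact_mod_cast hn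
  have hs : 0 < √(n : ℝ) := Real.sqrt_pos.2 hn0
  have hss : √(n : ℝ) * √n = n := Real.mul_self_sqrt hn0.le
  have h2 := abs_sum_siteRate_sub_le (c := c) hA hc hn le_rfl
  have e1 : ((2 * n : ℕ) : ℝ) * (1 / (2 * n)) = 1 := by push_cast; field_simp
  rw [e1, downMean_one hρ hc] at h2
  have e : (∑ d ∈ Finset.range (2 * n), siteRate (tilt ρ c) c n d - a n) / √(n : ℝ) =
      (∑ d ∈ Finset.range (2 * n), siteRate (tilt ρ c) c n d - 2 * n * ρ) / √n -
        2 * (((a n : ℝ) / (2 * n) - ρ) / (1 / √(n : ℝ))) := by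
    have e2 : 2 * (((a n : ℝ) / (2 * n) - ρ) / (1 / √(n : ℝ))) = (a n - 2 * n * ρ) / √n := by
      rw [eq_div_iff hs.ne', div_div_eq_mul_div, div_one, mul_assoc, mul_assoc, hss]
      field_simp
    rw [e2]
    ring
  rw [e, Real.norm_eq_abs]
  refine (abs_sub _ _).trans (add_le_add ?_ (le_of_eq ?_))
  · rw [abs_div, abs_of_pos hs]
    exact div_le_div_of_nonneg_right h2 hs.le
  · rw [abs_mul, abs_two]

theorem sinh_comb_ne (ρ : ℝ) (hc : c ≠ 0) (t : I) :
    Real.sinh (c * t) + Real.exp (c * (2 * ρ - 1)) * Real.sinh (c * (1 - t)) ≠ 0 := fun h => by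
  have := sinh_comb_pos ρ c hc t
  rw [h, zero_div] at this
  exact this.false

theorem fluctScale_ne_zero {ρ : ℝ} (hρ : ρ ∈ Set.Ioo (0 : ℝ) 1) (hc : c ≠ 0) (t : I) :
    fluctScale ρ c t ≠ 0 := fun h => by
  have h1 := fluctScale_mul hρ hc (t : ℝ) t
  have hA := tilt_pos hρ hc
  rw [h, zero_mul] at h1
  exact (ne_of_lt (by positivity)) h1

/-- The factor `-1 / f` turning `countPath` into the normalized fluctuation. -/
def scaleFactor (ρ : ℝ) (hc : c ≠ 0) (hρ : ρ ∈ Set.Ioo (0 : ℝ) 1) : C(I, ℝ) where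
  toFun t := -(fluctScale ρ c t)⁻¹
  continuous_toFun := by
    refine (Continuous.inv₀ ?_ fun t => fluctScale_ne_zero hρ hc t).neg
    unfold fluctScale
    refine continuous_const.mul (continuous_const.div (by fun_prop) fun t => sinh_comb_ne ρ hc t)

/-- The normalized fluctuation, as a continuous path. -/
def fluctCont (ρ c : ℝ) (n : ℕ) {a b : ℕ} (π : BoxPartition a b) : C(I, ℝ) :=
  ⟨fun t => fluctuation ρ c n π t / fluctScale ρ c t, continuous_fluctuation_div ρ c n π⟩

theorem norm_fluctCont_sub_le {ρ : ℝ} (hρ : ρ ∈ Set.Ioo (0 : ℝ) 1) (hc : c ≠ 0) {n : ℕ}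
    (hn : 0 < n) {a b : ℕ} (π : BoxPartition a b) :
    ‖fluctCont ρ c n π - scaleFactor ρ hc hρ * countPath (tilt ρ c) c n (downSteps π)‖ ≤
      (2 * |c| + 2) / √n * ‖scaleFactor ρ hc hρ‖ := by
  rw [ContinuousMap.norm_le _ (by positivity)]
  intro t
  have e : (fluctCont ρ c n π - scaleFactor ρ hc hρ * countPath (tilt ρ c) c n (downSteps π)) t =
      -((fluctuation ρ c n π t + countPath (tilt ρ c) c n (downSteps π) t) *
        scaleFactor ρ hc hρ t) := by
    simp only [fluctCont, scaleFactor, ContinuousMap.sub_apply, ContinuousMap.mul_apply,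
      ContinuousMap.coe_mk]
    ring
  rw [e, norm_neg, norm_mul]
  exact mul_le_mul (abs_fluctuation_add_countPath_le hρ hc hn π t)
    (ContinuousMap.norm_coe_le_norm _ t) (norm_nonneg _) (by positivity)

/-- The error of the Riemann sum is the same path for all diagrams. -/
theorem fluctCont_sub_eq {ρ : ℝ} (hρ : ρ ∈ Set.Ioo (0 : ℝ) 1) (hc : c ≠ 0) {n : ℕ}
    (hn : 0 < n) {a b : ℕ} (π π' : BoxPartition a b) :
    fluctCont ρ c n π - scaleFactor ρ hc hρ * countPath (tilt ρ c) c n (downSteps π) =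
    fluctCont ρ c n π' - scaleFactor ρ hc hρ * countPath (tilt ρ c) c n (downSteps π') := by
  have hn0 : (0 : ℝ) < n := by exact_mod_cast hn
  have hs : 0 < √(n : ℝ) := Real.sqrt_pos.2 hn0
  have hss : √(n : ℝ) * √n = n := Real.mul_self_sqrt hn0.le
  ext t
  simp only [fluctCont, scaleFactor, ContinuousMap.sub_apply, ContinuousMap.mul_apply,
      ContinuousMap.coe_mk, countPath_apply, fluctuation, linearInterp_boundary (tilt ρ c) c n]
  have h : √(n : ℝ) * (1 / (2 * n)) * 2 = 1 / √n := by
    rw [eq_div_iff hs.ne', mul_assoc, mul_assoc, mul_comm, mul_assoc, mul_assoc, hss]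
    field_simp
  set g := linearInterp (centredCount (tilt ρ c) c n (downSteps π)) (2 * n * (t : ℝ))
  set g' := linearInterp (centredCount (tilt ρ c) c n (downSteps π')) (2 * n * (t : ℝ))
  linear_combination (g' - g) * (fluctScale ρ c t)⁻¹ * h

end Paths

/-! ### Convergence of the fluctuations -/

section Final

variable {A c : ℝ} {a b : ℕ → ℕ}

/-- For times at distance less than `1` the bound comes from the Lipschitz property of the
interpolation, otherwise from the bound at the integer parts. -/
theorem exists_linearInterp_fourth_moment_le (hA : 0 < A) (hc : c ≠ 0)
    (hab : ∀ n, 1 ≤ n → a n + b n = 2 * n)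
    (ha : Tendsto (fun n : ℕ => (∑ d ∈ Finset.range (2 * n), siteRate A c n d - a n) / √(n : ℝ))
      atTop (𝓝 0)) :
    ∃ C, 0 ≤ C ∧ ∀ᶠ n : ℕ in atTop, ∀ x y : ℝ, 0 ≤ y → y ≤ x → x ≤ 2 * n →
      ∫ π, (linearInterp (centredCount A c n (downSteps π)) x -
          linearInterp (centredCount A c n (downSteps π)) y) ^ 4
        ∂(boxLaw (a n) (b n) (Real.exp (-c / n)) (Real.exp_pos _) :
          Measure (BoxPartition (a n) (b n))) ≤
        C * (x - y) ^ 2 := by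
  obtain ⟨C, hC, hev⟩ := exists_count_fourth_moment_le hA hc hab ha
  refine ⟨32 * C + 128, by positivity, ?_⟩
  filter_upwards [hev] with n hn x y hy hyx hx
  have hx0 := hy.trans hyx
  set P : Measure (BoxPartition (a n) (b n)) :=
    (boxLaw (a n) (b n) (Real.exp (-c / n)) (Real.exp_pos _) : Measure (BoxPartition (a n) (b n)))
  have hconst : ∀ r : ℝ, ∫ _, r ∂P = r := fun r => by simp
  have hint : ∀ F : BoxPartition (a n) (b n) → ℝ, Integrable F P := fun F => Integrable.of_finite
  rcases le_or_gt (x - y) 1 with h1 | h1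
  · refine (integral_mono (hint _) (hint fun _ => (x - y) ^ 2) fun π => ?_).trans ?_
    · have h2 := abs_linearInterp_sub_le (abs_centredCount_step_le (c := c) hA n (downSteps π))
        hx0 hy
      rw [abs_of_nonneg (sub_nonneg.2 hyx)] at h2
      simp only
      rw [← Even.pow_abs (by decide : Even 4)]
      calc _ ≤ (x - y) ^ 4 := pow_le_pow_left₀ (abs_nonneg _) h2 4
        _ ≤ (x - y) ^ 2 := pow_le_pow_of_le_one (sub_nonneg.2 hyx) h1 (by norm_num)
    · rw [hconst]
      have := mul_nonneg hC (sq_nonneg (x - y))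
      nlinarith [sq_nonneg (x - y)]
  · set k := ⌊y⌋₊
    set l := ⌊x⌋₊
    have hkl : k ≤ l := Nat.floor_le_floor hyx
    have hl : l ≤ 2 * n := by
      have : x ≤ (2 * n : ℕ) := by push_cast; exact hx
      exact (Nat.floor_le_floor this).trans (by rw [Nat.floor_natCast])
    refine (integral_mono (hint _) (hint fun π => 8 * (centredCount A c n (downSteps π) l -
      centredCount A c n (downSteps π) k) ^ 4 + 128) fun π => ?_).trans ?_
    · have h2 := abs_linearInterp_sub_floor_le
        (abs_centredCount_step_le (c := c) hA n (downSteps π)) hx0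
      have h3 := abs_linearInterp_sub_floor_le
        (abs_centredCount_step_le (c := c) hA n (downSteps π)) hy
      change |_ - centredCount A c n (downSteps π) l| ≤ 1 at h2
      change |_ - centredCount A c n (downSteps π) k| ≤ 1 at h3
      simp only
      generalize linearInterp (centredCount A c n (downSteps π)) x = X at *
      generalize linearInterp (centredCount A c n (downSteps π)) y = Y at *
      generalize centredCount A c n (downSteps π) l = L at *
      generalize centredCount A c n (downSteps π) k = K at *
      have h4 : |X - Y| ≤ |L - K| + 2 := by
        have := abs_add_three (X - L) (L - K) (K - Y)
        rw [abs_sub_comm K Y] at this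
        rw [show X - Y = X - L + (L - K) + (K - Y) by ring]
        linarith
      rw [← Even.pow_abs (by decide : Even 4), ← Even.pow_abs (by decide : Even 4) (L - K)]
      refine (pow_le_pow_left₀ (abs_nonneg _) h4 4).trans
        ((add_pow_four_le _ _).trans (le_of_eq ?_))
      norm_num
    · rw [integral_add (hint _) (hint _), integral_const_mul, hconst]
      have h2 : ∫ π, (centredCount A c n (downSteps π) l - centredCount A c n (downSteps π) k) ^ 4
        ∂P ≤ C * ((l : ℝ) - k) ^ 2 := hn k l hkl hl
      have h3 : (l : ℝ) - k ≤ 2 * (x - y) := by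
        have := Nat.floor_le hx0
        have := Nat.lt_floor_add_one y
        linarith
      have h4 : (0 : ℝ) ≤ (l : ℝ) - k := sub_nonneg.2 (by exact_mod_cast hkl)
      have h5 := mul_le_mul_of_nonneg_left (pow_le_pow_left₀ h4 h3 2) hC
      nlinarith

/-- The law of a random continuous path attached to the random diagram. -/
def pathLaw (a b : ℕ) (q : ℝ) (hq : 0 < q) (Z : BoxPartition a b → C(I, ℝ)) :
    ProbabilityMeasure C(I, ℝ) :=
  (boxLaw a b q hq).map (f := Z) (show Measurable Z from fun _ _ => trivial).aemeasurable

theorem pathLaw_coe (a b : ℕ) (q : ℝ) (hq : 0 < q) (Z : BoxPartition a b → C(I, ℝ)) :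
    (pathLaw a b q hq Z : Measure C(I, ℝ)) = (boxMeasure a b q).map Z := rfl

/-- Tightness is kept by multiplication by a fixed path and addition of deterministic paths tending
to `0`. -/
theorem isTightMeasureSet_affine {Ω : ℕ → Type*} [∀ n, MeasurableSpace (Ω n)]
    {P : ∀ n, Measure (Ω n)} {Z X : ∀ n, Ω n → C(I, ℝ)} (hZ : ∀ n, Measurable (Z n))
    (hX : ∀ n, Measurable (X n)) {h : ℕ → C(I, ℝ)} (hh : Tendsto h atTop (𝓝 0)) (u : C(I, ℝ))
    (hXZ : ∀ n w, X n w = u * Z n w + h n)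
    (ht : IsTightMeasureSet {x | ∃ n, (P n).map (Z n) = x}) :
    IsTightMeasureSet {x | ∃ n, (P n).map (X n) = x} := by
  rw [isTightMeasureSet_iff_exists_isCompact_measure_compl_le] at ht ⊢
  intro ε hε
  obtain ⟨K, hK, hKε⟩ := ht ε hε
  have hcomp : IsCompact ((fun p : C(I, ℝ) × C(I, ℝ) => u * p.1 + p.2) ''
      (K ×ˢ insert 0 (Set.range h))) :=
    (hK.prod hh.isCompact_insert_range).image (by fun_prop)
  refine ⟨_, hcomp, ?_⟩
  rintro _ ⟨n, rfl⟩
  refine le_trans ?_ (hKε _ ⟨n, rfl⟩)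
  rw [Measure.map_apply (hX n) hcomp.isClosed.measurableSet.compl,
    Measure.map_apply (hZ n) hK.isClosed.measurableSet.compl]
  refine measure_mono fun w hw hw' => hw ?_
  exact ⟨(Z n w, h n), ⟨hw', Set.mem_insert_of_mem _ ⟨n, rfl⟩⟩, (hXZ n w).symm⟩

theorem norm_exp_sub_exp_le (x y : ℝ) :
    ‖Complex.exp (x * Complex.I) - Complex.exp (y * Complex.I)‖ ≤ |x - y| := by
  have e : Complex.exp (x * Complex.I) - Complex.exp (y * Complex.I) =
      Complex.exp (y * Complex.I) * (Complex.exp (Complex.I * ((x - y : ℝ) : ℂ)) - 1) := by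
    rw [mul_sub, ← Complex.exp_add, mul_one]
    congr 2
    push_cast
    ring
  rw [e, norm_mul, Complex.norm_exp_ofReal_mul_I, one_mul]
  exact Real.norm_exp_I_mul_ofReal_sub_one_le

theorem tendsto_const_div_sqrt (K : ℝ) :
    Tendsto (fun n : ℕ => K / √(n : ℝ)) atTop (𝓝 0) :=
  tendsto_const_nhds.div_atTop (Real.tendsto_sqrt_atTop.comp tendsto_natCast_atTop_atTop)

/-- The normalized fluctuation is the normalized number of down steps, up to `O(1 / √n)`. -/
theorem abs_fluctCont_sub_le {ρ : ℝ} (hρ : ρ ∈ Set.Ioo (0 : ℝ) 1) (hc : c ≠ 0) {n : ℕ}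
    (hn : 0 < n) {a b : ℕ} (π : BoxPartition a b) (t : I) :
    |fluctCont ρ c n π t - scaleFactor ρ hc hρ t * stepSum (tilt ρ c) c n t (downSteps π)| ≤
      (2 * |c| + 3) * ‖scaleFactor ρ hc hρ‖ / √n := by
  have h1 := (ContinuousMap.norm_coe_le_norm _ t).trans (norm_fluctCont_sub_le hρ hc hn π)
  have h2 := abs_countPath_sub_stepSum_le (c := c) (tilt_pos hρ hc) n (downSteps π) t
  have h3 := mul_le_mul (ContinuousMap.norm_coe_le_norm (scaleFactor ρ hc hρ) t) h2 (abs_nonneg _)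
    (norm_nonneg _)
  rw [Real.norm_eq_abs, ← abs_mul] at h3
  rw [ContinuousMap.sub_apply, ContinuousMap.mul_apply, Real.norm_eq_abs] at h1
  have h4 := abs_add_le (fluctCont ρ c n π t -
    scaleFactor ρ hc hρ t * countPath (tilt ρ c) c n (downSteps π) t) (scaleFactor ρ hc hρ t *
      (countPath (tilt ρ c) c n (downSteps π) t - stepSum (tilt ρ c) c n t (downSteps π)))
  rw [mul_sub, sub_add_sub_cancel, ← mul_sub] at h4
  refine h4.trans ((add_le_add h1 h3).trans (le_of_eq ?_))
  ring

theorem tendsto_charFun_fluctCont {ρ : ℝ} (hρ : ρ ∈ Set.Ioo (0 : ℝ) 1) (hc : c ≠ 0)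
    (hab : ∀ n, 1 ≤ n → a n + b n = 2 * n)
    (ha : (fun n : ℕ => (a n : ℝ) / (2 * n) - ρ) =o[atTop] fun n : ℕ => 1 / √(n : ℝ))
    (J : Finset I) (l : I → ℝ) :
    Tendsto (fun n : ℕ => ∫ x, Complex.exp ((evalSum J l x : ℂ) * Complex.I)
        ∂(pathLaw (a n) (b n) (Real.exp (-c / n)) (Real.exp_pos _) (fluctCont ρ c n) :
          Measure C(I, ℝ))) atTop
      (𝓝 (Complex.exp (((-(∑ s ∈ J, ∑ t ∈ J, l s * l t * (scaleFactor ρ hc hρ s *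
        scaleFactor ρ hc hρ t * stepCov (tilt ρ c) c s t)) / 2 : ℝ)) : ℂ))) := by
  set u := scaleFactor ρ hc hρ
  have h1 := tendsto_charFun_stepSum (tilt_pos hρ hc) hc hab
    (tendsto_sum_siteRate_sub hρ hc ha) J (fun t => l t * u t)
  have e : ∑ s ∈ J, ∑ t ∈ J, l s * l t * (u s * u t * stepCov (tilt ρ c) c s t) =
      ∑ s ∈ J, ∑ t ∈ J, l s * u s * (l t * u t) * stepCov (tilt ρ c) c s t :=
    Finset.sum_congr rfl fun s _ => Finset.sum_congr rfl fun t _ => by ring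
  rw [e]
  refine tendsto_of_tendsto_of_dist h1 ?_
  have h2 := tendsto_const_div_sqrt ((∑ t ∈ J, |l t|) * ((2 * |c| + 3) * ‖u‖))
  refine squeeze_zero' (Eventually.of_forall fun _ => dist_nonneg) ?_ h2
  filter_upwards [eventually_ge_atTop 1] with n hn
  have hmeas : Measurable (fluctCont ρ c n : BoxPartition (a n) (b n) → C(I, ℝ)) :=
    fun _ _ => trivial
  rw [pathLaw_coe, integral_map hmeas.aemeasurable
    (Continuous.aestronglyMeasurable (by fun_prop)), dist_eq_norm,
    ← integral_sub (integrable_box _) (integrable_box _)]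
  have hprob : (boxMeasure (a n) (b n) (Real.exp (-c / n))).real Set.univ = 1 := by
    have : IsProbabilityMeasure (boxMeasure (a n) (b n) (Real.exp (-c / n))) :=
      (boxLaw (a n) (b n) (Real.exp (-c / n)) (Real.exp_pos _)).2
    simp
  refine (norm_integral_le_of_norm_le_const (Eventually.of_forall fun π => ?_)).trans
    (le_of_eq (by rw [hprob, mul_one]))
  rw [norm_sub_rev]
  refine (norm_exp_sub_exp_le _ _).trans ?_
  rw [evalSum_apply, ← Finset.sum_sub_distrib, Finset.sum_mul, Finset.sum_div]
  refine (Finset.abs_sum_le_sum_abs _ _).trans (Finset.sum_le_sum fun t _ => ?_)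
  rw [mul_assoc, ← mul_sub, abs_mul, mul_div_assoc]
  exact mul_le_mul_of_nonneg_left (abs_fluctCont_sub_le hρ hc hn π t) (abs_nonneg _)

/-- Tightness of the laws of the normalized fluctuations, from some index on. -/
theorem exists_isTightMeasureSet_fluctCont {ρ : ℝ} (hρ : ρ ∈ Set.Ioo (0 : ℝ) 1) (hc : c ≠ 0)
    (hab : ∀ n, 1 ≤ n → a n + b n = 2 * n)
    (ha : (fun n : ℕ => (a n : ℝ) / (2 * n) - ρ) =o[atTop] fun n : ℕ => 1 / √(n : ℝ)) :
    ∃ N, IsTightMeasureSet {x | ∃ n, (pathLaw (a (n + N)) (b (n + N))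
      (Real.exp (-c / (n + N : ℕ))) (Real.exp_pos _) (fluctCont ρ c (n + N)) :
        Measure C(I, ℝ)) = x} := by
  have hA := tilt_pos hρ hc
  obtain ⟨C, hC, hev⟩ := exists_linearInterp_fourth_moment_le hA hc hab
    (tendsto_sum_siteRate_sub hρ hc ha)
  obtain ⟨N₀, hN₀⟩ := eventually_atTop.1 hev
  set u := scaleFactor ρ hc hρ
  set N := N₀ + 1
  refine ⟨N, ?_⟩
  set Z : ∀ n, BoxPartition (a n) (b n) → C(I, ℝ) := fun n π =>
    countPath (tilt ρ c) c n (downSteps π) with hZdef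
  have htight : IsTightMeasureSet {x | ∃ n, (pathLaw (a (n + N)) (b (n + N))
      (Real.exp (-c / (n + N : ℕ))) (Real.exp_pos _) (Z (n + N)) : Measure C(I, ℝ)) = x} := by
    have hZm : ∀ n, Measurable (Z n) := fun _ _ _ => trivial
    refine isTightMeasureSet_of_fourth_moment
      (fun n => pathLaw (a (n + N)) (b (n + N)) (Real.exp (-c / (n + N : ℕ))) (Real.exp_pos _)
        (Z (n + N))) (fun n => ?_) (4 * C) (by positivity) fun n s t => ?_
    · have hclosed : IsClosed {x : C(I, ℝ) | x 0 = 0} :=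
        isClosed_singleton.preimage (continuous_eval_const (0 : I))
      rw [pathLaw_coe, ae_map_iff (hZm _).aemeasurable hclosed.measurableSet]
      exact Eventually.of_forall fun π => countPath_zero _ _
    · rw [pathLaw_coe, lintegral_map (by
        have : Continuous fun x : C(I, ℝ) => (x s - x t) ^ 4 := by fun_prop
        exact this.measurable.ennreal_ofReal) (hZm _),
        ← ofReal_integral_eq_lintegral_ofReal (integrable_box _)
          (Eventually.of_forall fun π => Even.pow_nonneg (by decide) _)]
      refine ENNReal.ofReal_le_ofReal ?_
      have hm : 0 < n + N := by omega
      have hmain := hN₀ (n + N) (by omega)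
      generalize n + N = m at *
      have hm0 : (0 : ℝ) < m := by exact_mod_cast hm
      have hss : √(m : ℝ) ^ 4 = (m : ℝ) ^ 2 := by
        rw [show √(m : ℝ) ^ 4 = (√(m : ℝ) ^ 2) ^ 2 by ring, Real.sq_sqrt hm0.le]
      wlog hst : t ≤ s generalizing s t
      · have h1 := this t s (le_of_not_ge hst)
        have e1 : ((t : ℝ) - s) ^ 2 = ((s : ℝ) - t) ^ 2 := by ring
        rw [e1] at h1
        refine le_trans (le_of_eq (integral_congr_ae (Eventually.of_forall fun π => ?_))) h1
        simp only
        ring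
      have hst' : (t : ℝ) ≤ s := hst
      have h1 := hmain (2 * m * s) (2 * m * t) (mul_nonneg (by positivity) t.2.1)
        (mul_le_mul_of_nonneg_left hst' (by positivity))
        (mul_le_of_le_one_right (by positivity) s.2.2)
      have e1 : ∀ π : BoxPartition (a m) (b m), (Z m π s - Z m π t) ^ 4 = ((m : ℝ) ^ 2)⁻¹ *
          (linearInterp (centredCount (tilt ρ c) c m (downSteps π)) (2 * m * s) -
          linearInterp (centredCount (tilt ρ c) c m (downSteps π)) (2 * m * t)) ^ 4 := by
        intro π
        rw [hZdef, countPath_apply, countPath_apply, ← sub_div, div_pow, hss,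
          div_eq_inv_mul]
      simp only [e1]
      rw [integral_const_mul, inv_mul_le_iff₀ (by positivity)]
      refine h1.trans (le_of_eq ?_)
      ring
  set h : ℕ → C(I, ℝ) := fun n => fluctCont ρ c (n + N)
    (Classical.arbitrary (BoxPartition (a (n + N)) (b (n + N)))) -
      u * Z (n + N) (Classical.arbitrary _) with hh
  refine isTightMeasureSet_affine (P := fun n => boxMeasure (a (n + N)) (b (n + N))
    (Real.exp (-c / (n + N : ℕ)))) (Z := fun n => Z (n + N)) (X := fun n => fluctCont ρ c (n + N))
    (h := h) (fun n _ _ => trivial) (fun n _ _ => trivial) ?_ u (fun n π => ?_) htight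
  · have h1 := (tendsto_add_atTop_iff_nat N).2
      (tendsto_const_div_sqrt ((2 * |c| + 2) * ‖u‖))
    refine squeeze_zero_norm (fun n => ?_) h1
    refine (norm_fluctCont_sub_le hρ hc (by omega) _).trans (le_of_eq ?_)
    ring
  · rw [hh]
    simp only
    rw [fluctCont_sub_eq hρ hc (by omega) (Classical.arbitrary _) π]
    ring

end Final

end BoxedDiagrams

end

theorem theorem2 (ρ c : ℝ) (hρ : ρ ∈ Set.Ioo (0 : ℝ) 1) (hc : c ≠ 0) (a b : ℕ → ℕ)
    (hab : ∀ n, 1 ≤ n → 0 < a n ∧ 0 < b n ∧ a n + b n = 2 * n)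
    (haρ : (fun n : ℕ => (a n : ℝ) / (2 * n) - ρ) =o[atTop] fun n : ℕ => 1 / √(n : ℝ)) :
    ∃ ν : ProbabilityMeasure BoxedDiagrams.CadlagPath,
      BoxedDiagrams.IsOUBridge c (fun t (y : BoxedDiagrams.CadlagPath) => y t) (ν : Measure _) ∧
      TendstoInDistribution
        (fun n (π : BoxedDiagrams.BoxPartition (a n) (b n)) => BoxedDiagrams.fluctPath ρ c n π)
        atTop (fun y : BoxedDiagrams.CadlagPath => y)
        (fun n => (BoxedDiagrams.boxLaw (a n) (b n) (Real.exp (-c / n)) (Real.exp_pos _) :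
          Measure (BoxedDiagrams.BoxPartition (a n) (b n))))
        (ν : Measure _) := by
  have hab' : ∀ n, 1 ≤ n → a n + b n = 2 * n := fun n hn => (hab n hn).2.2
  obtain ⟨N, hN⟩ := BoxedDiagrams.exists_isTightMeasureSet_fluctCont hρ hc hab' haρ
  obtain ⟨μ₀, hμ, hφ⟩ := BoxedDiagrams.exists_tendsto_of_tight_of_charFun _ hN _ fun J l =>
    (tendsto_add_atTop_iff_nat N).2
      (BoxedDiagrams.tendsto_charFun_fluctCont hρ hc hab' haρ J l)
  rw [tendsto_add_atTop_iff_nat N (f := fun n => BoxedDiagrams.pathLaw (a n) (b n)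
    (Real.exp (-c / n)) (Real.exp_pos _) (BoxedDiagrams.fluctCont ρ c n))] at hμ
  obtain ⟨hg, h0, hcov⟩ := BoxedDiagrams.gaussianProcess_of_charFun μ₀
    (fun s t => BoxedDiagrams.scaleFactor ρ hc hρ s * BoxedDiagrams.scaleFactor ρ hc hρ t *
      BoxedDiagrams.stepCov (BoxedDiagrams.tilt ρ c) c s t)
    (fun s t => by simp only [BoxedDiagrams.stepCov, min_comm (t : ℝ)]; ring) hφ
  have hmeas : Measurable BoxedDiagrams.toCadlag :=
    BoxedDiagrams.measurableEmbedding_toCadlag.measurable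
  refine ⟨μ₀.map hmeas.aemeasurable, BoxedDiagrams.isOUBridge_map_toCadlag c μ₀ hg h0
    fun s t hst => ?_, ?_⟩
  · rw [hcov, ← BoxedDiagrams.stepCov_div hρ hc (show (s : ℝ) ≤ t from hst)]
    simp only [BoxedDiagrams.scaleFactor, ContinuousMap.coe_mk]
    rw [neg_mul_neg, ← mul_inv, inv_mul_eq_div]
  · have hlim := ProbabilityMeasure.tendsto_map_of_tendsto_of_continuous _ _ hμ
      BoxedDiagrams.isClosedEmbedding_toCadlag.continuous
    refine ⟨fun n => (show Measurable (BoxedDiagrams.fluctPath ρ c n) from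
      fun _ _ => trivial).aemeasurable, aemeasurable_id, ?_⟩
    refine Tendsto.congr (fun n => Subtype.ext ?_)
      (hlim.trans (le_of_eq (congrArg 𝓝 (Subtype.ext Measure.map_id.symm))))
    exact Measure.map_map hmeas (fun _ _ => trivial)
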